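/- Let $b\ge 0$ be an integer and let $A_b=\mathbb{C}[x_0,\dots,x_{b+1}]/(x_ix_j-x_kx_l : i+j=k+l)$ be the homogeneous coordinate ring of the Veronese curve $\mathbb{P}^1\hookrightarrow\mathbb{P}^{b+1}$ of degree $b+1$, graded by $\deg x_i=1$. Let $L^b=\bigoplus_{n\ge1}L^b_n$ be its Koszul dual Lie algebra: the graded Lie algebra (in the super sense: $[x,y]=-(-1)^{ij}[y,x]$ and $[x,[y,z]]=[[x,y],z]+(-1)^{ij}[y,[x,z]]$ for $x\in L^b_i$, $y\in L^b_j$) generated by the dual basis $y_i=x_i^*$ $(0\le i\le b+1)$ placed in degree $1$, with the relations $\sum_{i,j} g_{ij}[y_i,y_j]=0$ for all $g=\sum g_{ij}\,y_i\otimes y_j$ in the annihilator $R^\perp$ of the space $R\subset V\otimes V$ ($V=\langle x_0,\dots,x_{b+1}\rangle$) of quadratic relations of $A_b$; equivalently, with the relations $\sum_{i+j=k}[y_i,y_j]=0$, $k=0,\dots,2(b+1)$. Let $C^\cdot(L^b)=S(L^b_1)^*\otimes\Lambda (L^b_2)^*\otimes S(L^b_3)^*\otimes\cdots$ be its Chevalley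 cochain complex, with the Chevalley differential (the derivation that is the transpose of the bracket on generators), doubly graded by giving $(L^b_i)^*$ homological degree $i-1$ and polynomial degree $i$. Each component $C^\cdot(L^b)_{a,n}$ is finite-dimensional and vanishes for $a>n$, so that the Euler–Hilbert series $$EH(C^\cdot(L^b);t)=\sum_{n\ge0}\Big(\sum_{a\ge0}(-1)^a\dim C^\cdot(L^b)_{a,n}\Big)t^n\in\mathbb{Z}[[t]]$$ is defined. For $n\ge1$ put $M_n(x)=\frac1n\sum_{d\mid n}\mu(d)x^{n/d}$. Then every $M_n(-b)$ is an integer, the infinite products below converge in $\mathbb{Z}[[t]]$ (coefficientwise), and $$EH(C^\cdot(L^b);t)=\prod_{n\ge1}(1-t^n)^{(-1)^n\dim L^b_n}=(1-t)^{-2}\prod_{n\ge1}(1-t^n)^{M_n(-b)}=\frac{1+bt}{(1-t)^2}.$$ Moreover, this series is the Hilbert series $\sum_{n\ge0}\dim (A_b)_n\,t^n$ of $A_b$. -/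

import Mathlib

noncomputable section

/-- A positively graded Lie algebra `L = ⨁_{n ≥ 1} L_n` over `ℂ` with finite-dimensional components, in
the signed (super) sense: the parity of an element of `L_n` is the parity of `n`. The component
`part n` is `L_n`, and `bracket h : L_i → L_j → L_n`, where `h : i + j = n`, is the bracket. It
satisfies `[x, y] = -(-1)^{ij} [y, x]` and the signed Jacobi identity
`[x, [y, z]] = [[x, y], z] + (-1)^{ij} [y, [x, z]]` for `x ∈ L_i` and `y ∈ L_j`. -/
structure PosGradedLie where
  part : ℕ → Type
  [addCommGroup : ∀ n, AddCommGroup (part n)]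
  [module : ∀ n, Module ℂ (part n)]
  [finite : ∀ n, FiniteDimensional ℂ (part n)]
  part_zero : Subsingleton (part 0)
  bracket : ∀ {i j n : ℕ}, i + j = n → part i →ₗ[ℂ] part j →ₗ[ℂ] part n
  skew : ∀ {i j n : ℕ} (h : i + j = n) (h' : j + i = n) (x : part i) (y : part j),
    bracket h x y = -((-1 : ℂ) ^ (i * j) • bracket h' y x)
  jacobi : ∀ {i j k p q r n : ℕ} (hp : j + k = p) (hip : i + p = n) (hq : i + j = q)
    (hqk : q + k = n) (hr : i + k = r) (hjr : j + r = n) (x : part i) (y : part j) (z : part k),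
    bracket hip x (bracket hp y z) =
      bracket hqk (bracket hq x y) z + (-1 : ℂ) ^ (i * j) • bracket hjr y (bracket hr x z)

attribute [instance] PosGradedLie.addCommGroup PosGradedLie.module
  PosGradedLie.finite

namespace PosGradedLie

/-! ### Graded Lie algebras with generators of degree one and quadratic relations -/

/-- A nonassociative word in the letters `y_i`, as an element of the free nonassociative algebra. -/
def word {ι : Type} (w : FreeMagma ι) : FreeNonUnitalNonAssocAlgebra ℂ ι :=
  MonoidAlgebra.ofMagma ℂ (FreeMagma ι) w

theorem word_mul {ι : Type} (u v : FreeMagma ι) : word (u * v) = word u * word v :=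
  map_mul _ u v

/-- The relators of the graded Lie algebra on generators `y_i` of degree one with the relations
`∑ g_ij [y_i, y_j] = 0` for `g ∈ Q`: signed antisymmetry and the signed Jacobi identity for words
(the degree of a word is its length), and the given quadratic relations. -/
inductive IsRelator {ι : Type} [Fintype ι] (Q : Set (ι → ι → ℂ)) :
    FreeNonUnitalNonAssocAlgebra ℂ ι → Prop
  | skew (u v : FreeMagma ι) :
      IsRelator Q (word u * word v + (-1 : ℂ) ^ (u.length * v.length) • (word v * word u))
  | jacobi (u v w : FreeMagma ι) :
      IsRelator Q (word u * (word v * word w) - (word u * word v) * word w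
        - (-1 : ℂ) ^ (u.length * v.length) • (word v * (word u * word w)))
  | quadratic (g : ι → ι → ℂ) (hg : g ∈ Q) :
      IsRelator Q (∑ i, ∑ j, g i j • (word (.of i) * word (.of j)))

/-- The two-sided ideal generated by the relators. -/
def relatorIdeal {ι : Type} [Fintype ι] (Q : Set (ι → ι → ℂ)) :
    Submodule ℂ (FreeNonUnitalNonAssocAlgebra ℂ ι) :=
  sInf {J | (∀ x, IsRelator Q x → x ∈ J) ∧ ∀ x ∈ J, ∀ y, x * y ∈ J ∧ y * x ∈ J}

section presented

variable {ι : Type} [Fintype ι] (Q : Set (ι → ι → ℂ))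

theorem relatorIdeal_of {x : FreeNonUnitalNonAssocAlgebra ℂ ι} (hx : IsRelator Q x) :
    x ∈ relatorIdeal Q :=
  Submodule.mem_sInf.2 fun _ hJ => hJ.1 x hx

theorem relatorIdeal_mul {x : FreeNonUnitalNonAssocAlgebra ℂ ι} (hx : x ∈ relatorIdeal Q)
    (y : FreeNonUnitalNonAssocAlgebra ℂ ι) :
    x * y ∈ relatorIdeal Q ∧ y * x ∈ relatorIdeal Q :=
  ⟨Submodule.mem_sInf.2 fun J hJ => (hJ.2 x (Submodule.mem_sInf.1 hx J hJ) y).1,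
    Submodule.mem_sInf.2 fun J hJ => (hJ.2 x (Submodule.mem_sInf.1 hx J hJ) y).2⟩

/-- The quotient of the free nonassociative algebra by the ideal of relators. -/
abbrev PresentedCarrier : Type := FreeNonUnitalNonAssocAlgebra ℂ ι ⧸ relatorIdeal Q

/-- The product (the bracket) of the quotient algebra. -/
def presentedMul : PresentedCarrier Q →ₗ[ℂ] PresentedCarrier Q →ₗ[ℂ] PresentedCarrier Q :=
  (relatorIdeal Q).liftQ
    (LinearMap.flip ((relatorIdeal Q).liftQ
      (LinearMap.flip ((LinearMap.mul ℂ (FreeNonUnitalNonAssocAlgebra ℂ ι)).compr₂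
        (relatorIdeal Q).mkQ))
      (fun x hx => by
        refine LinearMap.ext fun y => ?_
        simpa using (relatorIdeal_mul Q hx y).2)))
    (fun x hx => by
      refine LinearMap.ext fun y => ?_
      obtain ⟨y, rfl⟩ := (relatorIdeal Q).mkQ_surjective y
      exact (Submodule.Quotient.mk_eq_zero _).2 (relatorIdeal_mul Q hx y).1)

theorem presentedMul_mk (x y : FreeNonUnitalNonAssocAlgebra ℂ ι) :
    presentedMul Q ((relatorIdeal Q).mkQ x) ((relatorIdeal Q).mkQ y) =
      (relatorIdeal Q).mkQ (x * y) := rfl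

/-- The homogeneous component of degree `n`: the span of the classes of the words of length `n`. -/
def presentedPart (n : ℕ) : Submodule ℂ (PresentedCarrier Q) :=
  Submodule.span ℂ {x | ∃ w : FreeMagma ι, w.length = n ∧ (relatorIdeal Q).mkQ (word w) = x}

theorem presentedMul_mem {i j n : ℕ} (h : i + j = n) {x y : PresentedCarrier Q}
    (hx : x ∈ presentedPart Q i) (hy : y ∈ presentedPart Q j) :
    presentedMul Q x y ∈ presentedPart Q n := by
  have := Submodule.apply_mem_map₂ (presentedMul Q) hx hy
  rw [presentedPart, presentedPart, Submodule.map₂_span_span] at this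
  refine Submodule.span_mono ?_ this
  rintro _ ⟨_, ⟨u, hu, rfl⟩, _, ⟨v, hv, rfl⟩, rfl⟩
  exact ⟨u * v, by simp [hu, hv, h], by rw [word_mul]; rfl⟩

theorem finite_words (n : ℕ) : {w : FreeMagma ι | w.length = n}.Finite := by
  induction n using Nat.strong_induction_on with
  | _ n ih =>
    have h2 : (⋃ i ∈ Set.Iio n, ⋃ j ∈ Set.Iio n,
        Set.image2 (fun u v : FreeMagma ι => u * v)
          {w | w.length = i} {w | w.length = j}).Finite :=
      (Set.finite_Iio n).biUnion fun i hi => (Set.finite_Iio n).biUnion fun j hj =>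
        (ih i hi).image2 _ (ih j hj)
    refine ((Set.finite_range (FreeMagma.of : ι → FreeMagma ι)).union h2).subset ?_
    rintro (i | ⟨u, v⟩) hw
    · exact Or.inl ⟨i, rfl⟩
    · right
      have hw' : u.length + v.length = n := hw
      have hu := u.length_pos
      have hv := v.length_pos
      simp only [Set.mem_iUnion]
      exact ⟨u.length, by simp; omega, v.length, by simp; omega, u, rfl, v, rfl, rfl⟩

instance presentedPart_finite (n : ℕ) : FiniteDimensional ℂ (presentedPart Q n) := by
  refine FiniteDimensional.span_of_finite ℂ ?_
  refine ((finite_words (ι := ι) n).image fun w => (relatorIdeal Q).mkQ (word w)).subset ?_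
  rintro _ ⟨w, hw, rfl⟩
  exact ⟨w, hw, rfl⟩

theorem presentedMul_skew {i j : ℕ} {x y : PresentedCarrier Q}
    (hx : x ∈ presentedPart Q i) (hy : y ∈ presentedPart Q j) :
    presentedMul Q x y = -((-1 : ℂ) ^ (i * j) • presentedMul Q y x) := by
  induction hx using Submodule.span_induction with
  | mem x hx =>
    obtain ⟨u, rfl, rfl⟩ := hx
    induction hy using Submodule.span_induction with
    | mem y hy =>
      obtain ⟨v, rfl, rfl⟩ := hy
      have := relatorIdeal_of Q (IsRelator.skew (Q := Q) u v)
      rw [← Submodule.Quotient.mk_eq_zero, ← Submodule.mkQ_apply, map_add, map_smul] at this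
      rw [presentedMul_mk, presentedMul_mk]
      exact eq_neg_of_add_eq_zero_left this
    | zero => simp
    | add y z _ _ hy hz => simp only [map_add, LinearMap.add_apply, hy, hz, smul_add, neg_add]
    | smul c y _ hy => simp only [map_smul, LinearMap.smul_apply, hy, smul_neg, smul_comm c]
  | zero => simp
  | add y z _ _ hy hz => simp only [map_add, LinearMap.add_apply, hy, hz, smul_add, neg_add]
  | smul c y _ hy => simp only [map_smul, LinearMap.smul_apply, hy, smul_neg, smul_comm c]

theorem presentedMul_jacobi {i j k : ℕ} {x y z : PresentedCarrier Q}
    (hx : x ∈ presentedPart Q i) (hy : y ∈ presentedPart Q j) (hz : z ∈ presentedPart Q k) :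
    presentedMul Q x (presentedMul Q y z) = presentedMul Q (presentedMul Q x y) z +
      (-1 : ℂ) ^ (i * j) • presentedMul Q y (presentedMul Q x z) := by
  induction hx using Submodule.span_induction with
  | mem x hx =>
    obtain ⟨u, rfl, rfl⟩ := hx
    induction hy using Submodule.span_induction with
    | mem y hy =>
      obtain ⟨v, rfl, rfl⟩ := hy
      induction hz using Submodule.span_induction with
      | mem z hz =>
        obtain ⟨w, rfl, rfl⟩ := hz
        have := relatorIdeal_of Q (IsRelator.jacobi (Q := Q) u v w)
        rw [← Submodule.Quotient.mk_eq_zero, ← Submodule.mkQ_apply, map_sub, map_sub,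
          map_smul, sub_sub, sub_eq_zero] at this
        simpa only [presentedMul_mk] using this
      | zero => simp
      | add y z _ _ hy hz => simp only [map_add, hy, hz, smul_add]; abel
      | smul c y _ hy => simp only [map_smul, hy, smul_add, smul_comm c]
    | zero => simp
    | add y z _ _ hy hz => simp only [map_add, LinearMap.add_apply, hy, hz, smul_add]; abel
    | smul c y _ hy => simp only [map_smul, LinearMap.smul_apply, hy, smul_add, smul_comm c]
  | zero => simp
  | add y z _ _ hy hz => simp only [map_add, LinearMap.add_apply, hy, hz, smul_add]; abel
  | smul c y _ hy => simp only [map_smul, LinearMap.smul_apply, hy, smul_add, smul_comm c]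

end presented

/-- The graded Lie algebra generated by elements `y_i` of degree one subject to the relations
`∑ g_ij [y_i, y_j] = 0` for all `g ∈ Q`. -/
def presented {ι : Type} [Fintype ι] (Q : Set (ι → ι → ℂ)) : PosGradedLie where
  part n := presentedPart Q n
  part_zero := by
    rw [Submodule.subsingleton_iff_eq_bot, presentedPart, Submodule.span_eq_bot]
    rintro _ ⟨w, hw, -⟩
    exact absurd hw w.length_pos.ne'
  bracket {i j n} h := LinearMap.mk₂ ℂ
    (fun x y => ⟨presentedMul Q x.1 y.1, presentedMul_mem Q h x.2 y.2⟩)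
    (fun x x' y => Subtype.ext (by simp)) (fun c x y => Subtype.ext (by simp))
    (fun x y y' => Subtype.ext (by simp)) (fun c x y => Subtype.ext (by simp))
  skew h h' x y := Subtype.ext (presentedMul_skew Q x.2 y.2)
  jacobi _ _ _ _ _ _ x y z := Subtype.ext (presentedMul_jacobi Q x.2 y.2 z.2)

/-! ### The Chevalley cochain complex

As a graded algebra, `C(L) = S(L_1^*) ⊗ Λ(L_2^*) ⊗ S(L_3^*) ⊗ ⋯`. Since the symmetric and the exterior
algebra turn direct sums into tensor products, this is the tensor product of the symmetric algebra of
`⨁_{n odd} L_n^*` and the exterior algebra of `⨁_{n even} L_n^*`. -/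

variable (L : PosGradedLie)

/-- The direct sum of the dual spaces `L_n^*` over odd `n`. -/
abbrev oddDual : Type := DirectSum {n : ℕ // Odd n} fun n => Module.Dual ℂ (L.part n)

/-- The direct sum of the dual spaces `L_n^*` over even `n`. -/
abbrev evenDual : Type := DirectSum {n : ℕ // Even n} fun n => Module.Dual ℂ (L.part n)

/-- The algebra `C(L)` of Chevalley cochains (without its gradings and its differential). -/
def Cochains : Type :=
  TensorProduct ℂ (SymmetricAlgebra ℂ L.oddDual) (ExteriorAlgebra ℂ L.evenDual)

instance : Ring L.Cochains :=
  inferInstanceAs (Ring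
    (TensorProduct ℂ (SymmetricAlgebra ℂ L.oddDual) (ExteriorAlgebra ℂ L.evenDual)))

instance : Algebra ℂ L.Cochains :=
  inferInstanceAs (Algebra ℂ
    (TensorProduct ℂ (SymmetricAlgebra ℂ L.oddDual) (ExteriorAlgebra ℂ L.evenDual)))

/-- The inclusion of the symmetric algebra. -/
def ofSym : SymmetricAlgebra ℂ L.oddDual →ₐ[ℂ] L.Cochains :=
  Algebra.TensorProduct.includeLeft (R := ℂ) (S := ℂ) (A := SymmetricAlgebra ℂ L.oddDual)
    (B := ExteriorAlgebra ℂ L.evenDual)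

/-- The inclusion of the exterior algebra. -/
def ofExt : ExteriorAlgebra ℂ L.evenDual →ₐ[ℂ] L.Cochains :=
  Algebra.TensorProduct.includeRight (R := ℂ) (A := SymmetricAlgebra ℂ L.oddDual)
    (B := ExteriorAlgebra ℂ L.evenDual)

open TensorProduct in
theorem ofSym_mul_ofExt (s : SymmetricAlgebra ℂ L.oddDual) (e : ExteriorAlgebra ℂ L.evenDual) :
    L.ofSym s * L.ofExt e = L.ofExt e * L.ofSym s := by
  have : (s ⊗ₜ[ℂ] (1 : ExteriorAlgebra ℂ L.evenDual)) * ((1 : SymmetricAlgebra ℂ L.oddDual) ⊗ₜ[ℂ] e)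
      = ((1 : SymmetricAlgebra ℂ L.oddDual) ⊗ₜ[ℂ] e) * (s ⊗ₜ[ℂ] 1) := by
    simp
  exact this

/-- The inclusion of the generators coming from components of odd degree. -/
def ofOdd : L.oddDual →ₗ[ℂ] L.Cochains := L.ofSym.toLinearMap ∘ₗ SymmetricAlgebra.ι ℂ L.oddDual

/-- The inclusion of the generators coming from components of even degree. -/
def ofEven : L.evenDual →ₗ[ℂ] L.Cochains := L.ofExt.toLinearMap ∘ₗ ExteriorAlgebra.ι ℂ

/-- The inclusion `L_n^* → C(L)` of the generators. -/
def gen (n : ℕ) : Module.Dual ℂ (L.part n) →ₗ[ℂ] L.Cochains :=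
  if h : Even n then
    L.ofEven ∘ₗ DirectSum.lof ℂ {n : ℕ // Even n} (fun n => Module.Dual ℂ (L.part n)) ⟨n, h⟩
  else
    L.ofOdd ∘ₗ DirectSum.lof ℂ {n : ℕ // Odd n} (fun n => Module.Dual ℂ (L.part n))
      ⟨n, Nat.not_even_iff_odd.1 h⟩

theorem ofOdd_mul_ofOdd (v w : L.oddDual) : L.ofOdd v * L.ofOdd w = L.ofOdd w * L.ofOdd v := by
  simp only [ofOdd, LinearMap.comp_apply, AlgHom.toLinearMap_apply, ← map_mul, mul_comm]

theorem ofOdd_mul_ofEven (v : L.oddDual) (w : L.evenDual) :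
    L.ofOdd v * L.ofEven w = L.ofEven w * L.ofOdd v := by
  exact L.ofSym_mul_ofExt _ _

theorem ofEven_mul_ofEven (v w : L.evenDual) :
    L.ofEven v * L.ofEven w = -(L.ofEven w * L.ofEven v) := by
  have := ExteriorAlgebra.ι_add_mul_swap (R := ℂ) v w
  rw [eq_neg_iff_add_eq_zero]
  simp only [ofEven, LinearMap.comp_apply, AlgHom.toLinearMap_apply, ← map_mul, ← map_add, this,
    map_zero]

theorem gen_mul_gen (i j : ℕ) (α : Module.Dual ℂ (L.part i)) (β : Module.Dual ℂ (L.part j)) :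
    L.gen i α * L.gen j β = (-1 : ℂ) ^ ((i + 1) * (j + 1)) • (L.gen j β * L.gen i α) := by
  by_cases hi : Even i <;> by_cases hj : Even j
  · have : Odd ((i + 1) * (j + 1)) := by simp [*]
    rw [this.neg_one_pow, neg_smul, one_smul, gen, gen, dif_pos hi, dif_pos hj]
    exact L.ofEven_mul_ofEven _ _
  · have : Even ((i + 1) * (j + 1)) := by simp [Nat.even_add_one, *]
    simp [gen, hi, hj, this.neg_one_pow, L.ofOdd_mul_ofEven]
  · have : Even ((i + 1) * (j + 1)) := by simp [Nat.even_add_one, *]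
    simp [gen, hi, hj, this.neg_one_pow, L.ofOdd_mul_ofEven]
  · have : Even ((i + 1) * (j + 1)) := by simp [Nat.even_add_one, *]
    rw [this.neg_one_pow, one_smul, gen, gen, dif_neg hi, dif_neg hj]
    exact L.ofOdd_mul_ofOdd _ _

open TensorProduct in
theorem cochains_induction {P : L.Cochains → Prop}
    (algebraMap : ∀ r : ℂ, P (algebraMap ℂ L.Cochains r)) (gen : ∀ n φ, P (L.gen n φ))
    (mul : ∀ a b, P a → P b → P (a * b)) (add : ∀ a b, P a → P b → P (a + b))
    (c : L.Cochains) : P c := by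
  have h0 : P 0 := by simpa using algebraMap 0
  have hodd : ∀ v, P (L.ofOdd v) := by
    intro v
    induction v using DirectSum.induction_on with
    | zero => simpa using h0
    | of n φ =>
      have := gen n.1 φ
      rwa [PosGradedLie.gen, dif_neg (Nat.not_even_iff_odd.2 n.2)] at this
    | add v w hv hw => simpa using add _ _ hv hw
  have heven : ∀ v, P (L.ofEven v) := by
    intro v
    induction v using DirectSum.induction_on with
    | zero => simpa using h0
    | of n φ =>
      have := gen n.1 φ
      rwa [PosGradedLie.gen, dif_pos n.2] at this
    | add v w hv hw => simpa using add _ _ hv hw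
  have hS : ∀ s : SymmetricAlgebra ℂ L.oddDual, P (L.ofSym s) := by
    intro s
    induction s using SymmetricAlgebra.induction with
    | algebraMap r => rw [AlgHom.commutes]; exact algebraMap r
    | ι x => exact hodd x
    | mul a b ha hb => rw [map_mul]; exact mul _ _ ha hb
    | add a b ha hb => rw [map_add]; exact add _ _ ha hb
  have hE : ∀ s : ExteriorAlgebra ℂ L.evenDual, P (L.ofExt s) := by
    intro s
    induction s using ExteriorAlgebra.induction with
    | algebraMap r => rw [AlgHom.commutes]; exact algebraMap r
    | ι x => exact heven x
    | mul a b ha hb => rw [map_mul]; exact mul _ _ ha hb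
    | add a b ha hb => rw [map_add]; exact add _ _ ha hb
  refine TensorProduct.induction_on (motive := P) c h0 (fun s e => ?_) add
  have h : (s ⊗ₜ[ℂ] (1 : ExteriorAlgebra ℂ L.evenDual)) *
      ((1 : SymmetricAlgebra ℂ L.oddDual) ⊗ₜ[ℂ] e) = s ⊗ₜ[ℂ] e := by simp
  have := mul _ _ (hS s) (hE e)
  rw [← h]
  exact this

theorem sign_congr {a b : ℕ} (h : Even (a + b)) : (-1 : ℂ) ^ a = (-1) ^ b := by
  rcases Nat.even_or_odd a with ha | ha
  · rw [ha.neg_one_pow, ((Nat.even_add.1 h).1 ha).neg_one_pow]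
  · have hb : Odd b := by
      rw [← Nat.not_even_iff_odd] at ha ⊢
      exact fun hb => ha ((Nat.even_add.1 h).2 hb)
    rw [ha.neg_one_pow, hb.neg_one_pow]

/-- The bracket `L_i → L_j → L_n`, set to zero unless `i + j = n`. -/
def brk (i j n : ℕ) : L.part i →ₗ[ℂ] L.part j →ₗ[ℂ] L.part n :=
  if h : i + j = n then L.bracket h else 0

/-- The element `∑ B(e_r, f_s) e^r f^s` of `C(L)` attached to a bilinear form `B` on `L_i × L_j`, where
`e_r`, `f_s` are bases of `L_i`, `L_j` and `e^r`, `f^s` the dual bases. It does not depend on the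
bases. -/
def formElt (i j : ℕ) (B : L.part i → L.part j → ℂ) : L.Cochains :=
  ∑ r, ∑ s, B (Module.finBasis ℂ (L.part i) r) (Module.finBasis ℂ (L.part j) s) •
    (L.gen i ((Module.finBasis ℂ (L.part i)).coord r) *
      L.gen j ((Module.finBasis ℂ (L.part j)).coord s))

/-- The Chevalley differential on generators, the transpose of the bracket:
`dφ = (1/2) ∑_{i + j = n} (-1)^{i - 1} ∑ φ([e_r, f_s]) e^r f^s` for `φ ∈ L_n^*`, where `e_r`, `f_s` run
over bases of `L_i`, `L_j`. For `φ ∈ L_2^*` this is the quadratic form `φ([y, y]) / 2` on `L_1`. -/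
def dGen (n : ℕ) : Module.Dual ℂ (L.part n) →ₗ[ℂ] L.Cochains where
  toFun φ := (1 / 2 : ℂ) • ∑ p ∈ Finset.HasAntidiagonal.antidiagonal n,
    (-1 : ℂ) ^ (p.1 + 1) • L.formElt p.1 p.2 fun x y => φ (L.brk p.1 p.2 n x y)
  map_add' φ ψ := by
    simp only [formElt, LinearMap.add_apply, add_smul, Finset.sum_add_distrib, smul_add]
  map_smul' c φ := by
    simp only [formElt, LinearMap.smul_apply, smul_eq_mul, mul_smul, Finset.smul_sum,
      RingHom.id_apply, smul_comm c]

theorem formElt_mul_gen (i j k : ℕ) (B : L.part i → L.part j → ℂ)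
    (γ : Module.Dual ℂ (L.part k)) :
    L.formElt i j B * L.gen k γ =
      (-1 : ℂ) ^ ((i + j) * (k + 1)) • (L.gen k γ * L.formElt i j B) := by
  simp only [formElt, Finset.sum_mul, Finset.mul_sum, Finset.smul_sum]
  refine Finset.sum_congr rfl fun r _ => Finset.sum_congr rfl fun s _ => ?_
  rw [smul_mul_assoc, mul_smul_comm, smul_comm ((-1 : ℂ) ^ _), mul_assoc, L.gen_mul_gen j k,
    mul_smul_comm, ← mul_assoc, L.gen_mul_gen i k, smul_mul_assoc, smul_smul, mul_assoc]
  rw [mul_smul, smul_smul ((-1 : ℂ) ^ _), ← pow_add]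
  rw [sign_congr (b := (i + j) * (k + 1))]
  simp only [Nat.even_add, Nat.even_mul, Nat.even_add_one]
  tauto

theorem dGen_mul_gen (n k : ℕ) (φ : Module.Dual ℂ (L.part n)) (γ : Module.Dual ℂ (L.part k)) :
    L.dGen n φ * L.gen k γ = (-1 : ℂ) ^ (n * (k + 1)) • (L.gen k γ * L.dGen n φ) := by
  simp only [dGen, LinearMap.coe_mk, AddHom.coe_mk, smul_mul_assoc, mul_smul_comm, Finset.sum_mul,
    Finset.mul_sum]
  rw [smul_comm ((-1 : ℂ) ^ _) (1 / 2 : ℂ), Finset.smul_sum (r := (-1 : ℂ) ^ (n * (k + 1)))]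
  refine congrArg _ (Finset.sum_congr rfl fun p hp => ?_)
  rw [L.formElt_mul_gen, smul_comm, Finset.HasAntidiagonal.mem_antidiagonal.1 hp]

/-- The differential on the generators coming from components of odd degree. -/
def dOdd : L.oddDual →ₗ[ℂ] L.Cochains := DirectSum.toModule ℂ _ _ fun n => L.dGen n

/-- The differential on the generators coming from components of even degree. -/
def dEven : L.evenDual →ₗ[ℂ] L.Cochains := DirectSum.toModule ℂ _ _ fun n => L.dGen n

theorem dOdd_mul_ofOdd (v w : L.oddDual) : L.dOdd v * L.ofOdd w = L.ofOdd w * L.dOdd v := by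
  induction v using DirectSum.induction_on with
  | zero => simp
  | add v v' hv hv' => simp only [map_add, add_mul, mul_add, hv, hv']
  | of n φ =>
    induction w using DirectSum.induction_on with
    | zero => simp
    | add v v' hv hv' => simp only [map_add, add_mul, mul_add, hv, hv']
    | of m ψ =>
      have := L.dGen_mul_gen n m φ ψ
      have he : Even (n.1 * (m.1 + 1)) := by
        simp [m.2]
      rw [he.neg_one_pow, one_smul, gen, dif_neg (Nat.not_even_iff_odd.2 m.2)] at this
      simpa [dOdd, ← DirectSum.lof_eq_of ℂ] using this

theorem dOdd_mul_ofEven (v : L.oddDual) (w : L.evenDual) :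
    L.dOdd v * L.ofEven w = -(L.ofEven w * L.dOdd v) := by
  induction v using DirectSum.induction_on with
  | zero => simp
  | add v v' hv hv' => simp only [map_add, add_mul, mul_add, hv, hv', neg_add]
  | of n φ =>
    induction w using DirectSum.induction_on with
    | zero => simp
    | add v v' hv hv' => simp only [map_add, add_mul, mul_add, hv, hv', neg_add]
    | of m ψ =>
      have := L.dGen_mul_gen n m φ ψ
      have he : Odd (n.1 * (m.1 + 1)) := by
        simp [m.2, n.2]
      rw [he.neg_one_pow, neg_smul, one_smul, gen, dif_pos m.2] at this
      simpa [dOdd, ← DirectSum.lof_eq_of ℂ] using this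

theorem dEven_mul_ofOdd (v : L.evenDual) (w : L.oddDual) :
    L.dEven v * L.ofOdd w = L.ofOdd w * L.dEven v := by
  induction v using DirectSum.induction_on with
  | zero => simp
  | add v v' hv hv' => simp only [map_add, add_mul, mul_add, hv, hv']
  | of n φ =>
    induction w using DirectSum.induction_on with
    | zero => simp
    | add v v' hv hv' => simp only [map_add, add_mul, mul_add, hv, hv']
    | of m ψ =>
      have := L.dGen_mul_gen n m φ ψ
      have he : Even (n.1 * (m.1 + 1)) := n.2.mul_right _
      rw [he.neg_one_pow, one_smul, gen, dif_neg (Nat.not_even_iff_odd.2 m.2)] at this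
      simpa [dEven, ← DirectSum.lof_eq_of ℂ] using this

theorem dEven_mul_ofEven (v w : L.evenDual) :
    L.dEven v * L.ofEven w = L.ofEven w * L.dEven v := by
  induction v using DirectSum.induction_on with
  | zero => simp
  | add v v' hv hv' => simp only [map_add, add_mul, mul_add, hv, hv']
  | of n φ =>
    induction w using DirectSum.induction_on with
    | zero => simp
    | add v v' hv hv' => simp only [map_add, add_mul, mul_add, hv, hv']
    | of m ψ =>
      have := L.dGen_mul_gen n m φ ψ
      have he : Even (n.1 * (m.1 + 1)) := n.2.mul_right _
      rw [he.neg_one_pow, one_smul, gen, dif_pos m.2] at this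
      simpa [dEven, ← DirectSum.lof_eq_of ℂ] using this

theorem triangular_mul {A : Type} [Ring A] (a b c a' b' c' : A) :
    !![a, b; 0, c] * !![a', b'; 0, c'] = !![a * a', a * b' + b * c'; 0, c * c'] := by
  simp

/-- A linear family of upper triangular matrices. -/
def triangular {M A : Type} [AddCommGroup M] [Module ℂ M] [Ring A] [Algebra ℂ A]
    (f g h : M →ₗ[ℂ] A) : M →ₗ[ℂ] Matrix (Fin 2) (Fin 2) A where
  toFun v := !![f v, g v; 0, h v]
  map_add' v w := by simp
  map_smul' c v := by simp

theorem triangular_apply {M A : Type} [AddCommGroup M] [Module ℂ M] [Ring A] [Algebra ℂ A]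
    (f g h : M →ₗ[ℂ] A) (v : M) : triangular f g h v = !![f v, g v; 0, h v] := rfl

theorem ofEven_sq (v : L.evenDual) : L.ofEven v * L.ofEven v = 0 := by
  simp only [ofEven, LinearMap.comp_apply, AlgHom.toLinearMap_apply, ← map_mul,
    ExteriorAlgebra.ι_sq_zero, map_zero]

/-- The homomorphism that extends `v ↦ !![v, dv; 0, v]` to the symmetric algebra. -/
def symMatrix : SymmetricAlgebra ℂ L.oddDual →ₐ[ℂ] Matrix (Fin 2) (Fin 2) L.Cochains :=
  RingCon.liftₐ _ (TensorAlgebra.lift ℂ (triangular L.ofOdd L.dOdd L.ofOdd)) (by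
    refine RingCon.ringConGen_le.2 fun x y h => ?_
    obtain ⟨v, w⟩ := h
    rw [RingCon.ker_apply]
    change TensorAlgebra.lift ℂ _ (_ * _) = TensorAlgebra.lift ℂ _ (_ * _)
    rw [map_mul, map_mul, TensorAlgebra.lift_ι_apply, TensorAlgebra.lift_ι_apply,
      triangular_apply, triangular_apply, triangular_mul, triangular_mul, L.ofOdd_mul_ofOdd v,
      L.dOdd_mul_ofOdd v, L.dOdd_mul_ofOdd w, add_comm])

/-- The homomorphism that extends `v ↦ !![-v, dv; 0, v]` to the exterior algebra. -/
def extMatrix : ExteriorAlgebra ℂ L.evenDual →ₐ[ℂ] Matrix (Fin 2) (Fin 2) L.Cochains :=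
  ExteriorAlgebra.lift ℂ ⟨triangular (-L.ofEven) L.dEven L.ofEven, fun v => by
    rw [triangular_apply, triangular_mul, L.ofEven_sq, L.dEven_mul_ofEven, LinearMap.neg_apply,
      neg_mul_neg, L.ofEven_sq, neg_mul, neg_add_cancel]
    exact (Matrix.eta_fin_two 0).symm⟩

theorem symMatrix_ι (v : L.oddDual) : L.symMatrix (SymmetricAlgebra.ι ℂ _ v) = triangular L.ofOdd L.dOdd L.ofOdd v :=
  TensorAlgebra.lift_ι_apply _ _

theorem extMatrix_ι (v : L.evenDual) : L.extMatrix (ExteriorAlgebra.ι ℂ v) = triangular (-L.ofEven) L.dEven L.ofEven v :=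
  ExteriorAlgebra.lift_ι_apply ..

theorem commute_matrix (s : SymmetricAlgebra ℂ L.oddDual) (e : ExteriorAlgebra ℂ L.evenDual) :
    Commute (L.symMatrix s) (L.extMatrix e) := by
  induction s using SymmetricAlgebra.induction with
  | algebraMap r => rw [AlgHom.commutes]; exact Algebra.commute_algebraMap_left _ _
  | mul a b ha hb => rw [map_mul]; exact ha.mul_left hb
  | add a b ha hb => rw [map_add]; exact ha.add_left hb
  | ι v =>
    induction e using ExteriorAlgebra.induction with
    | algebraMap r => rw [AlgHom.commutes]; exact Algebra.commute_algebraMap_right _ _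
    | mul a b ha hb => rw [map_mul]; exact ha.mul_right hb
    | add a b ha hb => rw [map_add]; exact ha.add_right hb
    | ι w =>
      rw [symMatrix_ι, extMatrix_ι, commute_iff_eq]
      rw [triangular_apply, triangular_apply, triangular_mul, triangular_mul,
        LinearMap.neg_apply, L.ofOdd_mul_ofEven, L.dOdd_mul_ofEven, L.dEven_mul_ofOdd, mul_neg,
        neg_mul, neg_mul, L.ofOdd_mul_ofEven, add_comm]

/-- The homomorphism `c ↦ !![σ c, d c; 0, c]`, where `σ` is the parity automorphism of `C(L)` and `d` the
skew derivation that extends the differential on generators. -/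
def totalMatrix : L.Cochains →ₐ[ℂ] Matrix (Fin 2) (Fin 2) L.Cochains :=
  Algebra.TensorProduct.lift L.symMatrix L.extMatrix L.commute_matrix

theorem totalMatrix_ofSym (s : SymmetricAlgebra ℂ L.oddDual) :
    L.totalMatrix (L.ofSym s) = L.symMatrix s :=
  (Algebra.TensorProduct.lift_tmul L.symMatrix L.extMatrix L.commute_matrix s 1).trans (by simp)

theorem totalMatrix_ofExt (s : ExteriorAlgebra ℂ L.evenDual) :
    L.totalMatrix (L.ofExt s) = L.extMatrix s :=
  (Algebra.TensorProduct.lift_tmul L.symMatrix L.extMatrix L.commute_matrix 1 s).trans (by simp)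

/-- The parity automorphism `σ` of `C(L)`: it multiplies elements of homological degree `a` by
`(-1)^a`. -/
def parity : L.Cochains →ₗ[ℂ] L.Cochains where
  toFun c := L.totalMatrix c 0 0
  map_add' a b := by simp
  map_smul' c a := by simp

/-- The Chevalley differential of `C(L)`: the unique linear map with `d(xy) = dx y + σ(x) dy` that is
the transpose of the bracket on generators; see `differential_gen` and `differential_mul`. -/
def differential : L.Cochains →ₗ[ℂ] L.Cochains where
  toFun c := L.totalMatrix c 0 1
  map_add' a b := by simp
  map_smul' c a := by simp

theorem parity_apply (c : L.Cochains) : L.parity c = L.totalMatrix c 0 0 := rfl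

theorem differential_apply (c : L.Cochains) : L.differential c = L.totalMatrix c 0 1 := rfl

theorem totalMatrix_gen (n : ℕ) (φ : Module.Dual ℂ (L.part n)) :
    L.totalMatrix (L.gen n φ) =
      !![(-1 : ℂ) ^ (n + 1) • L.gen n φ, L.dGen n φ; 0, L.gen n φ] := by
  by_cases h : Even n
  · have ho : Odd (n + 1) := h.add_one
    rw [gen, dif_pos h, ho.neg_one_pow, neg_smul, one_smul]
    have := L.extMatrix_ι (DirectSum.lof ℂ _ (fun n : {n : ℕ // Even n} =>
      Module.Dual ℂ (L.part n)) ⟨n, h⟩ φ)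
    rw [triangular_apply, dEven, DirectSum.toModule_lof] at this
    rw [← totalMatrix_ofExt] at this
    exact this
  · have ho : Even (n + 1) := (Nat.not_even_iff_odd.1 h).add_one
    rw [gen, dif_neg h, ho.neg_one_pow, one_smul]
    have := L.symMatrix_ι (DirectSum.lof ℂ _ (fun n : {n : ℕ // Odd n} =>
      Module.Dual ℂ (L.part n)) ⟨n, Nat.not_even_iff_odd.1 h⟩ φ)
    rw [triangular_apply, dOdd, DirectSum.toModule_lof] at this
    rw [← totalMatrix_ofSym] at this
    exact this

theorem totalMatrix_lower (c : L.Cochains) :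
    L.totalMatrix c 1 0 = 0 ∧ L.totalMatrix c 1 1 = c := by
  induction c using L.cochains_induction with
  | algebraMap r =>
    rw [AlgHom.commutes, Matrix.algebraMap_matrix_apply, Matrix.algebraMap_matrix_apply]
    simp
  | gen n φ => simp [totalMatrix_gen]
  | mul a b ha hb => simp [Matrix.mul_apply, Fin.sum_univ_two, ha.1, ha.2, hb.1, hb.2]
  | add a b ha hb => simp [ha.1, ha.2, hb.1, hb.2]

theorem parity_gen (n : ℕ) (φ : Module.Dual ℂ (L.part n)) :
    L.parity (L.gen n φ) = (-1 : ℂ) ^ (n + 1) • L.gen n φ := by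
  simp [parity, totalMatrix_gen]

theorem parity_mul (a b : L.Cochains) : L.parity (a * b) = L.parity a * L.parity b := by
  simp [parity, Matrix.mul_apply, Fin.sum_univ_two, (L.totalMatrix_lower b).1]

theorem parity_algebraMap (r : ℂ) : L.parity (algebraMap ℂ _ r) = algebraMap ℂ _ r := by
  rw [parity_apply, AlgHom.commutes, Matrix.algebraMap_matrix_apply]
  simp

theorem differential_algebraMap (r : ℂ) : L.differential (algebraMap ℂ _ r) = 0 := by
  rw [differential_apply, AlgHom.commutes, Matrix.algebraMap_matrix_apply]
  simp

theorem differential_gen (n : ℕ) (φ : Module.Dual ℂ (L.part n)) :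
    L.differential (L.gen n φ) = L.dGen n φ := by
  simp [differential, totalMatrix_gen]

theorem differential_mul (a b : L.Cochains) :
    L.differential (a * b) = L.differential a * b + L.parity a * L.differential b := by
  simp [differential, parity, Matrix.mul_apply, Fin.sum_univ_two, (L.totalMatrix_lower b).2,
    add_comm]

theorem parity_formElt (i j : ℕ) (B : L.part i → L.part j → ℂ) :
    L.parity (L.formElt i j B) = (-1 : ℂ) ^ (i + j) • L.formElt i j B := by
  simp only [formElt, map_sum, map_smul, parity_mul, parity_gen, Finset.smul_sum]
  refine Finset.sum_congr rfl fun r _ => Finset.sum_congr rfl fun s _ => ?_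
  rw [smul_mul_assoc, mul_smul_comm, smul_smul ((-1 : ℂ) ^ (i + 1)), ← pow_add,
    smul_comm (B _ _), sign_congr (b := i + j)]
  simp only [Nat.even_add, Nat.even_add_one]
  tauto

theorem parity_dGen (n : ℕ) (φ : Module.Dual ℂ (L.part n)) :
    L.parity (L.dGen n φ) = (-1 : ℂ) ^ n • L.dGen n φ := by
  simp only [dGen, LinearMap.coe_mk, AddHom.coe_mk, map_smul, map_sum, parity_formElt]
  rw [smul_comm ((-1 : ℂ) ^ n) (1 / 2 : ℂ), Finset.smul_sum (r := (-1 : ℂ) ^ n)]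
  refine congrArg _ (Finset.sum_congr rfl fun p hp => ?_)
  rw [Finset.HasAntidiagonal.mem_antidiagonal.1 hp, smul_comm]

theorem differential_parity (c : L.Cochains) :
    L.differential (L.parity c) = -L.parity (L.differential c) := by
  induction c using L.cochains_induction with
  | algebraMap r => simp [parity_algebraMap, differential_algebraMap]
  | gen n φ => simp [parity_gen, differential_gen, parity_dGen, pow_succ]
  | mul a b ha hb =>
    simp only [parity_mul, differential_mul, map_add, ha, hb]
    noncomm_ring
  | add a b ha hb => simp only [map_add, ha, hb, neg_add]

/-- The cubic element of `C(L)` attached to a trilinear form. -/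
def triElt (i j k : ℕ) (T : L.part i → L.part j → L.part k → ℂ) : L.Cochains :=
  ∑ r, ∑ s, ∑ t, T (Module.finBasis ℂ (L.part i) r) (Module.finBasis ℂ (L.part j) s)
      (Module.finBasis ℂ (L.part k) t) •
    (L.gen i ((Module.finBasis ℂ (L.part i)).coord r) *
      L.gen j ((Module.finBasis ℂ (L.part j)).coord s) *
      L.gen k ((Module.finBasis ℂ (L.part k)).coord t))

theorem triElt_add (i j k : ℕ) (T T' : L.part i → L.part j → L.part k → ℂ) :
    L.triElt i j k (fun x y z => T x y z + T' x y z) = L.triElt i j k T + L.triElt i j k T' := by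
  simp only [triElt, add_smul, Finset.sum_add_distrib]

theorem triElt_mul (i j k : ℕ) (c : ℂ) (T : L.part i → L.part j → L.part k → ℂ) :
    L.triElt i j k (fun x y z => c * T x y z) = c • L.triElt i j k T := by
  simp only [triElt, mul_smul, Finset.smul_sum]

theorem triElt_swap (i j k : ℕ) (T : L.part i → L.part j → L.part k → ℂ) :
    L.triElt i j k T = (-1 : ℂ) ^ ((i + 1) * (j + 1)) • L.triElt j i k (fun y x z => T x y z) := by
  simp only [triElt, Finset.smul_sum]
  rw [Finset.sum_comm]
  refine Finset.sum_congr rfl fun r _ => Finset.sum_congr rfl fun s _ =>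
    Finset.sum_congr rfl fun t _ => ?_
  rw [L.gen_mul_gen i j, smul_mul_assoc, smul_comm]

theorem triElt_rot (i j k : ℕ) (T : L.part i → L.part j → L.part k → ℂ) :
    L.triElt i j k T = (-1 : ℂ) ^ ((i + 1) * (j + k)) • L.triElt j k i (fun y z x => T x y z) := by
  simp only [triElt, Finset.smul_sum]
  rw [Finset.sum_comm]
  refine Finset.sum_congr rfl fun r _ => ?_
  rw [Finset.sum_comm]
  refine Finset.sum_congr rfl fun s _ => Finset.sum_congr rfl fun t _ => ?_
  rw [L.gen_mul_gen i j, smul_mul_assoc, mul_assoc, L.gen_mul_gen i k, mul_smul_comm, smul_comm (T _ _ _),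
    smul_comm (T _ _ _), smul_smul ((-1 : ℂ) ^ _), ← pow_add, ← mul_assoc,
    sign_congr (b := (i + 1) * (j + k))]
  simp only [Nat.even_add, Nat.even_mul, Nat.even_add_one]
  tauto

/-- The triples of natural numbers with sum `n`. -/
def triples (n : ℕ) : Finset (ℕ × ℕ × ℕ) :=
  (Finset.range (n + 1) ×ˢ Finset.range (n + 1) ×ˢ Finset.range (n + 1)).filter
    fun p => p.1 + p.2.1 + p.2.2 = n

theorem mem_triples {n : ℕ} {p : ℕ × ℕ × ℕ} : p ∈ triples n ↔ p.1 + p.2.1 + p.2.2 = n := by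
  simp only [triples, Finset.mem_filter, Finset.mem_product, Finset.mem_range]
  omega

theorem sum_triples_left {M : Type} [AddCommMonoid M] (n : ℕ) (f : ℕ → ℕ → ℕ → M) :
    ∑ p ∈ Finset.HasAntidiagonal.antidiagonal n,
      ∑ q ∈ Finset.HasAntidiagonal.antidiagonal p.1, f q.1 q.2 p.2 =
    ∑ p ∈ triples n, f p.1 p.2.1 p.2.2 := by
  rw [Finset.sum_sigma']
  refine Finset.sum_nbij' (fun x => (x.2.1, x.2.2, x.1.2))
    (fun p => ⟨(p.1 + p.2.1, p.2.2), (p.1, p.2.1)⟩) ?_ ?_ ?_ ?_ ?_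
  · rintro ⟨⟨a, b⟩, ⟨c, d⟩⟩ h
    simp only [Finset.mem_sigma, Finset.HasAntidiagonal.mem_antidiagonal] at h
    simp only [mem_triples]; omega
  · rintro ⟨a, b, c⟩ h
    simp only [mem_triples] at h
    simp only [Finset.mem_sigma, Finset.HasAntidiagonal.mem_antidiagonal, and_true]; omega
  · rintro ⟨⟨a, b⟩, ⟨c, d⟩⟩ h
    simp only [Finset.mem_sigma, Finset.HasAntidiagonal.mem_antidiagonal] at h
    obtain ⟨-, rfl⟩ := h
    rfl
  · rintro ⟨a, b, c⟩ h; rfl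
  · rintro ⟨⟨a, b⟩, ⟨c, d⟩⟩ h; rfl

theorem sum_triples_right {M : Type} [AddCommMonoid M] (n : ℕ) (f : ℕ → ℕ → ℕ → M) :
    ∑ p ∈ Finset.HasAntidiagonal.antidiagonal n,
      ∑ q ∈ Finset.HasAntidiagonal.antidiagonal p.2, f p.1 q.1 q.2 =
    ∑ p ∈ triples n, f p.1 p.2.1 p.2.2 := by
  rw [Finset.sum_sigma']
  refine Finset.sum_nbij' (fun x => (x.1.1, x.2.1, x.2.2))
    (fun p => ⟨(p.1, p.2.1 + p.2.2), (p.2.1, p.2.2)⟩) ?_ ?_ ?_ ?_ ?_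
  · rintro ⟨⟨a, b⟩, ⟨c, d⟩⟩ h
    simp only [Finset.mem_sigma, Finset.HasAntidiagonal.mem_antidiagonal] at h
    simp only [mem_triples]; omega
  · rintro ⟨a, b, c⟩ h
    simp only [mem_triples] at h
    simp only [Finset.mem_sigma, Finset.HasAntidiagonal.mem_antidiagonal, and_true]; omega
  · rintro ⟨⟨a, b⟩, ⟨c, d⟩⟩ h
    simp only [Finset.mem_sigma, Finset.HasAntidiagonal.mem_antidiagonal] at h
    obtain ⟨-, rfl⟩ := h
    rfl
  · rintro ⟨a, b, c⟩ h; rfl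
  · rintro ⟨⟨a, b⟩, ⟨c, d⟩⟩ h; rfl

theorem sum_triples_swap {M : Type} [AddCommMonoid M] (n : ℕ) (f : ℕ → ℕ → ℕ → M) :
    ∑ p ∈ triples n, f p.2.1 p.1 p.2.2 = ∑ p ∈ triples n, f p.1 p.2.1 p.2.2 := by
  refine Finset.sum_nbij' (fun p => (p.2.1, p.1, p.2.2)) (fun p => (p.2.1, p.1, p.2.2))
    ?_ ?_ ?_ ?_ ?_ <;> simp only [mem_triples, implies_true]
  · intro p h; omega
  · intro p h; omega

theorem sum_triples_rot {M : Type} [AddCommMonoid M] (n : ℕ) (f : ℕ → ℕ → ℕ → M) :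
    ∑ p ∈ triples n, f p.2.1 p.2.2 p.1 = ∑ p ∈ triples n, f p.1 p.2.1 p.2.2 := by
  refine Finset.sum_nbij' (fun p => (p.2.1, p.2.2, p.1)) (fun p => (p.2.2, p.1, p.2.1))
    ?_ ?_ ?_ ?_ ?_ <;> simp only [mem_triples, implies_true]
  · intro p h; omega
  · intro p h; omega

theorem sum_basis_smul {n : ℕ} (f : Module.Dual ℂ (L.part n)) :
    ∑ r, f (Module.finBasis ℂ (L.part n) r) • (Module.finBasis ℂ (L.part n)).coord r = f := by
  refine (Module.finBasis ℂ (L.part n)).ext fun s => ?_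
  simp

/-- The trilinear form `φ([[x, y], z])`. -/
def leftForm (n : ℕ) (φ : Module.Dual ℂ (L.part n)) (i j k : ℕ) :
    L.part i → L.part j → L.part k → ℂ :=
  fun x y z => φ (L.brk (i + j) k n (L.brk i j (i + j) x y) z)

/-- The trilinear form `φ([x, [y, z]])`. -/
def rightForm (n : ℕ) (φ : Module.Dual ℂ (L.part n)) (i j k : ℕ) :
    L.part i → L.part j → L.part k → ℂ :=
  fun x y z => φ (L.brk i (j + k) n x (L.brk j k (j + k) y z))

theorem rightForm_eq_left_add {n i j k : ℕ} (h : i + j + k = n) (φ : Module.Dual ℂ (L.part n))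
    (x : L.part i) (y : L.part j) (z : L.part k) :
    L.rightForm n φ i j k x y z =
      L.leftForm n φ i j k x y z + (-1 : ℂ) ^ (i * j) * L.rightForm n φ j i k y x z := by
  have h1 : i + (j + k) = n := by omega
  have h2 : j + (i + k) = n := by omega
  simp only [rightForm, leftForm, brk, dif_pos h, dif_pos h1, dif_pos h2, dif_pos]
  rw [L.jacobi rfl h1 rfl h rfl h2, map_add, map_smul, smul_eq_mul]

theorem rightForm_eq_left_rot {n i j k : ℕ} (h : i + j + k = n) (φ : Module.Dual ℂ (L.part n))
    (x : L.part i) (y : L.part j) (z : L.part k) :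
    L.rightForm n φ i j k x y z = -(-1 : ℂ) ^ (i * (j + k)) * L.leftForm n φ j k i y z x := by
  have h1 : i + (j + k) = n := by omega
  have h2 : j + k + i = n := by omega
  simp only [rightForm, leftForm, brk, dif_pos h1, dif_pos h2, dif_pos]
  rw [L.skew h1 h2, map_neg, map_smul, smul_eq_mul, neg_mul]

theorem sum_formElt_mul (i j k : ℕ) (T : L.part i → L.part j → L.part k → ℂ) :
    ∑ t, L.formElt i j (fun x y => T x y (Module.finBasis ℂ (L.part k) t)) *
      L.gen k ((Module.finBasis ℂ (L.part k)).coord t) = L.triElt i j k T := by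
  simp only [formElt, triElt, Finset.sum_mul, smul_mul_assoc]
  rw [Finset.sum_comm]
  exact Finset.sum_congr rfl fun r _ => Finset.sum_comm

theorem sum_mul_formElt (i j k : ℕ) (T : L.part i → L.part j → L.part k → ℂ) :
    ∑ r, L.gen i ((Module.finBasis ℂ (L.part i)).coord r) *
      L.formElt j k (T (Module.finBasis ℂ (L.part i) r)) = L.triElt i j k T := by
  simp only [formElt, triElt, Finset.mul_sum, mul_smul_comm, mul_assoc]

theorem dGen_apply (n : ℕ) (φ : Module.Dual ℂ (L.part n)) :
    L.dGen n φ = (1 / 2 : ℂ) • ∑ p ∈ Finset.HasAntidiagonal.antidiagonal n,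
      (-1 : ℂ) ^ (p.1 + 1) • L.formElt p.1 p.2 fun x y => φ (L.brk p.1 p.2 n x y) := rfl

theorem sum_dGen_mul {n m k : ℕ} (φ : Module.Dual ℂ (L.part n)) :
    ∑ t, L.dGen m (φ ∘ₗ (L.brk m k n).flip (Module.finBasis ℂ (L.part k) t)) *
      L.gen k ((Module.finBasis ℂ (L.part k)).coord t) =
    (1 / 2 : ℂ) • ∑ p ∈ Finset.HasAntidiagonal.antidiagonal m,
      (-1 : ℂ) ^ (p.1 + 1) • L.triElt p.1 p.2 k (L.leftForm n φ p.1 p.2 k) := by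
  simp only [dGen_apply, smul_mul_assoc, Finset.sum_mul, ← Finset.smul_sum]
  rw [Finset.sum_comm]
  refine congrArg _ (Finset.sum_congr rfl fun p hp => ?_)
  obtain rfl := Finset.HasAntidiagonal.mem_antidiagonal.1 hp
  rw [← sum_formElt_mul, Finset.smul_sum]
  rfl

theorem sum_mul_dGen {n m k : ℕ} (φ : Module.Dual ℂ (L.part n)) :
    ∑ r, L.gen m ((Module.finBasis ℂ (L.part m)).coord r) *
      L.dGen k (φ ∘ₗ (L.brk m k n) (Module.finBasis ℂ (L.part m) r)) =
    (1 / 2 : ℂ) • ∑ p ∈ Finset.HasAntidiagonal.antidiagonal k,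
      (-1 : ℂ) ^ (p.1 + 1) • L.triElt m p.1 p.2 (L.rightForm n φ m p.1 p.2) := by
  simp only [dGen_apply, mul_smul_comm, Finset.mul_sum, ← Finset.smul_sum]
  rw [Finset.sum_comm]
  refine congrArg _ (Finset.sum_congr rfl fun p hp => ?_)
  obtain rfl := Finset.HasAntidiagonal.mem_antidiagonal.1 hp
  rw [← sum_mul_formElt, Finset.smul_sum]
  rfl

theorem differential_formElt {n m k : ℕ} (φ : Module.Dual ℂ (L.part n)) :
    L.differential (L.formElt m k fun x y => φ (L.brk m k n x y)) =
      (1 / 2 : ℂ) • ∑ p ∈ Finset.HasAntidiagonal.antidiagonal m,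
        (-1 : ℂ) ^ (p.1 + 1) • L.triElt p.1 p.2 k (L.leftForm n φ p.1 p.2 k) +
      (-1 : ℂ) ^ (m + 1) • (1 / 2 : ℂ) • ∑ p ∈ Finset.HasAntidiagonal.antidiagonal k,
        (-1 : ℂ) ^ (p.1 + 1) • L.triElt m p.1 p.2 (L.rightForm n φ m p.1 p.2) := by
  rw [← sum_dGen_mul, ← sum_mul_dGen]
  simp only [formElt, map_sum, map_smul, differential_mul, differential_gen, parity_gen, smul_add,
    Finset.sum_add_distrib]
  congr 1
  · rw [Finset.sum_comm]
    refine Finset.sum_congr rfl fun t _ => ?_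
    rw [← L.sum_basis_smul (φ ∘ₗ (L.brk m k n).flip (Module.finBasis ℂ (L.part k) t)), map_sum,
      Finset.sum_mul]
    simp
  · rw [Finset.smul_sum]
    refine Finset.sum_congr rfl fun r _ => ?_
    conv_rhs => rw [← L.sum_basis_smul (φ ∘ₗ (L.brk m k n) (Module.finBasis ℂ (L.part m) r)),
      map_sum, Finset.mul_sum, Finset.smul_sum]
    refine Finset.sum_congr rfl fun s _ => ?_
    rw [map_smul, mul_smul_comm, smul_mul_assoc, smul_comm]
    rfl

/-- The cubic element attached to the forms `φ([[x, y], z])`, with signs. -/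
def cubicLeft (n : ℕ) (φ : Module.Dual ℂ (L.part n)) : L.Cochains := ∑ p ∈ triples n,
  (-1 : ℂ) ^ p.2.1 • L.triElt p.1 p.2.1 p.2.2 (L.leftForm n φ p.1 p.2.1 p.2.2)

/-- The cubic element attached to the forms `φ([x, [y, z]])`, with signs. -/
def cubicRight (n : ℕ) (φ : Module.Dual ℂ (L.part n)) : L.Cochains := ∑ p ∈ triples n,
  (-1 : ℂ) ^ p.2.1 • L.triElt p.1 p.2.1 p.2.2 (L.rightForm n φ p.1 p.2.1 p.2.2)

theorem half_sum_left (n : ℕ) (φ : Module.Dual ℂ (L.part n)) :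
    ∑ p ∈ Finset.HasAntidiagonal.antidiagonal n, (-1 : ℂ) ^ (p.1 + 1) • (1 / 2 : ℂ) •
      ∑ q ∈ Finset.HasAntidiagonal.antidiagonal p.1,
        (-1 : ℂ) ^ (q.1 + 1) • L.triElt q.1 q.2 p.2 (L.leftForm n φ q.1 q.2 p.2) =
      (1 / 2 : ℂ) • L.cubicLeft n φ := by
  rw [cubicLeft, ← sum_triples_left n fun i j k =>
    (-1 : ℂ) ^ j • L.triElt i j k (L.leftForm n φ i j k), Finset.smul_sum]
  refine Finset.sum_congr rfl fun p _ => ?_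
  rw [smul_comm, Finset.smul_sum]
  refine congrArg _ (Finset.sum_congr rfl fun q hq => ?_)
  have := Finset.HasAntidiagonal.mem_antidiagonal.1 hq
  rw [smul_smul, ← pow_add, sign_congr (b := q.2)]
  rw [← this]
  simp only [Nat.even_add, Nat.even_add_one]
  tauto

theorem half_sum_right (n : ℕ) (φ : Module.Dual ℂ (L.part n)) :
    ∑ p ∈ Finset.HasAntidiagonal.antidiagonal n, (-1 : ℂ) ^ (p.1 + 1) •
      (-1 : ℂ) ^ (p.1 + 1) • (1 / 2 : ℂ) • ∑ q ∈ Finset.HasAntidiagonal.antidiagonal p.2,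
        (-1 : ℂ) ^ (q.1 + 1) • L.triElt p.1 q.1 q.2 (L.rightForm n φ p.1 q.1 q.2) =
      -((1 / 2 : ℂ) • L.cubicRight n φ) := by
  rw [cubicRight, ← sum_triples_right n fun i j k =>
    (-1 : ℂ) ^ j • L.triElt i j k (L.rightForm n φ i j k), Finset.smul_sum,
    ← Finset.sum_neg_distrib]
  refine Finset.sum_congr rfl fun p _ => ?_
  rw [smul_smul, ← pow_add, (Even.add_self _).neg_one_pow, one_smul, ← smul_neg,
    ← Finset.sum_neg_distrib]
  refine congrArg _ (Finset.sum_congr rfl fun q hq => ?_)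
  rw [pow_succ, mul_neg_one, neg_smul]

theorem cubicRight_eq_sub (n : ℕ) (φ : Module.Dual ℂ (L.part n)) :
    L.cubicRight n φ = L.cubicLeft n φ - L.cubicRight n φ := by
  have hZ : L.cubicRight n φ = L.cubicLeft n φ +
      ∑ p ∈ triples n, (-1 : ℂ) ^ (p.2.1 + p.1 * p.2.1) •
        L.triElt p.1 p.2.1 p.2.2 (fun x y z => L.rightForm n φ p.2.1 p.1 p.2.2 y x z) := by
    rw [cubicRight, cubicLeft, ← Finset.sum_add_distrib]
    refine Finset.sum_congr rfl fun p hp => ?_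
    rw [pow_add, mul_smul, ← smul_add, ← triElt_mul _ _ _ _ ((-1 : ℂ) ^ (p.1 * p.2.1)),
      ← triElt_add]
    refine congrArg _ (congrArg _ ?_)
    funext x y z
    exact L.rightForm_eq_left_add (mem_triples.1 hp) φ x y z
  have hW : ∑ p ∈ triples n, (-1 : ℂ) ^ (p.2.1 + p.1 * p.2.1) •
      L.triElt p.1 p.2.1 p.2.2 (fun x y z => L.rightForm n φ p.2.1 p.1 p.2.2 y x z) =
      -L.cubicRight n φ := by
    rw [cubicRight, ← sum_triples_swap n fun i j k => (-1 : ℂ) ^ j •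
      L.triElt i j k (L.rightForm n φ i j k), ← Finset.sum_neg_distrib]
    refine Finset.sum_congr rfl fun p hp => ?_
    rw [triElt_swap, smul_smul, ← pow_add, sign_congr (b := p.1 + 1), pow_succ, mul_neg_one,
      neg_smul]
    simp only [Nat.even_add, Nat.even_mul, Nat.even_add_one]
    tauto
  rw [sub_eq_add_neg, ← hW]
  exact hZ

theorem cubicRight_eq_neg (n : ℕ) (φ : Module.Dual ℂ (L.part n)) :
    L.cubicRight n φ = -L.cubicLeft n φ := by
  rw [cubicRight, cubicLeft, ← sum_triples_rot n fun i j k => (-1 : ℂ) ^ j •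
    L.triElt i j k (L.leftForm n φ i j k), ← Finset.sum_neg_distrib]
  refine Finset.sum_congr rfl fun p hp => ?_
  have : L.rightForm n φ p.1 p.2.1 p.2.2 = fun x y z =>
      -(-1 : ℂ) ^ (p.1 * (p.2.1 + p.2.2)) * L.leftForm n φ p.2.1 p.2.2 p.1 y z x := by
    funext x y z
    exact L.rightForm_eq_left_rot (mem_triples.1 hp) φ x y z
  rw [this, triElt_mul, triElt_rot, neg_smul, smul_neg, smul_smul, smul_smul, ← pow_add,
    ← pow_add, sign_congr (b := p.2.2)]
  simp only [Nat.even_add, Nat.even_mul, Nat.even_add_one]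
  tauto

theorem cubicLeft_eq_zero (n : ℕ) (φ : Module.Dual ℂ (L.part n)) : L.cubicLeft n φ = 0 := by
  have h2 := L.cubicRight_eq_sub n φ
  rw [L.cubicRight_eq_neg] at h2
  have h4 : (3 : ℂ) • L.cubicLeft n φ = 0 := by
    have : (3 : ℂ) • L.cubicLeft n φ =
      (L.cubicLeft n φ - -L.cubicLeft n φ) - -L.cubicLeft n φ := by module
    rw [this, ← h2, sub_self]
  exact (smul_eq_zero.1 h4).resolve_left (by norm_num)

theorem differential_dGen (n : ℕ) (φ : Module.Dual ℂ (L.part n)) :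
    L.differential (L.dGen n φ) = 0 := by
  rw [dGen_apply, map_smul, map_sum]
  simp only [map_smul, differential_formElt, smul_add, Finset.sum_add_distrib]
  rw [half_sum_left, half_sum_right, cubicRight_eq_neg, cubicLeft_eq_zero]
  simp

theorem differential_differential (c : L.Cochains) :
    L.differential (L.differential c) = 0 := by
  induction c using L.cochains_induction with
  | algebraMap r => simp [differential_algebraMap]
  | gen n φ => rw [differential_gen, differential_dGen]
  | mul a b ha hb =>
    simp only [differential_mul, map_add, differential_parity, ha, hb]
    noncomm_ring
  | add a b ha hb => simp only [map_add, ha, hb, add_zero]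

/-! #### The double grading -/

/-- The component `C(L)_{a,n}` of homological degree `a` and polynomial degree `n`: it is spanned by the
products of generators, where an element of `L_i^*` has homological degree `i - 1` and polynomial
degree `i`. -/
def bipart (a : ℤ) (n : ℕ) : Submodule ℂ L.Cochains :=
  Submodule.span ℂ {c | ∃ l : List (Σ i : ℕ, Module.Dual ℂ (L.part i)),
    (l.map fun φ => (φ.1 : ℤ) - 1).sum = a ∧ (l.map fun φ => φ.1).sum = n ∧
      (l.map fun φ => L.gen φ.1 φ.2).prod = c}

theorem bipart_mul {a a' : ℤ} {n n' : ℕ} {c c' : L.Cochains} (h : c ∈ L.bipart a n)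
    (h' : c' ∈ L.bipart a' n') : c * c' ∈ L.bipart (a + a') (n + n') := by
  have := Submodule.mul_mem_mul h h'
  rw [bipart, bipart, Submodule.span_mul_span] at this
  refine Submodule.span_mono ?_ this
  rintro _ ⟨_, ⟨l, rfl, rfl, rfl⟩, _, ⟨l', rfl, rfl, rfl⟩, rfl⟩
  exact ⟨l ++ l', by simp, by simp, by simp⟩

theorem gen_mem_bipart (i : ℕ) (φ : Module.Dual ℂ (L.part i)) :
    L.gen i φ ∈ L.bipart ((i : ℤ) - 1) i :=
  Submodule.subset_span ⟨[⟨i, φ⟩], by simp, by simp, by simp⟩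

theorem dGen_mem_bipart (n : ℕ) (φ : Module.Dual ℂ (L.part n)) :
    L.dGen n φ ∈ L.bipart ((n : ℤ) - 1 - 1) n := by
  rw [dGen_apply]
  refine Submodule.smul_mem _ _ (Submodule.sum_mem _ fun p hp => Submodule.smul_mem _ _
    (Submodule.sum_mem _ fun r _ => Submodule.sum_mem _ fun s _ => Submodule.smul_mem _ _ ?_))
  have h := Finset.HasAntidiagonal.mem_antidiagonal.1 hp
  have := L.bipart_mul (L.gen_mem_bipart p.1 ((Module.finBasis ℂ (L.part p.1)).coord r))
    (L.gen_mem_bipart p.2 ((Module.finBasis ℂ (L.part p.2)).coord s))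
  rw [h] at this
  convert this using 2
  rw [← h]; push_cast; ring

theorem differential_mem_bipart {a : ℤ} {n : ℕ} {c : L.Cochains} (h : c ∈ L.bipart a n) :
    L.differential c ∈ L.bipart (a - 1) n := by
  induction h using Submodule.span_induction with
  | mem c hc =>
    obtain ⟨l, rfl, rfl, rfl⟩ := hc
    induction l with
    | nil =>
      have := L.differential_algebraMap 1
      rw [map_one] at this
      simp [this]
    | cons φ l ih =>
      simp only [List.map_cons, List.sum_cons, List.prod_cons, differential_mul,
        differential_gen, parity_gen]
      refine Submodule.add_mem _ ?_ ?_
      · have h2 : (l.map fun φ => L.gen φ.1 φ.2).prod ∈ L.bipart _ _ :=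
          Submodule.subset_span ⟨l, rfl, rfl, rfl⟩
        convert L.bipart_mul (L.dGen_mem_bipart φ.1 φ.2) h2 using 2
        ring
      · rw [smul_mul_assoc]
        refine Submodule.smul_mem _ _ ?_
        convert L.bipart_mul (L.gen_mem_bipart φ.1 φ.2) ih using 2
        ring
  | zero => simp
  | add x y _ _ hx hy => rw [map_add]; exact Submodule.add_mem _ hx hy
  | smul r x _ hx => rw [map_smul]; exact Submodule.smul_mem _ _ hx

/-- The summand `⋯ → C(L)_{2,n} → C(L)_{1,n} → C(L)_{0,n}` of polynomial degree `n` of the Chevalley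
cochain complex of `L`. The Chevalley differential preserves the polynomial degree and lowers the
homological degree by one. -/
def chevalleyComplex (n : ℕ) : ChainComplex (ModuleCat ℂ) ℕ :=
  ChainComplex.of (fun a => ModuleCat.of ℂ (L.bipart (a : ℤ) n))
    (fun a => ModuleCat.ofHom (L.differential.restrict fun c hc => by
      have := L.differential_mem_bipart hc
      rwa [Nat.cast_add, Nat.cast_one, add_sub_cancel_right] at this))
    (fun a => by
      rw [← ModuleCat.ofHom_comp]
      refine ModuleCat.hom_ext (LinearMap.ext fun c => Subtype.ext ?_)
      exact L.differential_differential c.1)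

end PosGradedLie

/-! ### The Koszul dual Lie algebra of a commutative quadratic algebra -/

/-- The quadratic relations `R ⊆ V ⊗ V` of the commutative algebra `A = ℂ[x_i] / I`, that is, the
kernel of the multiplication map `V ⊗ V → A`, where `V` is the space of the generators `x_i`; a
tensor `∑ r_ij x_i ⊗ x_j` is written as its matrix of coefficients. -/
def quadraticRelations {ι : Type} [Fintype ι] (I : Ideal (MvPolynomial ι ℂ)) :
    Set (ι → ι → ℂ) :=
  {r | ∑ i, ∑ j, MvPolynomial.C (r i j) * (MvPolynomial.X i * MvPolynomial.X j) ∈ I}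

/-- The annihilator `R^⊥ ⊆ V^* ⊗ V^*` of the quadratic relations of `ℂ[x_i] / I`; a tensor
`∑ g_ij y_i ⊗ y_j` in the dual basis `y_i` is written as its matrix of coefficients. -/
def quadraticAnnihilator {ι : Type} [Fintype ι] (I : Ideal (MvPolynomial ι ℂ)) :
    Submodule ℂ (ι → ι → ℂ) where
  carrier := {g | ∀ r ∈ quadraticRelations I, ∑ i, ∑ j, g i j * r i j = 0}
  zero_mem' := by simp
  add_mem' := fun {g h} hg hh r hr => by
    simp only [Pi.add_apply, add_mul, Finset.sum_add_distrib, hg r hr, hh r hr, add_zero]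
  smul_mem' := fun c g hg r hr => by
    simp only [Pi.smul_apply, smul_eq_mul, mul_assoc, ← Finset.mul_sum, hg r hr, mul_zero]

/-- The Koszul (or Quillen) dual of a commutative quadratic algebra `A = ℂ[x_i] / I`: the graded
Lie algebra generated by the dual basis `y_i`, placed in degree one, with the relations
`∑ g_ij [y_i, y_j] = 0` for all `g ∈ R^⊥`. -/
def koszulDualLie {ι : Type} [Fintype ι] (I : Ideal (MvPolynomial ι ℂ)) : PosGradedLie :=
  PosGradedLie.presented (quadraticAnnihilator I : Set (ι → ι → ℂ))

/-! ### The Veronese ring -/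

/-- The ideal of the Veronese (rational normal) curve of degree `b + 1` in projective space of
dimension `b + 1`, generated by all `x_i x_j - x_k x_l` with `i + j = k + l`. -/
def veroneseIdeal (b : ℕ) : Ideal (MvPolynomial (Fin (b + 2)) ℂ) :=
  Ideal.span {f | ∃ i j k l : Fin (b + 2), (i : ℕ) + j = k + l ∧
    f = MvPolynomial.X i * MvPolynomial.X j - MvPolynomial.X k * MvPolynomial.X l}

/-- The homogeneous component of degree `n` of the Veronese ring `A_b = ℂ[x_0, …, x_{b+1}] / I`,
namely the image of the space of homogeneous polynomials of degree `n`. -/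
def veronesePart (b n : ℕ) : Submodule ℂ (MvPolynomial (Fin (b + 2)) ℂ ⧸ veroneseIdeal b) :=
  (MvPolynomial.homogeneousSubmodule (Fin (b + 2)) ℂ n).map
    (Ideal.Quotient.mkₐ ℂ (veroneseIdeal b)).toLinearMap

/-- The Hilbert series `∑ dim (A_b)_n t^n` of the Veronese ring. -/
def veroneseHilbertSeries (b : ℕ) : PowerSeries ℤ :=
  PowerSeries.mk fun n => (Module.finrank ℂ (veronesePart b n) : ℤ)

/-- The Koszul dual Lie algebra `L^b` of the Veronese ring `A_b`. -/
def veroneseLie (b : ℕ) : PosGradedLie := koszulDualLie (veroneseIdeal b)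

theorem sum_antidiagonal_eq_zero_of_mem {b : ℕ} {r : Fin (b + 2) → Fin (b + 2) → ℂ}
    (hr : r ∈ quadraticRelations (veroneseIdeal b)) (k : ℕ) :
    ∑ i : Fin (b + 2), ∑ j : Fin (b + 2), (if (i : ℕ) + j = k then (1 : ℂ) else 0) * r i j = 0 := by
  let φ : MvPolynomial (Fin (b + 2)) ℂ →ₐ[ℂ] Polynomial ℂ :=
    MvPolynomial.aeval fun i => Polynomial.X ^ (i : ℕ)
  have hle : veroneseIdeal b ≤ RingHom.ker φ := by
    refine Ideal.span_le.2 ?_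
    rintro _ ⟨i, j, k, l, h, rfl⟩
    simp [φ, RingHom.mem_ker, ← pow_add, h]
  have h0 := RingHom.mem_ker.1 (hle hr)
  have h1 := congrArg (fun p => Polynomial.coeff p k) h0
  simp only [map_sum, map_mul, φ, MvPolynomial.aeval_X, MvPolynomial.aeval_C, ← pow_add,
    Polynomial.algebraMap_eq, Polynomial.finsetSum_coeff, Polynomial.coeff_C_mul_X_pow,
    Polynomial.coeff_zero] at h1
  refine Eq.trans ?_ h1
  refine Finset.sum_congr rfl fun i _ => Finset.sum_congr rfl fun j _ => ?_
  simp [eq_comm]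

/-- The defining relations of `L^b` are the linear combinations of the `2b + 3` relations
`∑_{i + j = k} [y_i, y_j] = 0`, for `k = 0, …, 2(b + 1)`. -/
theorem quadraticAnnihilator_veroneseIdeal (b : ℕ) :
    quadraticAnnihilator (veroneseIdeal b) =
      Submodule.span ℂ (Set.range fun (k : Fin (2 * (b + 1) + 1)) (i j : Fin (b + 2)) =>
        if (i : ℕ) + j = k then (1 : ℂ) else 0) := by
  apply le_antisymm
  · intro g hg
    have hconst : ∀ i j k l : Fin (b + 2), (i : ℕ) + j = k + l → g i j = g k l := by
      intro i j k l h
      have := hg (fun p q => (if p = i then if q = j then (1 : ℂ) else 0 else 0) -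
        (if p = k then if q = l then (1 : ℂ) else 0 else 0)) (by
          have : MvPolynomial.X i * MvPolynomial.X j - MvPolynomial.X k * MvPolynomial.X l ∈
            veroneseIdeal b := Ideal.subset_span ⟨i, j, k, l, h, rfl⟩
          simpa [quadraticRelations, sub_mul, apply_ite MvPolynomial.C, ite_mul] using this)
      simpa [mul_sub, sub_eq_zero, mul_ite] using this
    have hsum : g = ∑ k : Fin (2 * (b + 1) + 1),
        g ⟨min (k : ℕ) (b + 1), by omega⟩ ⟨(k : ℕ) - min (k : ℕ) (b + 1), by omega⟩ •
          fun (i j : Fin (b + 2)) => if (i : ℕ) + j = k then (1 : ℂ) else 0 := by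
      funext i j
      simp only [Finset.sum_apply, Pi.smul_apply, smul_eq_mul]
      rw [Finset.sum_eq_single ⟨(i : ℕ) + j, by omega⟩]
      · rw [if_pos rfl, mul_one]
        exact hconst _ _ _ _ (by simp only []; omega)
      · intro k _ hk
        rw [if_neg fun h => hk (Fin.ext h.symm), mul_zero]
      · intro h; exact absurd (Finset.mem_univ _) h
    rw [hsum]
    exact Submodule.sum_mem _ fun k _ => Submodule.smul_mem _ _ (Submodule.subset_span ⟨k, rfl⟩)
  · refine Submodule.span_le.2 ?_
    rintro _ ⟨k, rfl⟩ r hr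
    exact sum_antidiagonal_eq_zero_of_mem hr k

/-! ### Euler–Hilbert series, necklace polynomials and products -/

/-- The Euler–Hilbert series `∑ χ(C_n) t^n` of a complex that is the direct sum of complexes `C_n`
of polynomial degree `n`; here `χ(C_n) = ∑ (-1)^a dim (C_n)_a` is the Euler–Poincaré
characteristic. -/
def eulerHilbertSeries (C : ℕ → ChainComplex (ModuleCat ℂ) ℕ) : PowerSeries ℤ :=
  PowerSeries.mk fun n => (C n).eulerChar

/-- The value `M_n(x) = (1/n) ∑_{d ∣ n} μ(d) x^{n/d}` of the necklace polynomial. -/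
def necklace (n : ℕ) (x : ℚ) : ℚ :=
  (1 / n) * ∑ d ∈ n.divisors, (ArithmeticFunction.moebius d : ℚ) * x ^ (n / d)

/-- The power series `1 - t^n`, for `n ≥ 1`, as a unit of `ℤ⟦t⟧`. -/
def oneSubUnit (n : ℕ+) : (PowerSeries ℤ)ˣ :=
  IsUnit.unit (a := 1 - PowerSeries.X ^ (n : ℕ))
    (PowerSeries.isUnit_iff_constantCoeff.2 (by simp [n.ne_zero]))

/-- The power series `(1 - t^n)^e`, for `n ≥ 1` and an integer `e` of either sign. -/
def oneSubPow (n : ℕ+) (e : ℤ) : PowerSeries ℤ := ((oneSubUnit n ^ e : (PowerSeries ℤ)ˣ) : _)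

theorem oneSubPow_one (n : ℕ+) : oneSubPow n 1 = 1 - PowerSeries.X ^ (n : ℕ) := by
  simp [oneSubPow, oneSubUnit]

theorem oneSubPow_add (n : ℕ+) (e f : ℤ) :
    oneSubPow n (e + f) = oneSubPow n e * oneSubPow n f := by
  simp [oneSubPow, zpow_add]

end

open scoped PowerSeries.WithPiTopology

/-! For any `L`, the algebra `C(L)` has a basis of monomials. A commuting generator of odd degree
`n` has even homological degree and contributes the factor `(1 - t^n)⁻¹`. An anticommuting generator
of even degree `n` has odd homological degree and contributes `1 - t^n`. Hence the Euler–Hilbert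
series is `∏ (1 - t^n)^{(-1)^n dim L_n}`, and it remains to find the dimensions of the components of
`L^b`. The component of degree one has dimension `b + 2`. From degree two on, `L^b` is as large as
the free graded Lie algebra on the `b` inner generators `y_1, …, y_b`, whose dimensions are `(-1)^n
M_n(-b)`.

Upper bound: the relation of index `k` contains exactly one unordered pair that involves `0` or `b +
1`, so every bracket of two generators is a combination of brackets of inner generators
(`presentedMul_presentedGen_mem`). The subalgebra generated by the inner generators is then stable
under `ad y` for every `y` of degree one, and so contains all components of degree at least two
(`presentedPart_le_lieSpan`). It is no larger than a free one (`finrank_lieSpan_le`).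

Lower bound: the relations say that `y(z) = ∑ y_i z^i` has square zero. This is solved by `y(z) =
u(z) N(z)`, where `N(z)` is a 2 × 2 matrix with scalar entries and square zero and the coefficients
`u_2, …, u_{b+1}` of `u(z)` are free noncommuting operators (`sum_nilGen_mul`). The images of the
inner generators generate a free associative algebra (`pow_le_finrank_assocSpan_repInner`), and
hence a Lie algebra at least as large as the free one (`le_finrank_lieSpan`).

Both comparisons with the free Lie algebra avoid the Poincaré–Birkhoff–Witt theorem. They use Lazard
elimination: a Lie algebra generated by `y` and `W` is the sum of the one generated by `y` and the
one generated by all `(ad y)^j w`. On the side of the counts this is the factorization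
`genSeries_elimCount`, and removing the generators one at a time, in order of degree, exhausts all
degrees up to a given `N`.

Series and products are compared through `prodExponent`, which reads off the exponents of `∏ (1 -
t^n)^{a_n}` by Möbius inversion. It is additive on products, it depends only on the series up to
degree `n`, and it turns `1 + bt` into the numbers `M_n(-b)`. The Hilbert series of the Veronese
ring is computed separately, from a basis of `n(b + 1) + 1` standard monomials in degree `n`. -/

noncomputable section

/-! ### Exponents of product expansions -/

/-- The coefficient of `t^n` in the logarithmic derivative `-t f' / f`. -/
def logDerivCoeff (f : PowerSeries ℚ) (n : ℕ) : ℚ :=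
  PowerSeries.coeff n (-(PowerSeries.X * PowerSeries.derivative ℚ f * f⁻¹))

/-- The exponent of `1 - t^n` in the expansion of `f` as a product `∏ (1 - t^n)^{a_n}`, obtained by
Möbius inversion from the logarithmic derivative. -/
def prodExponent (f : PowerSeries ℚ) (n : ℕ) : ℚ :=
  (1 / n) * ∑ d ∈ n.divisors, (ArithmeticFunction.moebius d : ℚ) * logDerivCoeff f (n / d)

theorem logDerivCoeff_mul {f g : PowerSeries ℚ} (hf : PowerSeries.constantCoeff f ≠ 0)
    (hg : PowerSeries.constantCoeff g ≠ 0) (n : ℕ) :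
    logDerivCoeff (f * g) n = logDerivCoeff f n + logDerivCoeff g n := by
  rw [logDerivCoeff, logDerivCoeff, logDerivCoeff, ← map_add]
  congr 1
  rw [PowerSeries.mul_inv_rev, Derivation.leibniz, smul_eq_mul, smul_eq_mul]
  linear_combination (-PowerSeries.X * PowerSeries.derivative ℚ g * g⁻¹) *
      PowerSeries.mul_inv_cancel f hf +
    (-PowerSeries.X * PowerSeries.derivative ℚ f * f⁻¹) * PowerSeries.mul_inv_cancel g hg

theorem prodExponent_mul {f g : PowerSeries ℚ} (hf : PowerSeries.constantCoeff f ≠ 0)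
    (hg : PowerSeries.constantCoeff g ≠ 0) (n : ℕ) :
    prodExponent (f * g) n = prodExponent f n + prodExponent g n := by
  simp only [prodExponent, logDerivCoeff_mul hf hg, mul_add, Finset.sum_add_distrib]

/-- The series `t f' = ∑ k f_k t^k` starts in degree `n` with coefficient `n f_n`, and division by a
series with constant term one keeps its leading term. -/
theorem logDerivCoeff_of_coeff_eq_zero {f : PowerSeries ℚ} {n : ℕ}
    (hf : PowerSeries.constantCoeff f = 1)
    (h : ∀ k, k ≠ 0 → k < n → PowerSeries.coeff k f = 0) :
    (∀ k < n, logDerivCoeff f k = 0) ∧ logDerivCoeff f n = -(n * PowerSeries.coeff n f) := by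
  have hc : ∀ k, PowerSeries.coeff k (PowerSeries.X * PowerSeries.derivative ℚ f) =
      k * PowerSeries.coeff k f := by
    rintro (_ | k)
    · simp
    · rw [PowerSeries.coeff_succ_X_mul, PowerSeries.coeff_derivative]
      push_cast; ring
  obtain ⟨g, hg⟩ : PowerSeries.X ^ n ∣ PowerSeries.X * PowerSeries.derivative ℚ f := by
    rw [PowerSeries.X_pow_dvd_iff]
    intro k hk
    rw [hc]
    rcases eq_or_ne k 0 with rfl | hk0
    · simp
    · rw [h k hk0 hk, mul_zero]
  have hg0 : PowerSeries.coeff 0 g = n * PowerSeries.coeff n f := by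
    rw [← hc n, hg]
    simpa using (PowerSeries.coeff_X_pow_mul g n 0).symm
  have key : ∀ k, logDerivCoeff f k = -PowerSeries.coeff k (PowerSeries.X ^ n * (g * f⁻¹)) := by
    intro k
    rw [logDerivCoeff, hg, map_neg, mul_assoc]
  constructor
  · intro k hk
    rw [key, PowerSeries.coeff_X_pow_mul', if_neg (by omega), neg_zero]
  · rw [key, PowerSeries.coeff_X_pow_mul', if_pos le_rfl, Nat.sub_self,
      PowerSeries.coeff_zero_eq_constantCoeff_apply, map_mul,
      ← PowerSeries.coeff_zero_eq_constantCoeff_apply g, hg0]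
    simp [hf]

/-- Only the divisor `d = 1` contributes to the Möbius sum, since the logarithmic derivative
vanishes below degree `n`. This makes the first exponent visible as the first coefficient, and so
makes the exponents determine the series. -/
theorem prodExponent_of_coeff_eq_zero {f : PowerSeries ℚ} {n : ℕ} (hn : n ≠ 0)
    (hf : PowerSeries.constantCoeff f = 1)
    (h : ∀ k, k ≠ 0 → k < n → PowerSeries.coeff k f = 0) :
    prodExponent f n = -PowerSeries.coeff n f := by
  obtain ⟨h1, h2⟩ := logDerivCoeff_of_coeff_eq_zero hf h
  rw [prodExponent, Finset.sum_eq_single 1]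
  · have : (n : ℚ) ≠ 0 := by exact_mod_cast hn
    rw [Nat.div_one, h2]
    simp
    field_simp
  · intro d hd hd1
    rw [h1, mul_zero]
    have := Nat.pos_of_mem_divisors hd
    exact Nat.div_lt_self (Nat.pos_of_ne_zero hn) (by omega)
  · simp [hn]

theorem coeff_eq_zero_of_prodExponent_eq_zero {f : PowerSeries ℚ} {N : ℕ}
    (hf : PowerSeries.constantCoeff f = 1) (h : ∀ n, n ≠ 0 → n ≤ N → prodExponent f n = 0)
    (n : ℕ) (hn : n ≠ 0) (hN : n ≤ N) : PowerSeries.coeff n f = 0 := by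
  induction n using Nat.strong_induction_on with
  | _ n ih =>
    have := prodExponent_of_coeff_eq_zero hn hf fun k hk hkn => ih k hkn hk (by omega)
    rw [h n hn hN] at this
    linarith

theorem dvd_sub_self_iff {m j : ℕ} (h : m ≤ j) : m ∣ j - m ↔ m ∣ j :=
  ⟨fun hd => by simpa [Nat.sub_add_cancel h] using Nat.dvd_add hd (dvd_refl m),
    fun hd => Nat.dvd_sub hd dvd_rfl⟩

theorem one_sub_X_pow_mul_mk {R : Type*} [CommRing R] {m : ℕ} (hm : m ≠ 0) :
    (1 - PowerSeries.X ^ m : PowerSeries R) *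
      (PowerSeries.mk fun k => if m ∣ k then (1 : R) else 0) = 1 := by
  ext j
  rw [sub_mul, one_mul, map_sub, PowerSeries.coeff_mk, PowerSeries.coeff_X_pow_mul',
    PowerSeries.coeff_mk, PowerSeries.coeff_one]
  rcases eq_or_ne j 0 with rfl | hj
  · simp [hm]
  · by_cases hmj : m ≤ j
    · simp [hmj, hj, dvd_sub_self_iff hmj]
    · simp [hmj, hj, Nat.not_dvd_of_pos_of_lt (Nat.pos_of_ne_zero hj) (not_le.1 hmj)]

/-- Here `-t f' / f = m t^m / (1 - t^m)`, whose coefficient at `k` is the sum over `i ∣ k` of `m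
δ_{i,m}`. Möbius inversion recovers `m δ_{n,m}`. -/
theorem prodExponent_one_sub_X_pow {m : ℕ} (hm : m ≠ 0) {n : ℕ} (hn : n ≠ 0) :
    prodExponent (1 - PowerSeries.X ^ m) n = if n = m then 1 else 0 := by
  have h0 : PowerSeries.constantCoeff (1 - PowerSeries.X ^ m : PowerSeries ℚ) ≠ 0 := by simp [hm]
  have hlog : ∀ k, k ≠ 0 → logDerivCoeff (1 - PowerSeries.X ^ m) k = if m ∣ k then (m : ℚ) else 0 := by
    intro k hk
    have hgeom := one_sub_X_pow_mul_mk (R := ℚ) hm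
    have hd : PowerSeries.derivative ℚ (1 - PowerSeries.X ^ m : PowerSeries ℚ) =
        -((m : PowerSeries ℚ) * PowerSeries.X ^ (m - 1)) := by
      simp
    rw [logDerivCoeff, (PowerSeries.inv_eq_iff_mul_eq_one h0).2 (by rw [mul_comm]; exact hgeom), hd]
    have : -(PowerSeries.X * -((m : PowerSeries ℚ) * PowerSeries.X ^ (m - 1)) *
        (PowerSeries.mk fun k => if m ∣ k then (1 : ℚ) else 0)) =
        PowerSeries.C (m : ℚ) * (PowerSeries.X ^ m *
          (PowerSeries.mk fun k => if m ∣ k then (1 : ℚ) else 0)) := by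
      obtain ⟨m, rfl⟩ := Nat.exists_eq_succ_of_ne_zero hm
      simp [pow_succ]; ring
    rw [this, PowerSeries.coeff_C_mul, PowerSeries.coeff_X_pow_mul', PowerSeries.coeff_mk]
    by_cases hmj : m ≤ k
    · simp [hmj, dvd_sub_self_iff hmj]
    · simp [hmj, Nat.not_dvd_of_pos_of_lt (Nat.pos_of_ne_zero hk) (not_le.1 hmj)]
  have hM := (ArithmeticFunction.sum_eq_iff_sum_mul_moebius_eq
    (f := fun i : ℕ => if i = m then (m : ℚ) else 0)
    (g := fun k => if m ∣ k then (m : ℚ) else 0)).1 (fun k hk => by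
      rw [Finset.sum_ite_eq']
      simp [hk.ne']) n (Nat.pos_of_ne_zero hn)
  rw [Nat.sum_divisorsAntidiagonal (fun x y =>
    (ArithmeticFunction.moebius x : ℚ) * if m ∣ y then (m : ℚ) else 0)] at hM
  have : ∑ d ∈ n.divisors, (ArithmeticFunction.moebius d : ℚ) *
      logDerivCoeff (1 - PowerSeries.X ^ m) (n / d) = if n = m then (m : ℚ) else 0 := by
    rw [← hM]
    refine Finset.sum_congr rfl fun d hd => ?_
    rw [hlog _ (Nat.div_ne_zero_iff_of_dvd (Nat.dvd_of_mem_divisors hd) |>.2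
      ⟨hn, (Nat.pos_of_mem_divisors hd).ne'⟩)]
  rw [prodExponent, this]
  split_ifs with h
  · subst h
    have : (n : ℚ) ≠ 0 := by exact_mod_cast hn
    field_simp
  · simp

/-- The logarithmic derivative `-ct / (1 + ct)` has the coefficients `(-c)^k`, and the Möbius sum of
these is by definition the necklace polynomial. -/
theorem prodExponent_one_add_mul_X (c : ℚ) (n : ℕ) (hn : n ≠ 0) :
    prodExponent (1 + PowerSeries.C c * PowerSeries.X) n = necklace n (-c) := by
  have h0 : PowerSeries.constantCoeff (1 + PowerSeries.C c * PowerSeries.X : PowerSeries ℚ) ≠ 0 := by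
    simp
  have hgeom : (1 + PowerSeries.C c * PowerSeries.X : PowerSeries ℚ) *
      (PowerSeries.mk fun k => (-c) ^ k) = 1 := by
    ext j
    rw [add_mul, one_mul, map_add, PowerSeries.coeff_mk, mul_assoc, PowerSeries.coeff_C_mul,
      PowerSeries.coeff_one]
    rcases j with _ | j
    · simp
    · rw [PowerSeries.coeff_succ_X_mul, PowerSeries.coeff_mk]
      simp; ring
  have hlog : ∀ k, k ≠ 0 → logDerivCoeff (1 + PowerSeries.C c * PowerSeries.X) k = (-c) ^ k := by
    intro k hk
    have hd : PowerSeries.derivative ℚ (1 + PowerSeries.C c * PowerSeries.X : PowerSeries ℚ) =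
        PowerSeries.C c := by
      rw [← PowerSeries.smul_eq_C_mul]
      simp [PowerSeries.smul_eq_C_mul]
    rw [logDerivCoeff, (PowerSeries.inv_eq_iff_mul_eq_one h0).2 (by rw [mul_comm]; exact hgeom), hd]
    obtain ⟨k, rfl⟩ := Nat.exists_eq_succ_of_ne_zero hk
    rw [map_neg, mul_assoc, PowerSeries.coeff_succ_X_mul, PowerSeries.coeff_C_mul,
      PowerSeries.coeff_mk, Nat.succ_eq_add_one, pow_succ]
    ring
  rw [prodExponent, necklace]
  congr 1
  refine Finset.sum_congr rfl fun d hd => ?_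
  rw [hlog _ (Nat.div_ne_zero_iff_of_dvd (Nat.dvd_of_mem_divisors hd) |>.2
      ⟨hn, (Nat.pos_of_mem_divisors hd).ne'⟩)]

theorem constantCoeff_unit_ne_zero (u : (PowerSeries ℤ)ˣ) :
    PowerSeries.constantCoeff (PowerSeries.map (Int.castRingHom ℚ) u) ≠ 0 := by
  have := (u.isUnit.map (PowerSeries.map (Int.castRingHom ℚ))).map
    (PowerSeries.constantCoeff (R := ℚ))
  exact this.ne_zero

/-- `prodExponent` on the units of `ℤ⟦t⟧`, as a group homomorphism. -/
def unitExponent (n : ℕ) : (PowerSeries ℤ)ˣ →* Multiplicative ℚ :=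
  MonoidHom.mk' (fun u => Multiplicative.ofAdd
    (prodExponent (PowerSeries.map (Int.castRingHom ℚ) u) n)) fun u v => by
    rw [Units.val_mul, map_mul, prodExponent_mul (constantCoeff_unit_ne_zero u)
      (constantCoeff_unit_ne_zero v), ofAdd_add]

theorem unitExponent_apply (n : ℕ) (u : (PowerSeries ℤ)ˣ) :
    (unitExponent n u).toAdd = prodExponent (PowerSeries.map (Int.castRingHom ℚ) u) n := rfl

theorem unitExponent_oneSubUnit_zpow (m : ℕ+) (a : ℤ) {n : ℕ} (hn : n ≠ 0) :
    (unitExponent n (oneSubUnit m ^ a)).toAdd = if n = m then (a : ℚ) else 0 := by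
  have h : (unitExponent n (oneSubUnit m)).toAdd = if n = m then (1 : ℚ) else 0 := by
    rw [unitExponent_apply, ← prodExponent_one_sub_X_pow m.ne_zero hn]
    simp [oneSubUnit]
  rw [map_zpow, toAdd_zpow, h]
  simp

/-- If the exponents of `f` at the elements of `s ⊇ {1, …, N}` are `a_n`, then `f` and
`∏_{n ∈ s} (1 - t^n)^{a_n}` agree up to degree `N`. -/
theorem coeff_prod_oneSubPow {f : PowerSeries ℤ} (hf : PowerSeries.constantCoeff f = 1)
    {a : ℕ+ → ℤ} {N : ℕ}
    (h : ∀ n : ℕ+, (n : ℕ) ≤ N → prodExponent (PowerSeries.map (Int.castRingHom ℚ) f) n = a n)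
    {s : Finset ℕ+} (hs : ∀ n : ℕ+, (n : ℕ) ≤ N → n ∈ s) :
    PowerSeries.coeff N (∏ n ∈ s, oneSubPow n (a n)) = PowerSeries.coeff N f := by
  obtain ⟨u, rfl⟩ : IsUnit f := PowerSeries.isUnit_iff_constantCoeff.2 (by simp [hf])
  set v : (PowerSeries ℤ)ˣ := ∏ n ∈ s, oneSubUnit n ^ a n with hv
  have hvp : ∏ n ∈ s, oneSubPow n (a n) = v := by
    rw [hv, Units.coe_prod]; rfl
  have hv1 : PowerSeries.constantCoeff (v : PowerSeries ℤ) = 1 := by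
    have : Units.map (PowerSeries.constantCoeff (R := ℤ)).toMonoidHom v = 1 := by
      rw [hv, map_prod]
      refine Finset.prod_eq_one fun n _ => ?_
      rw [map_zpow]
      have : Units.map (PowerSeries.constantCoeff (R := ℤ)).toMonoidHom (oneSubUnit n) = 1 := by
        ext; simp [oneSubUnit]
      rw [this, one_zpow]
    exact congrArg Units.val this
  have hvi1 : PowerSeries.constantCoeff ((v⁻¹ : (PowerSeries ℤ)ˣ) : PowerSeries ℤ) = 1 := by
    have h1 := congrArg PowerSeries.constantCoeff (v.mul_inv)
    rwa [map_mul, hv1, one_mul, map_one] at h1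
  -- The quotient of `f` by the finite product has zero exponents up to `N`, so it is `1` modulo
  -- `t^(N+1)`.
  have hw : ∀ n, n ≠ 0 → n ≤ N →
      PowerSeries.coeff n ((u * v⁻¹ : (PowerSeries ℤ)ˣ) : PowerSeries ℤ) = 0 := by
    intro n hn hnN
    have := coeff_eq_zero_of_prodExponent_eq_zero (N := N)
      (f := PowerSeries.map (Int.castRingHom ℚ) ((u * v⁻¹ : (PowerSeries ℤ)ˣ) : PowerSeries ℤ))
      ?_ ?_ n hn hnN
    · rw [PowerSeries.coeff_map] at this
      simpa using this
    · rw [← PowerSeries.coeff_zero_eq_constantCoeff_apply, PowerSeries.coeff_map,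
        PowerSeries.coeff_zero_eq_constantCoeff_apply, Units.val_mul, map_mul, hf, hvi1]
      simp
    · intro n hn hnN
      rw [← unitExponent_apply, map_mul, map_inv, hv, map_prod, toAdd_mul, toAdd_inv, toAdd_prod,
        unitExponent_apply]
      simp only [unitExponent_oneSubUnit_zpow _ _ hn]
      rw [show prodExponent _ n = _ from h ⟨n, Nat.pos_of_ne_zero hn⟩ hnN,
        Finset.sum_eq_single ⟨n, Nat.pos_of_ne_zero hn⟩]
      · simp
      · intro m _ hm
        rw [if_neg]
        rintro rfl
        exact hm rfl
      · intro hns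
        exact absurd (hs ⟨n, Nat.pos_of_ne_zero hn⟩ hnN) hns
  rw [hvp]
  have huv : (u : PowerSeries ℤ) = v * ((u * v⁻¹ : (PowerSeries ℤ)ˣ) : PowerSeries ℤ) := by
    rw [← Units.val_mul]; congr 1; simp
  rw [huv, PowerSeries.coeff_mul, Finset.sum_eq_single (N, 0)]
  · simp [hf, hvi1]
  · rintro ⟨i, j⟩ hij hne
    have hij := Finset.HasAntidiagonal.mem_antidiagonal.1 hij
    rw [hw j (fun hj => hne (by simp at hij; ext <;> simp <;> omega)) (by simp at hij; omega),
      mul_zero]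
  · simp

/-- Convergence is coefficientwise: the coefficient of `t^N` of a partial product is already that of
`f` once all factors of index at most `N` are present. -/
theorem hasProd_oneSubPow {f : PowerSeries ℤ} (hf : PowerSeries.constantCoeff f = 1)
    {a : ℕ+ → ℤ}
    (h : ∀ n : ℕ+, prodExponent (PowerSeries.map (Int.castRingHom ℚ) f) n = a n) :
    HasProd (fun n : ℕ+ => oneSubPow n (a n)) f := by
  rw [HasProd, PowerSeries.WithPiTopology.tendsto_iff_coeff_tendsto]
  intro N
  refine tendsto_const_nhds.congr' ?_
  rw [SummationFilter.unconditional_filter]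
  -- The interval ends at `N + 1` and not at `N` only because its endpoint must be positive also for
  -- `N = 0`.
  filter_upwards [Filter.eventually_ge_atTop
    (Finset.Icc 1 N.succPNat)] with s hs
  refine (coeff_prod_oneSubPow hf (fun n _ => h n) fun n hn => hs ?_).symm
  rw [Finset.mem_Icc, ← PNat.coe_le_coe n, Nat.succPNat_coe]
  exact ⟨_root_.one_le, by omega⟩

/-- The quotient `f / g = 1 + (f - g) g⁻¹` is `1` modulo `t^(N+1)`, so its exponents up to `N`
vanish. Thus an infinite product may be replaced by a truncation. -/
theorem prodExponent_congr {f g : PowerSeries ℚ} {N : ℕ} (hf : PowerSeries.constantCoeff f = 1)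
    (hg : PowerSeries.constantCoeff g = 1)
    (h : ∀ n ≤ N, PowerSeries.coeff n f = PowerSeries.coeff n g) {n : ℕ} (hn : n ≠ 0)
    (hN : n ≤ N) : prodExponent f n = prodExponent g n := by
  have hg0 : PowerSeries.constantCoeff g ≠ 0 := by simp [hg]
  have hfg : f = g * (1 + (f - g) * g⁻¹) := by
    linear_combination -(f - g) * PowerSeries.mul_inv_cancel g hg0
  obtain ⟨r, hr⟩ : PowerSeries.X ^ (N + 1) ∣ f - g := by
    rw [PowerSeries.X_pow_dvd_iff]
    intro k hk
    rw [map_sub, h k (by omega), sub_self]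
  have hc : ∀ k, k ≠ 0 → k ≤ n → PowerSeries.coeff k (1 + (f - g) * g⁻¹) = 0 := by
    intro k hk hkn
    rw [hr, mul_assoc, map_add, PowerSeries.coeff_X_pow_mul', if_neg (by omega),
      PowerSeries.coeff_one, if_neg hk, add_zero]
  have h1 : PowerSeries.constantCoeff (1 + (f - g) * g⁻¹) = 1 := by simp [hf, hg]
  rw [hfg, prodExponent_mul hg0 (by simp [h1]),
    prodExponent_of_coeff_eq_zero hn h1 fun k hk hkn => hc k hk hkn.le, hc n hn le_rfl, neg_zero,
    add_zero]

end

noncomputable section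

/-! ### The generating function of monomials in commuting and anticommuting variables -/

/-- The degree of a monomial `(α, s)` in commuting variables of degrees `d i` and anticommuting
variables of degrees `e j`. -/
def monomialDegree {κ I : Type} {M : Type*} [AddCommMonoid M] (d : κ → M) (e : I → M)
    (k : (κ →₀ ℕ) × Finset I) : M :=
  k.1.sum (fun i m => m • d i) + ∑ j ∈ k.2, e j

theorem coe_oneSubUnit_inv (n : ℕ+) : ((oneSubUnit n)⁻¹ : (PowerSeries ℤ)ˣ).1 =
    PowerSeries.mk fun k => if (n : ℕ) ∣ k then (1 : ℤ) else 0 := by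
  rw [Units.inv_eq_of_mul_eq_one_right]
  exact one_sub_X_pow_mul_mk n.ne_zero

section

variable {κ I : Type} (d : κ → ℕ+) (e : I → ℕ+) (N : ℕ) (S : Finset κ) (T : Finset I)

/-- A term of the product of geometric series is a choice of degrees `l_i` divisible by `d i` with
sum `m`, and `l_i = α_i d_i` turns these into exponent vectors. A variable outside `S` has degree
above `m` and cannot occur. -/
theorem coeff_prod_oneSubUnit_inv {m : ℕ} (hS : ∀ i, (d i : ℕ) ≤ m → i ∈ S)
    (A : Finset (κ →₀ ℕ)) (hA : ∀ α, α ∈ A ↔ (α.sum fun i k => k * (d i : ℕ)) = m) :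
    PowerSeries.coeff m (∏ i ∈ S, ((oneSubUnit (d i))⁻¹ : (PowerSeries ℤ)ˣ).1) = A.card := by
  classical
  have hsupp : ∀ α ∈ A, α.support ⊆ S := by
    intro α hα i hi
    refine hS i ?_
    rw [← (hA α).1 hα]
    refine le_trans ?_ (Finset.single_le_sum (f := fun i => α i * (d i : ℕ))
      (fun _ _ => Nat.zero_le _) hi)
    exact Nat.le_mul_of_pos_left _ (Nat.pos_of_ne_zero (Finsupp.mem_support_iff.1 hi))
  rw [PowerSeries.coeff_prod]
  simp only [coe_oneSubUnit_inv, PowerSeries.coeff_mk]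
  simp only [Finset.prod_ite_zero, Finset.prod_const_one]
  rw [Finset.sum_boole, Nat.cast_inj]
  refine (Finset.card_nbij'
    (fun α => Finsupp.onFinset α.support (fun i => α i * (d i : ℕ)) fun i hi => by
      rw [Finsupp.mem_support_iff]; exact left_ne_zero_of_mul hi)
    (fun l => Finsupp.onFinset l.support (fun i => l i / (d i : ℕ)) fun i hi => by
      rw [Finsupp.mem_support_iff]; rintro h; rw [h, Nat.zero_div] at hi; exact hi rfl)
    ?_ ?_ ?_ ?_).symm
  · intro α hα
    have hα' := (hA α).1 hα
    rw [Finset.mem_coe, Finset.mem_filter, Finset.mem_finsuppAntidiag]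
    refine ⟨⟨?_, ?_⟩, fun i _ => ?_⟩
    · rw [← hα', Finsupp.sum_of_support_subset _ (hsupp α hα)]
      · rfl
      · simp
    · exact Finsupp.support_onFinset_subset.trans (hsupp α hα)
    · exact Dvd.intro_left _ rfl
  · intro l hl
    rw [Finset.mem_coe, Finset.mem_filter, Finset.mem_finsuppAntidiag] at hl
    rw [Finset.mem_coe, hA, Finsupp.sum_of_support_subset _
      (Finsupp.support_onFinset_subset.trans hl.1.2)]
    · refine Eq.trans (Finset.sum_congr rfl fun i hi => ?_) hl.1.1
      exact Nat.div_mul_cancel (hl.2 i hi)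
    · simp
  · intro α hα
    ext i
    exact Nat.mul_div_cancel _ (d i).pos
  · intro l hl
    rw [Finset.mem_coe, Finset.mem_filter, Finset.mem_finsuppAntidiag] at hl
    ext i
    by_cases hi : i ∈ S
    · exact Nat.div_mul_cancel (hl.2 i hi)
    · have : l i = 0 := Finsupp.notMem_support_iff.1 fun h => hi (hl.1.2 h)
      simp [this]

theorem coeff_prod_oneSubUnit (m : ℕ) :
    PowerSeries.coeff m (∏ j ∈ T, (oneSubUnit (e j)).1) =
      ∑ s ∈ T.powerset with (∑ j ∈ s, (e j : ℕ)) = m, (-1 : ℤ) ^ s.card := by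
  have : ∏ j ∈ T, (oneSubUnit (e j)).1 =
      ∑ s ∈ T.powerset, PowerSeries.C ((-1 : ℤ) ^ s.card) *
        PowerSeries.X ^ (∑ j ∈ s, (e j : ℕ)) := by
    have h1 : ∀ j, (oneSubUnit (e j)).1 = 1 + -PowerSeries.X ^ (e j : ℕ) := by
      intro j; rw [← sub_eq_add_neg]; rfl
    simp only [h1]
    rw [Finset.prod_one_add]
    refine Finset.sum_congr rfl fun s _ => ?_
    rw [Finset.prod_neg, Finset.prod_pow_eq_pow_sum]
    simp
  rw [this, map_sum, Finset.sum_filter]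
  refine Finset.sum_congr rfl fun s _ => ?_
  rw [PowerSeries.coeff_C_mul, PowerSeries.coeff_X_pow]
  simp [eq_comm]

theorem finite_monomialDegree_eq (hS : ∀ i, (d i : ℕ) ≤ N → i ∈ S)
    (hT : ∀ j, (e j : ℕ) ≤ N → j ∈ T) :
    {k : (κ →₀ ℕ) × Finset I |
      monomialDegree (fun i => (d i : ℕ)) (fun j => (e j : ℕ)) k = N}.Finite := by
  classical
  refine ((Finset.finite_toSet ((Finset.range (N + 1)).biUnion
    fun m => S.finsuppAntidiag m)).prod (Finset.finite_toSet T.powerset)).subset ?_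
  rintro ⟨α, s⟩ h
  have h : (α.sum fun i m => m * (d i : ℕ)) + ∑ j ∈ s, (e j : ℕ) = N := h
  have hsupp : α.support ⊆ S := by
    intro i hi
    have h1 := Finset.single_le_sum (f := fun i => α i * (d i : ℕ))
      (fun _ _ => Nat.zero_le _) hi
    have h2 : (d i : ℕ) ≤ α i * d i :=
      Nat.le_mul_of_pos_left _ (Nat.pos_of_ne_zero (Finsupp.mem_support_iff.1 hi))
    refine hS i ?_
    rw [Finsupp.sum] at h
    omega
  constructor
  · simp only [Finset.coe_biUnion, Set.mem_iUnion, Finset.mem_coe, Finset.mem_range,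
      Finset.mem_finsuppAntidiag]
    refine ⟨S.sum α, ?_, rfl, hsupp⟩
    have h1 : S.sum α ≤ α.sum fun i m => m * (d i : ℕ) := by
      rw [Finsupp.sum_of_support_subset _ hsupp _ (by simp)]
      exact Finset.sum_le_sum fun i _ => Nat.le_mul_of_pos_right _ (d i).pos
    omega
  · rw [Finset.mem_coe, Finset.mem_powerset]
    change s ⊆ T
    intro j hj
    have h1 := Finset.single_le_sum (f := fun j => (e j : ℕ)) (fun _ _ => Nat.zero_le _) hj
    exact hT j (by omega)

/-- The signed number of the monomials of degree `N` is the coefficient of `t^N` in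
`∏ (1 - t^{d i})⁻¹ ∏ (1 - t^{e j})`. -/
theorem sum_monomials_eq_coeff (hS : ∀ i, (d i : ℕ) ≤ N → i ∈ S)
    (hT : ∀ j, (e j : ℕ) ≤ N → j ∈ T) (K : Finset ((κ →₀ ℕ) × Finset I))
    (hK : ∀ k, k ∈ K ↔ monomialDegree (fun i => (d i : ℕ)) (fun j => (e j : ℕ)) k = N) :
    ∑ k ∈ K, (-1 : ℤ) ^ k.2.card = PowerSeries.coeff N
      (((∏ i ∈ S, (oneSubUnit (d i))⁻¹) * ∏ j ∈ T, oneSubUnit (e j) : (PowerSeries ℤ)ˣ) :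
        PowerSeries ℤ) := by
  classical
  have hK' : ∀ α s, (α, s) ∈ K ↔
      (α.sum fun i m => m * (d i : ℕ)) + ∑ j ∈ s, (e j : ℕ) = N := fun α s => hK (α, s)
  rw [Units.val_mul, Units.coe_prod, Units.coe_prod, PowerSeries.coeff_mul]
  have hfin : ∀ m ≤ N, {α : κ →₀ ℕ | (α.sum fun i k => k * (d i : ℕ)) = m}.Finite := by
    intro m hm
    have := finite_monomialDegree_eq d e m S T (fun i hi => hS i (hi.trans hm))
      (fun j hj => hT j (hj.trans hm))
    refine (this.image Prod.fst).subset ?_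
    intro α hα
    exact ⟨(α, ∅), by simpa [monomialDegree] using hα, rfl⟩
  -- The condition `m ≤ N` is put into the set to make it finite for every `m`, so that it defines a
  -- finset over each pair of degrees.
  have hfin' : ∀ m, {α : κ →₀ ℕ | m ≤ N ∧ (α.sum fun i k => k * (d i : ℕ)) = m}.Finite := by
    intro m
    by_cases hm : m ≤ N
    · exact (hfin m hm).subset fun α hα => hα.2
    · convert Set.finite_empty
      ext α; simp [hm]
  have hterm : ∀ p ∈ Finset.HasAntidiagonal.antidiagonal N,
      PowerSeries.coeff p.1 (∏ i ∈ S, ((oneSubUnit (d i))⁻¹ : (PowerSeries ℤ)ˣ).1) *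
        PowerSeries.coeff p.2 (∏ j ∈ T, (oneSubUnit (e j)).1) =
      ∑ k ∈ (hfin' p.1).toFinset ×ˢ T.powerset.filter (fun s => (∑ j ∈ s, (e j : ℕ)) = p.2),
        (-1 : ℤ) ^ k.2.card := by
    intro p hp
    have hp := Finset.HasAntidiagonal.mem_antidiagonal.1 hp
    rw [coeff_prod_oneSubUnit_inv d S (fun i hi => hS i (by omega)) (hfin' p.1).toFinset,
      coeff_prod_oneSubUnit, Finset.sum_product]
    · simp
    · intro α
      simp only [Set.Finite.mem_toFinset, Set.mem_ofPred_eq, and_iff_right_iff_imp]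
      omega
  rw [Finset.sum_congr rfl hterm, Finset.sum_sigma']
  refine Finset.sum_nbij' (fun k => ⟨(k.1.sum fun i m => m * (d i : ℕ), ∑ j ∈ k.2, (e j : ℕ)), k⟩)
    (fun x => x.2) ?_ ?_ ?_ ?_ ?_
  · rintro ⟨α, s⟩ hk
    have hk := (hK' α s).1 hk
    simp only [Finset.mem_sigma, Finset.HasAntidiagonal.mem_antidiagonal, Finset.mem_product,
      Set.Finite.mem_toFinset, Set.mem_ofPred_eq, Finset.mem_filter, Finset.mem_powerset, and_true]
    refine ⟨hk, by omega, fun j hj => ?_⟩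
    have h1 := Finset.single_le_sum (f := fun j => (e j : ℕ)) (fun _ _ => Nat.zero_le _) hj
    exact hT j (by omega)
  · rintro ⟨⟨m, m'⟩, ⟨α, s⟩⟩ hx
    simp only [Finset.mem_sigma, Finset.HasAntidiagonal.mem_antidiagonal, Finset.mem_product,
      Set.Finite.mem_toFinset, Set.mem_ofPred_eq, Finset.mem_filter] at hx
    rw [hK']
    omega
  · rintro ⟨α, s⟩ hk; rfl
  · rintro ⟨⟨m, m'⟩, ⟨α, s⟩⟩ hx
    simp only [Finset.mem_sigma, Finset.HasAntidiagonal.mem_antidiagonal, Finset.mem_product,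
      Set.Finite.mem_toFinset, Set.mem_ofPred_eq, Finset.mem_filter] at hx
    obtain ⟨-, ⟨-, rfl⟩, -, rfl⟩ := hx
    rfl
  · rintro ⟨α, s⟩ hk; rfl

end

end

noncomputable section

theorem dfinsupp_basis_apply {ι : Type*} [DecidableEq ι] {M : ι → Type*}
    [∀ i, AddCommMonoid (M i)] [∀ i, Module ℂ (M i)] {η : ι → Type*}
    (b : ∀ i, Module.Basis (η i) ℂ (M i)) (k : Σ i, η i) :
    DFinsupp.basis b k = DFinsupp.lsingle (R := ℂ) k.1 (b k.1 k.2) := by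
  classical
  rw [Module.Basis.apply_eq_iff, DFinsupp.basis]
  simp only [LinearEquiv.trans_apply, DFinsupp.mapRange.linearEquiv_apply]
  rw [LinearEquiv.symm_apply_eq]
  simp [sigmaFinsuppLequivDFinsupp]

namespace PosGradedLie

variable (L : PosGradedLie)

/-! ### A basis of the Chevalley cochains -/

/-- The automorphism of `oddDual` that multiplies `L_n^*` by `c n`. -/
def scaleOdd (c : ℕ → ℂ) : L.oddDual →ₗ[ℂ] L.oddDual :=
  DirectSum.lmap fun n => c n • LinearMap.id

/-- The automorphism of `evenDual` that multiplies `L_n^*` by `c n`. -/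
def scaleEven (c : ℕ → ℂ) : L.evenDual →ₗ[ℂ] L.evenDual :=
  DirectSum.lmap fun n => c n • LinearMap.id

/-- The endomorphism of `C(L)` that multiplies the generators in `L_n^*` by `c n`. -/
def scale (c : ℕ → ℂ) : L.Cochains →ₐ[ℂ] L.Cochains :=
  Algebra.TensorProduct.map
    (SymmetricAlgebra.lift (SymmetricAlgebra.ι ℂ L.oddDual ∘ₗ L.scaleOdd c))
    (ExteriorAlgebra.map (L.scaleEven c))

theorem scale_ofOdd (c : ℕ → ℂ) (v : L.oddDual) :
    L.scale c (L.ofOdd v) = L.ofOdd (L.scaleOdd c v) := by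
  have : L.scale c (L.ofSym (SymmetricAlgebra.ι ℂ L.oddDual v)) =
      L.ofSym (SymmetricAlgebra.lift (SymmetricAlgebra.ι ℂ L.oddDual ∘ₗ L.scaleOdd c)
        (SymmetricAlgebra.ι ℂ L.oddDual v)) :=
    (Algebra.TensorProduct.map_tmul _ _ _ _).trans (by rw [map_one]; rfl)
  rwa [SymmetricAlgebra.lift_ι_apply] at this

theorem scale_ofEven (c : ℕ → ℂ) (v : L.evenDual) :
    L.scale c (L.ofEven v) = L.ofEven (L.scaleEven c v) := by
  have : L.scale c (L.ofExt (ExteriorAlgebra.ι ℂ v)) =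
      L.ofExt (ExteriorAlgebra.map (L.scaleEven c) (ExteriorAlgebra.ι ℂ v)) :=
    (Algebra.TensorProduct.map_tmul _ _ _ _).trans (by rw [map_one]; rfl)
  rwa [ExteriorAlgebra.map_apply_ι] at this

theorem scale_gen (c : ℕ → ℂ) (n : ℕ) (φ : Module.Dual ℂ (L.part n)) :
    L.scale c (L.gen n φ) = c n • L.gen n φ := by
  by_cases h : Even n
  · rw [gen, dif_pos h, LinearMap.comp_apply, scale_ofEven, scaleEven, DirectSum.lmap_lof,
      LinearMap.smul_apply, LinearMap.id_apply, map_smul, map_smul]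
  · rw [gen, dif_neg h, LinearMap.comp_apply, scale_ofOdd, scaleOdd, DirectSum.lmap_lof,
      LinearMap.smul_apply, LinearMap.id_apply, map_smul, map_smul]

theorem scale_list_prod (c : ℕ → ℂ) (l : List (Σ i : ℕ, Module.Dual ℂ (L.part i))) :
    L.scale c (l.map fun φ => L.gen φ.1 φ.2).prod =
      (l.map fun φ => c φ.1).prod • (l.map fun φ => L.gen φ.1 φ.2).prod := by
  induction l with
  | nil => simp
  | cons φ l ih =>
    simp only [List.map_cons, List.prod_cons, map_mul, ih, scale_gen, smul_mul_smul_comm]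

/-- The component `bipart a n` is only given as a span of products. Two diagonal endomorphisms
separate the bidegrees, because `2` is not a root of unity. The first needs integer exponents, since
a generator of degree `0` has weight `-1`. -/
theorem scale_of_mem_bipart {a : ℤ} {n : ℕ} {x : L.Cochains} (hx : x ∈ L.bipart a n) :
    L.scale (fun i => (2 : ℂ) ^ ((i : ℤ) - 1)) x = (2 : ℂ) ^ a • x ∧
      L.scale (fun i => (2 : ℂ) ^ i) x = (2 : ℂ) ^ n • x := by
  induction hx using Submodule.span_induction with
  | mem x hx =>
    obtain ⟨l, rfl, rfl, rfl⟩ := hx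
    rw [scale_list_prod, scale_list_prod]
    constructor <;> congr 1 <;> clear * -
    · induction l with
      | nil => simp
      | cons φ l ih =>
        rw [List.map_cons, List.prod_cons, ih, List.map_cons, List.sum_cons,
          zpow_add₀ two_ne_zero]
    · induction l with
      | nil => simp
      | cons φ l ih => rw [List.map_cons, List.prod_cons, ih, List.map_cons, List.sum_cons, pow_add]
  | zero => simp
  | add x y _ _ hx hy => simp only [map_add, hx, hy, smul_add, and_self]
  | smul r x _ hx =>
    rw [map_smul, map_smul, hx.1, hx.2, smul_comm r, smul_comm r]
    exact ⟨rfl, rfl⟩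

/-- The indices of a homogeneous basis of `oddDual`. -/
def OddIndex : Type := Σ n : {n : ℕ // Odd n}, Fin (Module.finrank ℂ (L.part n))

/-- The indices of a homogeneous basis of `evenDual`. -/
def EvenIndex : Type := Σ n : {n : ℕ // Even n}, Fin (Module.finrank ℂ (L.part n))

/-- The basis of the exterior algebra consists of products in increasing order of the indices; any
linear order serves. -/
instance : LinearOrder L.EvenIndex := IsWellOrder.linearOrder WellOrderingRel

theorem OddIndex.pos (i : L.OddIndex) : 0 < i.1.1 := i.1.2.pos

/-- The index `0` is even but carries no basis element, as `L_0 = 0`. Without this the components of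
given polynomial degree could have infinitely many monomials to sort. -/
theorem EvenIndex.pos (i : L.EvenIndex) : 0 < i.1.1 := by
  refine Nat.pos_of_ne_zero fun h => ?_
  have h1 : Module.finrank ℂ (L.part i.1) = 0 := by
    rw [h]
    have := L.part_zero
    exact Module.finrank_zero_of_subsingleton
  exact (Fin.cast h1 i.2).elim0

/-- The degree of an element of the basis of `oddDual`. -/
def oddDegree (i : L.OddIndex) : ℕ+ := ⟨i.1.1, i.pos⟩

/-- The degree of an element of the basis of `evenDual`. -/
def evenDegree (i : L.EvenIndex) : ℕ+ := ⟨i.1.1, i.pos⟩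

theorem oddDegree_odd (i : L.OddIndex) : Odd (L.oddDegree i : ℕ) := i.1.2

theorem evenDegree_even (i : L.EvenIndex) : Even (L.evenDegree i : ℕ) := i.1.2

/-- A homogeneous basis of `oddDual`. -/
def oddBasis : Module.Basis L.OddIndex ℂ L.oddDual :=
  DFinsupp.basis fun n => (Module.finBasis ℂ (L.part n)).dualBasis

/-- A homogeneous basis of `evenDual`. -/
def evenBasis : Module.Basis L.EvenIndex ℂ L.evenDual :=
  DFinsupp.basis fun n => (Module.finBasis ℂ (L.part n)).dualBasis

theorem ofOdd_oddBasis_mem (i : L.OddIndex) :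
    L.ofOdd (L.oddBasis i) ∈ L.bipart ((L.oddDegree i : ℤ) - 1) (L.oddDegree i) := by
  have h : L.oddBasis i = DirectSum.lof ℂ _ (fun n : {n : ℕ // Odd n} => Module.Dual ℂ (L.part n))
      i.1 ((Module.finBasis ℂ (L.part i.1)).dualBasis i.2) := by
    exact dfinsupp_basis_apply _ i
  have := L.gen_mem_bipart i.1 ((Module.finBasis ℂ (L.part i.1)).dualBasis i.2)
  rw [gen, dif_neg (Nat.not_even_iff_odd.2 i.1.2)] at this
  rw [h]
  exact this

theorem ofEven_evenBasis_mem (i : L.EvenIndex) :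
    L.ofEven (L.evenBasis i) ∈ L.bipart ((L.evenDegree i : ℤ) - 1) (L.evenDegree i) := by
  have h : L.evenBasis i = DirectSum.lof ℂ _ (fun n : {n : ℕ // Even n} => Module.Dual ℂ (L.part n))
      i.1 ((Module.finBasis ℂ (L.part i.1)).dualBasis i.2) := by
    exact dfinsupp_basis_apply _ i
  have := L.gen_mem_bipart i.1 ((Module.finBasis ℂ (L.part i.1)).dualBasis i.2)
  rw [gen, dif_pos i.1.2] at this
  rw [h]
  exact this

/-- The monomial basis of `C(L)`. -/
def cochainBasis : Module.Basis ((L.OddIndex →₀ ℕ) × Finset L.EvenIndex) ℂ L.Cochains :=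
  L.oddBasis.symmetricAlgebra.tensorProduct L.evenBasis.ExteriorAlgebra

theorem cochainBasis_apply (k : (L.OddIndex →₀ ℕ) × Finset L.EvenIndex) :
    L.cochainBasis k = L.ofSym (L.oddBasis.symmetricAlgebra k.1) *
      L.ofExt (L.evenBasis.ExteriorAlgebra k.2) := by
  refine (Module.Basis.tensorProduct_apply _ _ k.1 k.2).trans ?_
  refine Eq.trans ?_ (Algebra.TensorProduct.tmul_mul_tmul _ _ _ _).symm
  rw [mul_one, one_mul]

theorem one_mem_bipart : (1 : L.Cochains) ∈ L.bipart 0 0 :=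
  Submodule.subset_span ⟨[], by simp, by simp, by simp⟩

theorem pow_mem_bipart {a : ℤ} {n : ℕ} {c : L.Cochains} (h : c ∈ L.bipart a n) (m : ℕ) :
    c ^ m ∈ L.bipart (m • a) (m • n) := by
  induction m with
  | zero => simpa using L.one_mem_bipart
  | succ m ih =>
    rw [pow_succ, succ_nsmul, succ_nsmul]
    exact L.bipart_mul ih h

theorem ofSym_basis_mem (α : L.OddIndex →₀ ℕ) :
    L.ofSym (L.oddBasis.symmetricAlgebra α) ∈ L.bipart
      (α.sum fun i m => m • ((L.oddDegree i : ℤ) - 1)) (α.sum fun i m => m • (L.oddDegree i : ℕ)) := by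
  have hb : ∀ α, L.oddBasis.symmetricAlgebra α =
      (SymmetricAlgebra.equivMvPolynomial L.oddBasis).symm (MvPolynomial.monomial α 1) := by
    intro α; simp [Module.Basis.symmetricAlgebra]
  induction α using Finsupp.induction_linear with
  | zero =>
    rw [hb]
    simpa using L.one_mem_bipart
  | add α β hα hβ =>
    rw [hb, show (MvPolynomial.monomial (α + β) (1 : ℂ)) = MvPolynomial.monomial α 1 *
      MvPolynomial.monomial β 1 by rw [MvPolynomial.monomial_mul, one_mul], map_mul, ← hb, ← hb,
      map_mul, Finsupp.sum_add_index' (by simp) (by intros; exact add_nsmul _ _ _),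
      Finsupp.sum_add_index' (by simp) (by intros; exact add_nsmul _ _ _)]
    exact L.bipart_mul hα hβ
  | single i m =>
    rw [hb, ← MvPolynomial.X_pow_eq_monomial, map_pow, SymmetricAlgebra.equivMvPolynomial_symm_X,
      map_pow, Finsupp.sum_single_index (by simp), Finsupp.sum_single_index (by simp)]
    exact L.pow_mem_bipart (L.ofOdd_oddBasis_mem i) m

theorem list_prod_mem_bipart {m : ℕ} (x : Fin m → L.Cochains) (a : Fin m → ℤ) (n : Fin m → ℕ)
    (h : ∀ i, x i ∈ L.bipart (a i) (n i)) :
    (List.ofFn x).prod ∈ L.bipart (∑ i, a i) (∑ i, n i) := by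
  induction m with
  | zero => simpa using L.one_mem_bipart
  | succ m ih =>
    rw [List.ofFn_succ, List.prod_cons, Fin.sum_univ_succ, Fin.sum_univ_succ]
    exact L.bipart_mul (h 0) (ih _ _ _ fun i => h i.succ)

theorem ofExt_basis_mem (s : Finset L.EvenIndex) :
    L.ofExt (L.evenBasis.ExteriorAlgebra s) ∈ L.bipart
      (∑ j ∈ s, ((L.evenDegree j : ℤ) - 1)) (∑ j ∈ s, (L.evenDegree j : ℕ)) := by
  obtain ⟨p, hp⟩ : ∃ p : Set.powersetCard L.EvenIndex s.card, (p : Finset L.EvenIndex) = s :=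
    ⟨⟨s, rfl⟩, rfl⟩
  have hsum : ∀ {M : Type} [AddCommMonoid M] (f : L.EvenIndex → M),
      ∑ j ∈ s, f j = ∑ i, f (Set.powersetCard.ofFinEmbEquiv.symm p i) := by
    intro M _ f
    have : s = Finset.univ.map (Set.powersetCard.ofFinEmbEquiv.symm p).toEmbedding := by
      ext j
      have := Set.powersetCard.mem_range_ofFinEmbEquiv_symm_iff_mem p j
      simp only [Finset.mem_map, Finset.mem_univ, true_and]
      rw [Set.mem_range, ← Set.powersetCard.mem_coe_iff, hp] at this
      exact this.symm
    conv_lhs => rw [this]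
    rw [Finset.sum_map]
    rfl
  have hs : L.evenBasis.ExteriorAlgebra s = ExteriorAlgebra.ιMulti ℂ s.card
      (L.evenBasis ∘ Set.powersetCard.ofFinEmbEquiv.symm p) := by
    have := ExteriorAlgebra.basis_apply_powersetCard L.evenBasis p
    rw [hp] at this
    exact this
  rw [hs, ExteriorAlgebra.ιMulti_apply, map_list_prod, List.map_ofFn, hsum, hsum]
  exact L.list_prod_mem_bipart _ _ _ fun i => L.ofEven_evenBasis_mem _

/-- The homological degree of a basis element. -/
abbrev homDegree (k : (L.OddIndex →₀ ℕ) × Finset L.EvenIndex) : ℤ :=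
  monomialDegree (fun i => (L.oddDegree i : ℤ) - 1) (fun j => (L.evenDegree j : ℤ) - 1) k

/-- The polynomial degree of a basis element. -/
abbrev polyDegree (k : (L.OddIndex →₀ ℕ) × Finset L.EvenIndex) : ℕ :=
  monomialDegree (fun i => (L.oddDegree i : ℕ)) (fun j => (L.evenDegree j : ℕ)) k

theorem cochainBasis_mem (k : (L.OddIndex →₀ ℕ) × Finset L.EvenIndex) :
    L.cochainBasis k ∈ L.bipart (L.homDegree k) (L.polyDegree k) := by
  rw [cochainBasis_apply]
  exact L.bipart_mul (L.ofSym_basis_mem k.1) (L.ofExt_basis_mem k.2)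

/-- An endomorphism that is diagonal in the monomial basis acts on each coordinate by the
corresponding eigenvalue; it suffices to check this on basis elements. -/
theorem repr_scale {c : ℕ → ℂ} {w : (L.OddIndex →₀ ℕ) × Finset L.EvenIndex → ℂ}
    (h : ∀ k, L.scale c (L.cochainBasis k) = w k • L.cochainBasis k) (x : L.Cochains)
    (k : (L.OddIndex →₀ ℕ) × Finset L.EvenIndex) :
    L.cochainBasis.repr (L.scale c x) k = w k * L.cochainBasis.repr x k := by
  have : (Finsupp.lapply k ∘ₗ L.cochainBasis.repr.toLinearMap) ∘ₗ (L.scale c).toLinearMap =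
      w k • (Finsupp.lapply k ∘ₗ L.cochainBasis.repr.toLinearMap) := by
    refine L.cochainBasis.ext fun k' => ?_
    simp only [LinearMap.comp_apply, AlgHom.toLinearMap_apply, h, map_smul, LinearMap.smul_apply,
      LinearEquiv.coe_coe, Module.Basis.repr_self, Finsupp.lapply_apply, smul_eq_mul]
    by_cases hk : k' = k
    · rw [hk]
    · simp [hk]
  exact LinearMap.congr_fun this x

/-- If a monomial occurs in `x ∈ bipart a n`, then its two eigenvalues under scaling must be `2^a`
and `2^n`, so its bidegree is `(a, n)`. -/
theorem bipart_eq_span (a : ℤ) (n : ℕ) :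
    L.bipart a n = Submodule.span ℂ (Set.range fun k : {k : (L.OddIndex →₀ ℕ) × Finset L.EvenIndex //
      L.homDegree k = a ∧ L.polyDegree k = n} => L.cochainBasis k) := by
  apply le_antisymm
  · intro x hx
    rw [← L.cochainBasis.linearCombination_repr x, Finsupp.linearCombination_apply]
    refine Submodule.sum_mem _ fun k hk => Submodule.smul_mem _ _ (Submodule.subset_span ?_)
    rw [Finsupp.mem_support_iff] at hk
    have h1 := L.repr_scale (fun k => (L.scale_of_mem_bipart (L.cochainBasis_mem k)).1) x k
    have h2 := L.repr_scale (fun k => (L.scale_of_mem_bipart (L.cochainBasis_mem k)).2) x k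
    rw [(L.scale_of_mem_bipart hx).1, map_smul, Finsupp.smul_apply, smul_eq_mul] at h1
    rw [(L.scale_of_mem_bipart hx).2, map_smul, Finsupp.smul_apply, smul_eq_mul] at h2
    refine ⟨⟨k, ?_, ?_⟩, rfl⟩
    -- The equation is moved to `ℝ`, where injectivity of `a ↦ 2^a` follows from the order.
    · have h3 : (2 : ℝ) ^ a = 2 ^ L.homDegree k := by
        apply Complex.ofReal_injective
        push_cast
        exact mul_right_cancel₀ hk h1
      exact (zpow_right_injective₀ (by norm_num) (by norm_num) h3).symm
    · exact (Nat.pow_right_injective le_rfl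
        (show 2 ^ n = 2 ^ L.polyDegree k by exact_mod_cast mul_right_cancel₀ hk h2)).symm
  · rw [Submodule.span_le]
    rintro _ ⟨⟨k, rfl, rfl⟩, rfl⟩
    exact L.cochainBasis_mem k

theorem finrank_bipart (a : ℤ) (n : ℕ) : Module.finrank ℂ (L.bipart a n) =
    Nat.card {k : (L.OddIndex →₀ ℕ) × Finset L.EvenIndex //
      L.homDegree k = a ∧ L.polyDegree k = n} := by
  rw [bipart_eq_span]
  exact Module.finrank_eq_nat_card_basis (Module.Basis.span
    (L.cochainBasis.linearIndependent.comp _ Subtype.val_injective))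

end PosGradedLie

end

noncomputable section

namespace PosGradedLie

variable (L : PosGradedLie)

/-! ### The Euler–Hilbert series of the Chevalley complex -/

theorem finite_oddDegree_le (N : ℕ) : {i : L.OddIndex | (L.oddDegree i : ℕ) ≤ N}.Finite := by
  have : Finite {i : L.OddIndex | (L.oddDegree i : ℕ) ≤ N} := by
    refine Finite.of_injective (β := Σ m : Fin (N + 1), Fin (Module.finrank ℂ (L.part m)))
      (fun i => ⟨⟨i.1.1.1, Nat.lt_succ_of_le i.2⟩, i.1.2⟩) ?_
    rintro ⟨⟨⟨i, hi⟩, r⟩, hr⟩ ⟨⟨⟨j, hj⟩, s⟩, hs⟩ h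
    simp only [Sigma.mk.injEq, Fin.mk.injEq] at h
    obtain ⟨rfl, h⟩ := h
    cases h
    rfl
  exact Set.toFinite _

theorem finite_evenDegree_le (N : ℕ) : {i : L.EvenIndex | (L.evenDegree i : ℕ) ≤ N}.Finite := by
  have : Finite {i : L.EvenIndex | (L.evenDegree i : ℕ) ≤ N} := by
    refine Finite.of_injective (β := Σ m : Fin (N + 1), Fin (Module.finrank ℂ (L.part m)))
      (fun i => ⟨⟨i.1.1.1, Nat.lt_succ_of_le i.2⟩, i.1.2⟩) ?_
    rintro ⟨⟨⟨i, hi⟩, r⟩, hr⟩ ⟨⟨⟨j, hj⟩, s⟩, hs⟩ h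
    simp only [Sigma.mk.injEq, Fin.mk.injEq] at h
    obtain ⟨rfl, h⟩ := h
    cases h
    rfl
  exact Set.toFinite _

/-- The basis elements of `oddDual` of degree at most `N`. -/
def oddUpTo (N : ℕ) : Finset L.OddIndex := (L.finite_oddDegree_le N).toFinset

/-- The basis elements of `evenDual` of degree at most `N`. -/
def evenUpTo (N : ℕ) : Finset L.EvenIndex := (L.finite_evenDegree_le N).toFinset

theorem mem_oddUpTo {N : ℕ} {i : L.OddIndex} : i ∈ L.oddUpTo N ↔ (L.oddDegree i : ℕ) ≤ N := by
  simp [oddUpTo]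

theorem mem_evenUpTo {N : ℕ} {i : L.EvenIndex} : i ∈ L.evenUpTo N ↔ (L.evenDegree i : ℕ) ≤ N := by
  simp [evenUpTo]

theorem card_oddDegree_eq {n N : ℕ} (h : n ≤ N) :
    ((L.oddUpTo N).filter fun i => n = L.oddDegree i).card =
      if Odd n then Module.finrank ℂ (L.part n) else 0 := by
  classical
  split_ifs with ho
  · refine ((Finset.card_bij (s := (Finset.univ : Finset (Fin (Module.finrank ℂ (L.part n)))))
      (fun r _ => (⟨⟨n, ho⟩, r⟩ : L.OddIndex)) ?_ ?_ ?_).symm.trans ?_)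
    · intro r _
      exact Finset.mem_filter.2 ⟨L.mem_oddUpTo.2 h, rfl⟩
    · intro r _ s _ hrs
      cases hrs
      rfl
    · intro i hi
      have hi := (Finset.mem_filter.1 hi).2
      obtain ⟨⟨m, hm⟩, r⟩ := i
      obtain rfl : n = m := hi
      exact ⟨r, Finset.mem_univ _, rfl⟩
    · rw [Finset.card_univ, Fintype.card_fin]
  · rw [Finset.card_eq_zero, Finset.filter_eq_empty_iff]
    rintro i - rfl
    exact ho (L.oddDegree_odd i)

theorem card_evenDegree_eq {n N : ℕ} (h : n ≤ N) :
    ((L.evenUpTo N).filter fun i => n = L.evenDegree i).card =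
      if Even n then Module.finrank ℂ (L.part n) else 0 := by
  classical
  split_ifs with ho
  · refine ((Finset.card_bij (s := (Finset.univ : Finset (Fin (Module.finrank ℂ (L.part n)))))
      (fun r _ => (⟨⟨n, ho⟩, r⟩ : L.EvenIndex)) ?_ ?_ ?_).symm.trans ?_)
    · intro r _
      exact Finset.mem_filter.2 ⟨L.mem_evenUpTo.2 h, rfl⟩
    · intro r _ s _ hrs
      cases hrs
      rfl
    · intro i hi
      have hi := (Finset.mem_filter.1 hi).2
      obtain ⟨⟨m, hm⟩, r⟩ := i
      obtain rfl : n = m := hi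
      exact ⟨r, Finset.mem_univ _, rfl⟩
    · rw [Finset.card_univ, Fintype.card_fin]
  · rw [Finset.card_eq_zero, Finset.filter_eq_empty_iff]
    rintro i - rfl
    exact ho (L.evenDegree_even i)

theorem finite_polyDegree_eq (n : ℕ) :
    {k : (L.OddIndex →₀ ℕ) × Finset L.EvenIndex | L.polyDegree k = n}.Finite :=
  finite_monomialDegree_eq L.oddDegree L.evenDegree n (L.oddUpTo n) (L.evenUpTo n)
    (fun _ h => L.mem_oddUpTo.2 h) (fun _ h => L.mem_evenUpTo.2 h)

theorem finiteDimensional_bipart (a : ℤ) (n : ℕ) : FiniteDimensional ℂ (L.bipart a n) := by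
  rw [bipart_eq_span]
  have h : {k | L.homDegree k = a ∧ L.polyDegree k = n}.Finite :=
    (L.finite_polyDegree_eq n).subset fun k hk => hk.2
  have : Finite {k : (L.OddIndex →₀ ℕ) × Finset L.EvenIndex //
      L.homDegree k = a ∧ L.polyDegree k = n} := h.to_subtype
  exact FiniteDimensional.span_of_finite ℂ (Set.finite_range _)

theorem homDegree_nonneg (k : (L.OddIndex →₀ ℕ) × Finset L.EvenIndex) : 0 ≤ L.homDegree k := by
  refine add_nonneg (Finset.sum_nonneg fun i _ => nsmul_nonneg ?_ _)
    (Finset.sum_nonneg fun j _ => ?_)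
  · have := (L.oddDegree i).pos
    change 0 ≤ (L.oddDegree i : ℤ) - 1
    omega
  · have := (L.evenDegree j).pos
    omega

theorem homDegree_le (k : (L.OddIndex →₀ ℕ) × Finset L.EvenIndex) :
    L.homDegree k ≤ L.polyDegree k := by
  simp only [homDegree, polyDegree, monomialDegree, Finsupp.sum]
  push_cast
  refine add_le_add (Finset.sum_le_sum fun i _ => ?_) (Finset.sum_le_sum fun j _ => ?_)
  · rw [nsmul_eq_mul, smul_eq_mul, Nat.cast_mul]
    exact mul_le_mul_of_nonneg_left (sub_le_self _ zero_le_one) (Int.natCast_nonneg _)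
  · exact sub_le_self _ zero_le_one

/-- The homological degree `i - 1` of a generator is even for commuting and odd for anticommuting
generators, so the parity of a monomial is that of the number of its anticommuting factors. -/
theorem neg_one_pow_homDegree (k : (L.OddIndex →₀ ℕ) × Finset L.EvenIndex) {a : ℕ}
    (h : L.homDegree k = a) : (-1 : ℤ) ^ a = (-1) ^ k.2.card := by
  have h1 : Even ((k.1.sum fun i m => m • ((L.oddDegree i : ℤ) - 1))) := by
    refine Finset.even_sum _ fun i _ => ?_
    refine Even.nsmul_right (a := (L.oddDegree i : ℤ) - 1) (k.1 i) ?_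
    obtain ⟨r, hr⟩ := L.oddDegree_odd i
    rw [hr]
    exact ⟨r, by push_cast; ring⟩
  have h2 : Even ((∑ j ∈ k.2, ((L.evenDegree j : ℤ) - 1)) + k.2.card) := by
    rw [Finset.card_eq_sum_ones, Nat.cast_sum, ← Finset.sum_add_distrib]
    refine Finset.even_sum _ fun j _ => ?_
    obtain ⟨r, hr⟩ := L.evenDegree_even j
    rw [hr]
    exact ⟨r, by push_cast; ring⟩
  have h3 : Even (a + k.2.card) := by
    rw [← Int.even_coe_nat, Nat.cast_add, ← h]
    have := h1.add h2
    rwa [← add_assoc] at this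
  rcases Nat.even_or_odd a with ha | ha
  · rw [ha.neg_one_pow, ((Nat.even_add.1 h3).1 ha).neg_one_pow]
  · have hb : Odd k.2.card := by
      rw [← Nat.not_even_iff_odd] at ha ⊢
      exact fun hb => ha ((Nat.even_add.1 h3).2 hb)
    rw [ha.neg_one_pow, hb.neg_one_pow]

theorem bipart_eq_bot {a : ℤ} {n : ℕ} (h : n < a) : L.bipart a n = ⊥ := by
  rw [bipart_eq_span, Submodule.span_eq_bot]
  rintro _ ⟨⟨k, rfl, rfl⟩, rfl⟩
  have := L.homDegree_le k
  omega

/-- The monomials of polynomial degree `n` are sorted by homological degree, which lies between `0`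
and `n`; on each fibre the sign is constant. -/
theorem eulerChar_chevalleyComplex (n : ℕ) : (L.chevalleyComplex n).eulerChar =
    ∑ k ∈ (L.finite_polyDegree_eq n).toFinset, (-1 : ℤ) ^ k.2.card := by
  classical
  rw [HomologicalComplex.eulerChar_eq_sum_finSet_of_finrankSupport_subset _
    (Finset.range (n + 1)) ?_]
  · rw [← Finset.sum_fiberwise_of_maps_to (g := fun k => (L.homDegree k).toNat)
      (t := Finset.range (n + 1))]
    · refine Finset.sum_congr rfl fun a _ => ?_
      have h1 : Module.finrank ℂ ((L.chevalleyComplex n).X a) =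
          ((L.finite_polyDegree_eq n).toFinset.filter
            fun k => (L.homDegree k).toNat = a).card := by
        refine (L.finrank_bipart a n).trans ?_
        rw [← Nat.card_eq_finsetCard]
        refine Nat.card_congr (Equiv.subtypeEquivRight fun k => ?_)
        have h2 := L.homDegree_nonneg k
        simp only [Finset.mem_filter, Set.Finite.mem_toFinset, Set.mem_ofPred_eq]
        omega
      rw [Finset.sum_congr rfl (g := fun _ => (-1 : ℤ) ^ a), Finset.sum_const, h1]
      · simp [mul_comm]
      · intro k hk
        have h2 := L.homDegree_nonneg k
        have h3 := (Finset.mem_filter.1 hk).2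
        exact (L.neg_one_pow_homDegree k (by omega)).symm
    · intro k hk
      have h1 := L.homDegree_le k
      have h2 : L.polyDegree k = n := by simpa using hk
      rw [Finset.mem_range]
      omega
  · intro a ha
    by_contra h
    rw [Finset.mem_coe, Finset.mem_range, not_lt] at h
    refine ha ?_
    change Module.finrank ℂ (L.bipart (a : ℤ) n) = 0
    rw [L.bipart_eq_bot (by omega)]
    simp

/-- The bound `N` is kept apart from `n` so that one finite product serves for all coefficients up
to `N` at once. -/
theorem coeff_eulerHilbertSeries {n N : ℕ} (h : n ≤ N) :
    PowerSeries.coeff n (eulerHilbertSeries L.chevalleyComplex) = PowerSeries.coeff n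
      (((∏ i ∈ L.oddUpTo N, (oneSubUnit (L.oddDegree i))⁻¹) *
        ∏ j ∈ L.evenUpTo N, oneSubUnit (L.evenDegree j) : (PowerSeries ℤ)ˣ) : PowerSeries ℤ) := by
  rw [eulerHilbertSeries, PowerSeries.coeff_mk, eulerChar_chevalleyComplex]
  exact sum_monomials_eq_coeff L.oddDegree L.evenDegree n _ _
    (fun i hi => L.mem_oddUpTo.2 (hi.trans h)) (fun i hi => L.mem_evenUpTo.2 (hi.trans h)) _
    fun k => by simp

theorem constantCoeff_eulerHilbertSeries :
    PowerSeries.constantCoeff (eulerHilbertSeries L.chevalleyComplex) = 1 := by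
  have h := L.coeff_eulerHilbertSeries le_rfl (n := 0)
  have h1 : L.oddUpTo 0 = ∅ := by
    ext i; have := (L.oddDegree i).pos; rw [mem_oddUpTo]; simp
  have h2 : L.evenUpTo 0 = ∅ := by
    ext i; have := (L.evenDegree i).pos; rw [mem_evenUpTo]; simp
  rw [h1, h2] at h
  simpa using h

/-- The Euler–Hilbert series of `C(L)` is `∏ (1 - t^n)^{(-1)^n dim L_n}`, in terms of exponents. -/
theorem prodExponent_eulerHilbertSeries {n : ℕ} (hn : n ≠ 0) :
    prodExponent (PowerSeries.map (Int.castRingHom ℚ) (eulerHilbertSeries L.chevalleyComplex)) n =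
      ((-1) ^ n * (Module.finrank ℂ (L.part n) : ℤ) : ℤ) := by
  set u : (PowerSeries ℤ)ˣ := (∏ i ∈ L.oddUpTo n, (oneSubUnit (L.oddDegree i))⁻¹) *
    ∏ j ∈ L.evenUpTo n, oneSubUnit (L.evenDegree j) with hu
  have hcoeff : ∀ m ≤ n, PowerSeries.coeff m (PowerSeries.map (Int.castRingHom ℚ)
      (eulerHilbertSeries L.chevalleyComplex)) =
      PowerSeries.coeff m (PowerSeries.map (Int.castRingHom ℚ) u.1) := by
    intro m hm
    rw [PowerSeries.coeff_map, PowerSeries.coeff_map, L.coeff_eulerHilbertSeries hm]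
  have hconst : PowerSeries.constantCoeff (PowerSeries.map (Int.castRingHom ℚ)
      (eulerHilbertSeries L.chevalleyComplex)) = 1 := by
    rw [← PowerSeries.coeff_zero_eq_constantCoeff_apply, PowerSeries.coeff_map,
      PowerSeries.coeff_zero_eq_constantCoeff_apply, constantCoeff_eulerHilbertSeries, map_one]
  rw [prodExponent_congr hconst (by
      rw [← hconst, ← PowerSeries.coeff_zero_eq_constantCoeff_apply,
        ← PowerSeries.coeff_zero_eq_constantCoeff_apply, hcoeff 0 (Nat.zero_le _)]) hcoeff hn le_rfl,
    ← unitExponent_apply, hu, map_mul, map_prod, map_prod, toAdd_mul, toAdd_prod, toAdd_prod]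
  have h1 : ∀ m : ℕ+, (unitExponent n (oneSubUnit m)⁻¹).toAdd = -(if n = m then (1 : ℚ) else 0) := by
    intro m
    have := unitExponent_oneSubUnit_zpow m (-1) hn
    rw [zpow_neg_one] at this
    rw [this]
    split_ifs <;> simp
  have h2 : ∀ m : ℕ+, (unitExponent n (oneSubUnit m)).toAdd = if n = m then (1 : ℚ) else 0 := by
    intro m
    have := unitExponent_oneSubUnit_zpow m 1 hn
    rw [zpow_one] at this
    rw [this]
    split_ifs <;> simp
  simp only [h1, h2]
  -- Each factor of the finite product contributes only in its own degree, so the exponent counts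
  -- basis elements of degree `n`, with sign `-1` for odd `n` and `+1` for even `n`.
  rw [Finset.sum_neg_distrib, Finset.sum_boole, Finset.sum_boole, L.card_oddDegree_eq le_rfl,
    L.card_evenDegree_eq le_rfl]
  rcases Nat.even_or_odd n with h | h
  · simp [h, Nat.not_odd_iff_even.2 h]
  · simp [h, Nat.not_even_iff_odd.2 h]

end PosGradedLie

end

noncomputable section

/-! ### The Hilbert series of the Veronese ring -/

section Veronese

variable (b : ℕ)

/-- The generator `x_i` of the Veronese ring, with `i` cut off at `b + 1`. -/
def veroneseX (i : ℕ) : MvPolynomial (Fin (b + 2)) ℂ ⧸ veroneseIdeal b :=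
  Ideal.Quotient.mkₐ ℂ (veroneseIdeal b) (MvPolynomial.X ⟨min i (b + 1), by omega⟩)

variable {b} in
theorem veroneseX_mul {i j k l : ℕ} (hi : i ≤ b + 1) (hj : j ≤ b + 1) (hk : k ≤ b + 1)
    (hl : l ≤ b + 1) (h : i + j = k + l) :
    veroneseX b i * veroneseX b j = veroneseX b k * veroneseX b l := by
  rw [veroneseX, veroneseX, veroneseX, veroneseX, ← map_mul, ← map_mul]
  refine Ideal.Quotient.eq.2 (Ideal.subset_span ⟨_, _, _, _, ?_, rfl⟩)
  simp only [min_eq_left, hi, hj, hk, hl, h]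

/-- The standard monomial of degree `n` and weight `m`. -/
def veroneseMonomial : ℕ → ℕ → MvPolynomial (Fin (b + 2)) ℂ ⧸ veroneseIdeal b
  | 0, _ => 1
  | n + 1, m => veroneseX b (min m (b + 1)) * veroneseMonomial n (m - min m (b + 1))

/-- The standard monomial is greedy: it takes the largest possible index first. Multiplying by
`x_i`, the product with the first factor is rewritten, with the same sum of indices, so that its
first index is `min (m + i) (b + 1)`; the other factor is passed on to the rest. -/
theorem veroneseX_mul_monomial {i n m : ℕ} (hi : i ≤ b + 1) (hm : m ≤ n * (b + 1)) :
    veroneseX b i * veroneseMonomial b n m = veroneseMonomial b (n + 1) (m + i) := by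
  induction n generalizing i m with
  | zero =>
    obtain rfl : m = 0 := by simpa using hm
    rw [veroneseMonomial, veroneseMonomial, veroneseMonomial, zero_add, min_eq_left hi]
  | succ n ih =>
    rw [add_mul, one_mul] at hm
    rw [veroneseMonomial, ← mul_assoc,
      veroneseX_mul (k := min (m + i) (b + 1)) (l := min m (b + 1) + i - min (m + i) (b + 1))
        hi (by omega) (by omega) (by omega) (by omega), mul_assoc, ih (by omega) (by omega),
      veroneseMonomial.eq_def b (n + 1 + 1)]
    simp only
    congr 2
    omega

theorem veroneseX_mem (i : ℕ) : veroneseX b i ∈ veronesePart b 1 :=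
  ⟨_, MvPolynomial.isHomogeneous_X _ _, rfl⟩

theorem veroneseMonomial_mem (n m : ℕ) : veroneseMonomial b n m ∈ veronesePart b n := by
  induction n generalizing m with
  | zero => exact ⟨1, MvPolynomial.isHomogeneous_one _ _,
      map_one (Ideal.Quotient.mkₐ ℂ (veroneseIdeal b))⟩
  | succ n ih =>
    obtain ⟨p, hp, hp'⟩ := ih (m - min m (b + 1))
    obtain ⟨q, hq, hq'⟩ := veroneseX_mem b (min m (b + 1))
    refine ⟨q * p, ?_, ?_⟩
    · rw [add_comm n]
      exact MvPolynomial.IsHomogeneous.mul hq hp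
    · rw [veroneseMonomial, ← hp', ← hq']
      exact map_mul (Ideal.Quotient.mkₐ ℂ (veroneseIdeal b)) q p

theorem exists_veroneseMonomial (s : Fin (b + 2) →₀ ℕ) (c : ℂ) :
    ∃ n m, (MvPolynomial.monomial s c).IsHomogeneous n ∧ m ≤ n * (b + 1) ∧ ∃ r : ℂ,
      Ideal.Quotient.mkₐ ℂ (veroneseIdeal b) (MvPolynomial.monomial s c) =
        r • veroneseMonomial b n m := by
  refine MvPolynomial.induction_on_monomial (motive := fun p => ∃ n m, p.IsHomogeneous n ∧
    m ≤ n * (b + 1) ∧ ∃ r : ℂ, Ideal.Quotient.mkₐ ℂ (veroneseIdeal b) p =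
        r • veroneseMonomial b n m) ?_ ?_ s c
  · intro r
    refine ⟨0, 0, MvPolynomial.isHomogeneous_C _ _, by simp, r, ?_⟩
    rw [veroneseMonomial, ← Algebra.algebraMap_eq_smul_one]
    exact AlgHom.commutes (Ideal.Quotient.mkₐ ℂ (veroneseIdeal b)) r
  · rintro p i ⟨n, m, hp, hm, r, h⟩
    have hi : (i : ℕ) ≤ b + 1 := by omega
    refine ⟨n + 1, m + i, hp.mul (MvPolynomial.isHomogeneous_X _ _), ?_, r, ?_⟩
    · rw [add_mul, one_mul]
      omega
    · have hx : Ideal.Quotient.mkₐ ℂ (veroneseIdeal b) (MvPolynomial.X i) = veroneseX b i := by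
        rw [veroneseX]
        simp only [min_eq_left hi]
      rw [map_mul, h, hx, ← veroneseX_mul_monomial b hi hm, smul_mul_assoc, mul_comm]

/-- The substitution `x_i ↦ t^i`. -/
def veroneseEval : (MvPolynomial (Fin (b + 2)) ℂ ⧸ veroneseIdeal b) →ₐ[ℂ] Polynomial ℂ :=
  Ideal.Quotient.liftₐ (veroneseIdeal b)
    (MvPolynomial.aeval fun i : Fin (b + 2) => (Polynomial.X : Polynomial ℂ) ^ (i : ℕ)) (by
      have : veroneseIdeal b ≤ RingHom.ker (MvPolynomial.aeval (R := ℂ)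
          fun i : Fin (b + 2) => (Polynomial.X : Polynomial ℂ) ^ (i : ℕ)) := by
        refine Ideal.span_le.2 ?_
        rintro _ ⟨i, j, k, l, h, rfl⟩
        simp [RingHom.mem_ker, ← pow_add, h]
      exact fun a ha => this ha)

theorem veroneseEval_X {i : ℕ} (hi : i ≤ b + 1) :
    veroneseEval b (veroneseX b i) = Polynomial.X ^ i := by
  refine (Ideal.Quotient.liftₐ_apply _ _ _ _).trans ?_
  refine (MvPolynomial.aeval_X _ _).trans ?_
  simp only [min_eq_left hi]

theorem veroneseEval_monomial {n m : ℕ} (hm : m ≤ n * (b + 1)) :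
    veroneseEval b (veroneseMonomial b n m) = Polynomial.X ^ m := by
  induction n generalizing m with
  | zero =>
    obtain rfl : m = 0 := by simpa using hm
    rw [veroneseMonomial, map_one, pow_zero]
  | succ n ih =>
    rw [add_mul, one_mul] at hm
    rw [veroneseMonomial, map_mul, veroneseEval_X b (by omega), ih (by omega), ← pow_add]
    congr 1
    omega

/-- The substitution `x_i ↦ t^i` sends these monomials to distinct powers of `t`. -/
theorem linearIndependent_veroneseMonomial (n : ℕ) : LinearIndependent ℂ
    fun m : Fin (n * (b + 1) + 1) => veroneseMonomial b n m := by
  refine LinearIndependent.of_comp (veroneseEval b).toLinearMap ?_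
  have h : (veroneseEval b).toLinearMap ∘ (fun m : Fin (n * (b + 1) + 1) =>
      veroneseMonomial b n m) = Polynomial.basisMonomials ℂ ∘ Fin.val := by
    funext m
    simp only [Function.comp_apply, AlgHom.toLinearMap_apply, Polynomial.coe_basisMonomials]
    rw [veroneseEval_monomial b (Nat.lt_succ_iff.1 m.2), Polynomial.X_pow_eq_monomial]
  rw [h]
  exact (Polynomial.basisMonomials ℂ).linearIndependent.comp _ Fin.val_injective

theorem veronesePart_eq_span (n : ℕ) : veronesePart b n =
    Submodule.span ℂ (Set.range fun m : Fin (n * (b + 1) + 1) => veroneseMonomial b n m) := by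
  apply le_antisymm
  · rintro _ ⟨p, hp, rfl⟩
    rw [p.as_sum, map_sum]
    refine Submodule.sum_mem _ fun s hs => ?_
    obtain ⟨k, m, hk, hm, r, h⟩ := exists_veroneseMonomial b s (p.coeff s)
    -- The monomial has a nonzero coefficient, so its degree can be read off both from its own
    -- homogeneity and from that of `p`.
    obtain rfl : k = n := by
      have hs' := MvPolynomial.mem_support_iff.1 hs
      have h1 := hp hs'
      have h2 := hk (d := s) (by simpa using hs')
      rw [← h1, ← h2]
    rw [AlgHom.toLinearMap_apply, h]
    exact Submodule.smul_mem _ _ (Submodule.subset_span ⟨⟨m, by omega⟩, rfl⟩)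
  · rw [Submodule.span_le]
    rintro _ ⟨m, rfl⟩
    exact veroneseMonomial_mem b n m

theorem finrank_veronesePart (n : ℕ) :
    Module.finrank ℂ (veronesePart b n) = n * (b + 1) + 1 := by
  rw [veronesePart_eq_span, finrank_span_eq_card (linearIndependent_veroneseMonomial b n),
    Fintype.card_fin]

theorem veroneseHilbertSeries_eq : veroneseHilbertSeries b =
    (1 + (b : PowerSeries ℤ) * PowerSeries.X) * oneSubPow 1 (-2) := by
  have h1 : oneSubPow 1 2 * oneSubPow 1 (-2) = 1 := by
    rw [← oneSubPow_add, oneSubPow, add_neg_cancel, zpow_zero, Units.val_one]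
  have h2 : oneSubPow 1 2 = (1 - PowerSeries.X) ^ 2 := by
    rw [show (2 : ℤ) = 1 + 1 by norm_num, oneSubPow_add, oneSubPow_one, PNat.one_coe, pow_one, sq]
  have h3 : veroneseHilbertSeries b * oneSubPow 1 2 = 1 + (b : PowerSeries ℤ) * PowerSeries.X := by
    -- Multiplication by `(1 - t)^2` takes second differences, which kill the linear function `n (b
    -- + 1) + 1` from degree two on.
    rw [h2, show veroneseHilbertSeries b * (1 - PowerSeries.X) ^ 2 =
      veroneseHilbertSeries b - 2 * (PowerSeries.X * veroneseHilbertSeries b) +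
        PowerSeries.X * (PowerSeries.X * veroneseHilbertSeries b) by ring]
    have hb : (b : PowerSeries ℤ) = PowerSeries.C (b : ℤ) := by simp
    have htwo : (2 : PowerSeries ℤ) = PowerSeries.C (2 : ℤ) := by simp
    ext n
    rw [hb, htwo]
    simp only [map_add, map_sub, PowerSeries.coeff_C_mul]
    rcases n with _ | _ | n
    · simp [veroneseHilbertSeries, finrank_veronesePart]
    · simp [veroneseHilbertSeries, finrank_veronesePart, PowerSeries.coeff_succ_X_mul,
        PowerSeries.coeff_one]
      ring
    · simp [veroneseHilbertSeries, finrank_veronesePart, PowerSeries.coeff_succ_X_mul,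
        PowerSeries.coeff_one, PowerSeries.coeff_X]
      ring
  rw [← h3, mul_assoc, h1, mul_one]

end Veronese

end

noncomputable section

/-! ### Elimination in graded Lie algebras -/

/-- A bilinear operation on a graded family of subspaces that satisfies the identities of a graded
Lie algebra in the signed sense; it may depend on the degrees of its arguments. -/
structure GradedBracket (E : Type) [AddCommGroup E] [Module ℂ E] where
  part : ℕ → Submodule ℂ E
  br : ℕ → ℕ → E →ₗ[ℂ] E →ₗ[ℂ] E
  br_mem : ∀ {i j : ℕ} {x y : E}, x ∈ part i → y ∈ part j → br i j x y ∈ part (i + j)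
  skew : ∀ {i j : ℕ} {x y : E}, x ∈ part i → y ∈ part j →
    br i j x y = -((-1 : ℂ) ^ (i * j) • br j i y x)
  jacobi : ∀ {i j k : ℕ} {x y z : E}, x ∈ part i → y ∈ part j → z ∈ part k →
    br i (j + k) x (br j k y z) = br (i + j) k (br i j x y) z +
      (-1 : ℂ) ^ (i * j) • br j (i + k) y (br i k x z)

namespace GradedBracket

variable {E : Type} [AddCommGroup E] [Module ℂ E] (G : GradedBracket E)

/-- A graded family of subspaces that is closed under the bracket. -/
def Closed (K : ℕ → Submodule ℂ E) : Prop :=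
  ∀ i j, ∀ x ∈ K i, ∀ y ∈ K j, G.br i j x y ∈ K (i + j)

/-- The components of the graded Lie subalgebra generated by a graded family of subspaces. -/
def lieSpan (V : ℕ → Submodule ℂ E) (n : ℕ) : Submodule ℂ E :=
  sInf ((fun K : ℕ → Submodule ℂ E => K n) '' {K | V ≤ K ∧ G.Closed K})

theorem lieSpan_le {V K : ℕ → Submodule ℂ E} (h : V ≤ K) (hK : G.Closed K) : G.lieSpan V ≤ K :=
  fun _ => sInf_le ⟨K, ⟨h, hK⟩, rfl⟩

theorem mem_lieSpan {V : ℕ → Submodule ℂ E} {n : ℕ} {x : E} :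
    x ∈ G.lieSpan V n ↔ ∀ K, V ≤ K → G.Closed K → x ∈ K n := by
  rw [lieSpan, Submodule.mem_sInf]
  exact ⟨fun h K hV hK => h _ ⟨K, ⟨hV, hK⟩, rfl⟩, fun h _ ⟨K, hK, hKn⟩ => hKn ▸ h K hK.1 hK.2⟩

theorem le_lieSpan (V : ℕ → Submodule ℂ E) : V ≤ G.lieSpan V :=
  fun n _ hx => G.mem_lieSpan.2 fun _ hV _ => hV n hx

theorem lieSpan_closed (V : ℕ → Submodule ℂ E) : G.Closed (G.lieSpan V) :=
  fun i j x hx y hy => G.mem_lieSpan.2 fun K hV hK =>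
    hK i j x (G.mem_lieSpan.1 hx K hV hK) y (G.mem_lieSpan.1 hy K hV hK)

theorem lieSpan_le_part {V : ℕ → Submodule ℂ E} (h : V ≤ G.part) : G.lieSpan V ≤ G.part :=
  G.lieSpan_le h fun _ _ _ hx _ hy => G.br_mem hx hy

theorem lieSpan_eq_bot {V : ℕ → Submodule ℂ E} {N : ℕ} (h : ∀ k ≤ N, V k = ⊥) {n : ℕ}
    (hn : n ≤ N) : G.lieSpan V n = ⊥ := by
  have := G.lieSpan_le (V := V) (K := fun k => if k ≤ N then ⊥ else ⊤) (fun k => by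
    dsimp only
    split_ifs with hk
    · exact (h k hk).le
    · exact le_top) (fun i j x hx y _ => by
    dsimp only at hx ⊢
    split_ifs with hij
    · rw [if_pos (by omega), Submodule.mem_bot] at hx
      simp [hx]
    · trivial) n
  dsimp only at this
  rwa [if_pos hn, le_bot_iff] at this

/-- The family `W_k + [y, W_{k - d}] + [y, [y, W_{k - 2d}]] + ⋯`. -/
def adSpan (d : ℕ) (y : E) (W : ℕ → Submodule ℂ E) (k : ℕ) : Submodule ℂ E :=
  W k ⊔ if _h : 0 < d ∧ d ≤ k then (adSpan d y W (k - d)).map (G.br d (k - d) y) else ⊥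
  termination_by k
  decreasing_by omega

variable {d : ℕ} {y : E} {W : ℕ → Submodule ℂ E}

theorem le_adSpan : W ≤ G.adSpan d y W := by
  intro k
  rw [adSpan]
  exact le_sup_left

theorem br_mem_adSpan (hd : 0 < d) {k : ℕ} {x : E} (hx : x ∈ G.adSpan d y W k) :
    G.br d k y x ∈ G.adSpan d y W (d + k) := by
  rw [adSpan, dif_pos ⟨hd, by omega⟩, Nat.add_sub_cancel_left]
  exact Submodule.mem_sup_right ⟨x, hx, rfl⟩

theorem adSpan_le {K : ℕ → Submodule ℂ E} (hW : W ≤ K) (hd : 0 < d)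
    (hK : ∀ k, ∀ x ∈ K k, G.br d k y x ∈ K (d + k)) : G.adSpan d y W ≤ K := by
  intro k
  induction k using Nat.strong_induction_on with
  | _ k ih =>
    rw [adSpan]
    refine sup_le (hW k) ?_
    split_ifs with h
    · rintro _ ⟨x, hx, rfl⟩
      have := hK _ x (ih (k - d) (by omega) hx)
      rwa [Nat.add_sub_cancel' h.2] at this
    · exact bot_le

theorem finiteDimensional_adSpan (hW : ∀ k, FiniteDimensional ℂ (W k)) (k : ℕ) :
    FiniteDimensional ℂ (G.adSpan d y W k) := by
  induction k using Nat.strong_induction_on with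
  | _ k ih =>
    rw [adSpan]
    have := hW k
    by_cases h : 0 < d ∧ d ≤ k
    · rw [dif_pos h]
      have := ih (k - d) (by omega)
      infer_instance
    · rw [dif_neg h]
      infer_instance

/-- The components of the Lie algebra generated by the element `y` of degree `d`. -/
def singleSpan (d : ℕ) (y : E) (n : ℕ) : Submodule ℂ E :=
  Submodule.span ℂ {x | (n = d ∧ x = y) ∨ (n = d + d ∧ x = G.br d d y y)}

theorem self_mem_singleSpan : y ∈ G.singleSpan d y d := Submodule.subset_span (Or.inl ⟨rfl, rfl⟩)

theorem br_self_mem_singleSpan : G.br d d y y ∈ G.singleSpan d y (d + d) :=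
  Submodule.subset_span (Or.inr ⟨rfl, rfl⟩)

theorem singleSpan_le {n : ℕ} {M : Submodule ℂ E} (h1 : n = d → y ∈ M)
    (h2 : n = d + d → G.br d d y y ∈ M) : G.singleSpan d y n ≤ M := by
  rw [singleSpan, Submodule.span_le]
  rintro x (⟨h, rfl⟩ | ⟨h, rfl⟩)
  · exact h1 h
  · exact h2 h

theorem br_self_eq_zero (hy : y ∈ G.part d) (hd : Even d) : G.br d d y y = 0 := by
  have h := G.skew hy hy
  rw [(hd.mul_left d).neg_one_pow, one_smul] at h
  have h2 : (2 : ℂ) • G.br d d y y = 0 := by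
    rw [two_smul]
    nth_rewrite 1 [h]
    exact neg_add_cancel _
  exact (smul_eq_zero.1 h2).resolve_left two_ne_zero

/-- For even `d` already `[y, y] = 0`; for odd `d` the Jacobi identity together with skew symmetry
gives `3 [y, [y, y]] = 0`. Hence `y` and `[y, y]` span the Lie algebra generated by `y`. -/
theorem br_br_self (hy : y ∈ G.part d) : G.br d (d + d) y (G.br d d y y) = 0 := by
  have h1 := G.jacobi hy hy hy
  have h2 := G.skew (G.br_mem hy hy) hy
  have he : Even ((d + d) * d) := ⟨d * d, by ring⟩
  rw [he.neg_one_pow, one_smul] at h2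
  rw [h2] at h1
  rcases Nat.even_or_odd d with h | h
  · rw [G.br_self_eq_zero hy h, map_zero]
  · rw [(h.mul h).neg_one_pow] at h1
    have h3 : (3 : ℂ) • G.br d (d + d) y (G.br d d y y) = 0 := by
      have : (3 : ℂ) • G.br d (d + d) y (G.br d d y y) = G.br d (d + d) y (G.br d d y y) -
        (-G.br d (d + d) y (G.br d d y y) + (-1 : ℂ) • G.br d (d + d) y (G.br d d y y)) := by
        module
      rw [this, ← h1, sub_self]
    exact (smul_eq_zero.1 h3).resolve_left (by norm_num)

/-- Since `ad y` is a signed derivation, the elements of the generated subalgebra that it maps back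
into this subalgebra are closed under the bracket, so it suffices to test generators. -/
theorem br_mem_lieSpan (hy : y ∈ G.part d) {V : ℕ → Submodule ℂ E} (hV : V ≤ G.part)
    (h : ∀ k, ∀ x ∈ V k, G.br d k y x ∈ G.lieSpan V (d + k)) {j : ℕ} {x : E}
    (hx : x ∈ G.lieSpan V j) : G.br d j y x ∈ G.lieSpan V (d + j) := by
  have hS := G.lieSpan_le_part hV
  refine (G.lieSpan_le (K := fun j => G.lieSpan V j ⊓
    (G.lieSpan V (d + j)).comap (G.br d j y)) ?_ ?_ j hx).2
  · exact fun k x hx => ⟨G.le_lieSpan _ _ hx, h k x hx⟩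
  · rintro i j x ⟨hx, hx'⟩ z ⟨hz, hz'⟩
    refine ⟨G.lieSpan_closed _ i j x hx z hz, ?_⟩
    change G.br d (i + j) y (G.br i j x z) ∈ G.lieSpan V (d + (i + j))
    rw [G.jacobi hy (hS i hx) (hS j hz)]
    refine Submodule.add_mem _ ?_ (Submodule.smul_mem _ _ ?_)
    · rw [← add_assoc]
      exact G.lieSpan_closed _ _ _ _ hx' _ hz
    · rw [add_left_comm]
      exact G.lieSpan_closed _ _ _ _ hx _ hz'

theorem br_lieSpan_adSpan (hd : 0 < d) (hy : y ∈ G.part d) (hW : W ≤ G.part) {j : ℕ} {x : E}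
    (hx : x ∈ G.lieSpan (G.adSpan d y W) j) :
    G.br d j y x ∈ G.lieSpan (G.adSpan d y W) (d + j) :=
  G.br_mem_lieSpan hy (G.adSpan_le hW hd fun _ _ hx => G.br_mem hy hx)
    (fun _ _ hx => G.le_lieSpan _ _ (G.br_mem_adSpan hd hx)) hx

theorem closed_singleSpan_sup {S : ℕ → Submodule ℂ E} (hS : G.Closed S)
    (hyS : ∀ {j x}, x ∈ S j → G.br d j y x ∈ S (d + j))
    (hSy : ∀ {j x}, x ∈ S j → G.br j d x y ∈ S (j + d))
    (hyyS : ∀ {j x}, x ∈ S j → G.br (d + d) j (G.br d d y y) x ∈ S (d + d + j))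
    (hSyy : ∀ {j x}, x ∈ S j → G.br j (d + d) x (G.br d d y y) ∈ S (j + (d + d)))
    (h1 : G.br d (d + d) y (G.br d d y y) = 0) (h2 : G.br (d + d) d (G.br d d y y) y = 0)
    (h3 : G.br (d + d) (d + d) (G.br d d y y) (G.br d d y y) = 0) :
    G.Closed fun n => G.singleSpan d y n ⊔ S n := by
  intro i j x hx z hz
  obtain ⟨a, ha, a', ha', rfl⟩ := Submodule.mem_sup.1 hx
  obtain ⟨c, hc, c', hc', rfl⟩ := Submodule.mem_sup.1 hz
  clear hx hz
  simp only [map_add, LinearMap.add_apply]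
  refine Submodule.add_mem _ (Submodule.add_mem _ ?_ ?_) (Submodule.add_mem _ ?_ ?_)
  · refine Submodule.mem_sup_left (G.singleSpan_le (M := (G.singleSpan d y (i + j)).comap
      ((G.br i j).flip c)) ?_ ?_ ha)
    · intro h
      obtain rfl : d = i := h.symm
      refine G.singleSpan_le (M := (G.singleSpan d y (d + j)).comap (G.br d j y)) ?_ ?_ hc
      · intro h
        obtain rfl : d = j := h.symm
        exact G.br_self_mem_singleSpan
      · intro h
        subst h
        rw [Submodule.mem_comap, h1]
        exact Submodule.zero_mem _
    · intro h
      subst h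
      refine G.singleSpan_le (M := (G.singleSpan d y (d + d + j)).comap
        (G.br (d + d) j (G.br d d y y))) ?_ ?_ hc
      · intro h
        obtain rfl : d = j := h.symm
        rw [Submodule.mem_comap, h2]
        exact Submodule.zero_mem _
      · intro h
        subst h
        rw [Submodule.mem_comap, h3]
        exact Submodule.zero_mem _
  · refine Submodule.mem_sup_right (G.singleSpan_le (M := (S (i + j)).comap
      (G.br i j a')) ?_ ?_ hc)
    · intro h
      obtain rfl : d = j := h.symm
      exact hSy ha'
    · intro h
      subst h
      exact hSyy ha'
  · refine Submodule.mem_sup_right (G.singleSpan_le (M := (S (i + j)).comap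
      ((G.br i j).flip c')) ?_ ?_ ha)
    · intro h
      obtain rfl : d = i := h.symm
      exact hyS hc'
    · intro h
      subst h
      exact hyyS hc'
  · exact Submodule.mem_sup_right (hS _ _ _ ha' _ hc')

/-- Elimination of a generator: a graded Lie algebra generated by `y` and `W` is the sum of the Lie
algebra generated by `y` and the one generated by all `[y, [y, …, [y, w]]]`. -/
theorem lieSpan_le_sup (hd : 0 < d) (hy : y ∈ G.part d) (hW : W ≤ G.part)
    {V : ℕ → Submodule ℂ E} (hV : ∀ n, V n ≤ (if n = d then Submodule.span ℂ {y} else ⊥) ⊔ W n)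
    (n : ℕ) : G.lieSpan V n ≤ G.singleSpan d y n ⊔ G.lieSpan (G.adSpan d y W) n := by
  have hV' : G.adSpan d y W ≤ G.part := G.adSpan_le hW hd fun k x hx => G.br_mem hy hx
  have hS := G.lieSpan_le_part hV'
  set S := G.lieSpan (G.adSpan d y W) with hSdef
  have hyS : ∀ {j x}, x ∈ S j → G.br d j y x ∈ S (d + j) := fun hx =>
    G.br_lieSpan_adSpan hd hy hW hx
  have hSy : ∀ {j x}, x ∈ S j → G.br j d x y ∈ S (j + d) := fun {j x} hx => by
    rw [G.skew (hS j hx) hy, add_comm]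
    exact Submodule.neg_mem _ (Submodule.smul_mem _ _ (hyS hx))
  have hyyS : ∀ {j x}, x ∈ S j → G.br (d + d) j (G.br d d y y) x ∈ S (d + d + j) :=
      fun {j x} hx => by
    -- By the Jacobi identity, `ad [y, y]` is a combination of two copies of `(ad y)^2`, which
    -- preserves `S`.
    have h := G.jacobi hy hy (hS j hx)
    rw [← sub_eq_iff_eq_add] at h
    rw [← h, add_assoc]
    exact Submodule.sub_mem _ (hyS (hyS hx)) (Submodule.smul_mem _ _ (hyS (hyS hx)))
  have hSyy : ∀ {j x}, x ∈ S j → G.br j (d + d) x (G.br d d y y) ∈ S (j + (d + d)) :=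
      fun {j x} hx => by
    rw [G.skew (hS j hx) (G.br_mem hy hy), add_comm]
    exact Submodule.neg_mem _ (Submodule.smul_mem _ _ (hyyS hx))
  have hz1 : G.br (d + d) d (G.br d d y y) y = 0 := by
    rw [G.skew (G.br_mem hy hy) hy, G.br_br_self hy, smul_zero, neg_zero]
  have hz2 : G.br (d + d) (d + d) (G.br d d y y) (G.br d d y y) = 0 :=
    G.br_self_eq_zero (G.br_mem hy hy) (Even.add_self d)
  refine G.lieSpan_le (K := fun n => G.singleSpan d y n ⊔ S n) ?_ ?_ n
  · intro n
    refine (hV n).trans (sup_le_sup ?_ ((G.le_adSpan n).trans (G.le_lieSpan _ n)))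
    split_ifs with h
    · subst h
      rw [Submodule.span_singleton_le_iff_mem]
      exact G.self_mem_singleSpan
    · exact bot_le
  · exact G.closed_singleSpan_sup (G.lieSpan_closed _) hyS hSy hyyS hSyy (G.br_br_self hy) hz1 hz2

end GradedBracket

end

noncomputable section

/-! ### The number of generators after elimination -/

/-- The series `1 - ∑ c_k (ε t)^k`. -/
def genSeries {R : Type} [CommRing R] (ε : R) (c : ℕ → ℕ) : PowerSeries R :=
  PowerSeries.mk fun k => if k = 0 then 1 else -(ε ^ k * c k)

/-- The numbers `c_k - δ_{k,d} + c_{k-d} + c_{k-2d} + ⋯` of generators after the elimination of a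
generator of degree `d`. -/
def elimCount (d : ℕ) (c : ℕ → ℕ) (k : ℕ) : ℕ :=
  (if k = d then c k - 1 else c k) +
    if _h : 0 < d ∧ d ≤ k then elimCount d c (k - d) else 0
  termination_by k
  decreasing_by omega

theorem elimCount_of_lt {d : ℕ} {c : ℕ → ℕ} {k : ℕ} (hk : k < d) : elimCount d c k = c k := by
  rw [elimCount, if_neg hk.ne, dif_neg (by omega), add_zero]

theorem elimCount_self {d : ℕ} {c : ℕ → ℕ} (hd : 0 < d) (hc : c 0 = 0) :
    elimCount d c d = c d - 1 := by
  rw [elimCount, if_pos rfl, dif_pos ⟨hd, le_rfl⟩, Nat.sub_self, elimCount_of_lt hd, hc, add_zero]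

/-- The recursion says `c'_k - c'_{k-d} = c_k - δ_{k,d}`, which is this factorization coefficient by
coefficient. The case `ε = 1` counts words and `ε = -1` counts Lie elements with their signs. The
condition `1 ≤ c d` makes the truncated subtraction exact. -/
theorem genSeries_elimCount {R : Type} [CommRing R] (ε : R) {d : ℕ} {c : ℕ → ℕ} (hd : 0 < d)
    (h0 : c 0 = 0) (hc : 1 ≤ c d) : genSeries ε c =
      genSeries ε (elimCount d c) * (1 - PowerSeries.C (ε ^ d) * PowerSeries.X ^ d) := by
  ext k
  rw [mul_sub, mul_one, mul_left_comm, map_sub, PowerSeries.coeff_C_mul,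
    PowerSeries.coeff_mul_X_pow', genSeries, genSeries, PowerSeries.coeff_mk, PowerSeries.coeff_mk,
    PowerSeries.coeff_mk]
  rcases lt_trichotomy k d with hk | rfl | hk
  · rw [if_neg (not_le.2 hk), elimCount_of_lt hk, mul_zero, sub_zero]
  · rw [if_neg hd.ne', if_neg hd.ne', elimCount_self hd h0, if_pos le_rfl, Nat.sub_self,
      if_pos rfl, Nat.cast_sub hc]
    push_cast
    ring
  · rw [if_neg (by omega), if_neg (by omega), if_pos hk.le, if_neg (by omega), elimCount,
      if_neg hk.ne', dif_pos ⟨hd, hk.le⟩]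
    obtain ⟨j, rfl⟩ := Nat.exists_eq_add_of_lt hk
    rw [show d + j + 1 - d = j + 1 by omega]
    push_cast
    ring

theorem constantCoeff_genSeries {R : Type} [CommRing R] (ε : R) (c : ℕ → ℕ) :
    PowerSeries.constantCoeff (genSeries ε c) = 1 := by
  rw [← PowerSeries.coeff_zero_eq_constantCoeff_apply, genSeries, PowerSeries.coeff_mk, if_pos rfl]

/-- The dimension of the component of degree `n` of a free graded Lie algebra with `c k` generators
of degree `k`. -/
def lieCount (c : ℕ → ℕ) (n : ℕ) : ℚ := (-1) ^ n * prodExponent (genSeries (-1 : ℚ) c) n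

/-- The dimension of the component of degree `n` of a free graded Lie algebra with one generator,
of degree `d`. -/
def singleCount (d n : ℕ) : ℕ :=
  (if n = d then 1 else 0) + if n = d + d ∧ Odd d then 1 else 0

/-- For even `d` the series is `1 - t^d` and only `y` counts. For odd `d` it is `1 + t^d = (1 -
t^{2d}) / (1 - t^d)`, which accounts for `y` and `[y, y]`. -/
theorem prodExponent_single {d : ℕ} (hd : 0 < d) {n : ℕ} (hn : n ≠ 0) :
    (-1) ^ n * prodExponent (1 - PowerSeries.C ((-1) ^ d) * PowerSeries.X ^ d) n =
      singleCount d n := by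
  rcases Nat.even_or_odd d with h | h
  · rw [h.neg_one_pow, map_one, one_mul, prodExponent_one_sub_X_pow hd.ne' hn, singleCount]
    by_cases hnd : n = d
    · subst hnd
      simp [h.neg_one_pow, Nat.not_odd_iff_even.2 h]
    · simp [hnd, Nat.not_odd_iff_even.2 h]
  · have h1 : (1 - PowerSeries.C ((-1) ^ d) * PowerSeries.X ^ d) * (1 - PowerSeries.X ^ d) =
        (1 - PowerSeries.X ^ (d + d) : PowerSeries ℚ) := by
      rw [h.neg_one_pow, map_neg, map_one, pow_add]
      ring
    have h2 := congrArg (fun f => prodExponent f n) h1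
    rw [prodExponent_mul (by simp [hd.ne']) (by simp [hd.ne']),
      prodExponent_one_sub_X_pow hd.ne' hn, prodExponent_one_sub_X_pow (by omega) hn] at h2
    rw [eq_sub_of_add_eq h2, singleCount]
    by_cases hnd : n = d
    · subst hnd
      simp [h.neg_one_pow, hn]
    · by_cases hnd2 : n = d + d
      · subst hnd2
        simp [h, show d ≠ 0 by omega]
      · simp [hnd, hnd2]

theorem lieCount_elimCount {d : ℕ} {c : ℕ → ℕ} (hd : 0 < d) (h0 : c 0 = 0) (hc : 1 ≤ c d) {n : ℕ}
    (hn : n ≠ 0) : lieCount c n = lieCount (elimCount d c) n + singleCount d n := by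
  rw [lieCount, genSeries_elimCount _ hd h0 hc, prodExponent_mul
    (by simp [constantCoeff_genSeries]) (by simp [hd.ne']), mul_add, prodExponent_single hd hn]
  rfl

theorem lieCount_eq_zero {c : ℕ → ℕ} {N : ℕ} (h : ∀ k ≤ N, c k = 0) {n : ℕ} (hn : n ≠ 0)
    (hN : n ≤ N) : lieCount c n = 0 := by
  have hc : ∀ k, k ≠ 0 → k ≤ N → PowerSeries.coeff k (genSeries (-1 : ℚ) c) = 0 := by
    intro k hk hkN
    rw [genSeries, PowerSeries.coeff_mk, if_neg hk, h k hkN]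
    simp
  rw [lieCount, prodExponent_of_coeff_eq_zero hn (constantCoeff_genSeries _ _)
    (fun k hk hkn => hc k hk (by omega)), hc n hn hN, neg_zero, mul_zero]

/-- One generator is split off. The hypothesis is only an upper bound for the dimension, so `M` may
be zero, and then `y = 0` will do. -/
theorem exists_span_sup {E : Type} [AddCommGroup E] [Module ℂ E] (M : Submodule ℂ E)
    [FiniteDimensional ℂ M] {m : ℕ} (h : Module.finrank ℂ M ≤ m + 1) :
    ∃ y ∈ M, ∃ W ≤ M, M ≤ Submodule.span ℂ {y} ⊔ W ∧ Module.finrank ℂ W ≤ m := by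
  by_cases hM : M = ⊥
  · exact ⟨0, M.zero_mem, ⊥, bot_le, by rw [hM]; exact bot_le, by simp⟩
  · obtain ⟨y, hy, hy0⟩ := Submodule.exists_mem_ne_zero_of_ne_bot hM
    obtain ⟨q, hq⟩ := Submodule.exists_isCompl (Submodule.span ℂ {(⟨y, hy⟩ : M)})
    refine ⟨y, hy, q.map M.subtype, Submodule.map_subtype_le _ _, ?_, ?_⟩
    · have h1 := congrArg (Submodule.map M.subtype) hq.sup_eq_top
      rw [Submodule.map_sup, Submodule.map_span, Set.image_singleton, Submodule.map_top,
        Submodule.range_subtype] at h1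
      exact h1.ge
    · have h1 := Submodule.finrank_add_eq_of_isCompl hq
      rw [finrank_span_singleton (by simpa [Subtype.ext_iff] using hy0)] at h1
      have h2 := Submodule.finrank_map_le M.subtype q
      omega

/-! ### Upper bound for the dimensions of a graded Lie algebra with given numbers of generators -/

namespace GradedBracket

variable {E : Type} [AddCommGroup E] [Module ℂ E] (G : GradedBracket E)

theorem finrank_adSpan_le {d : ℕ} {y : E} {W : ℕ → Submodule ℂ E} {c : ℕ → ℕ}
    (hfin : ∀ k, FiniteDimensional ℂ (W k))
    (h : ∀ k, Module.finrank ℂ (W k) ≤ if k = d then c k - 1 else c k) (k : ℕ) :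
    Module.finrank ℂ (G.adSpan d y W k) ≤ elimCount d c k := by
  induction k using Nat.strong_induction_on with
  | _ k ih =>
    rw [adSpan, elimCount]
    have := hfin k
    by_cases hk : 0 < d ∧ d ≤ k
    · rw [dif_pos hk, dif_pos hk]
      have := G.finiteDimensional_adSpan (d := d) (y := y) hfin (k - d)
      exact (Submodule.finrank_add_le_finrank_add_finrank _ _).trans
        (add_le_add (h k) ((Submodule.finrank_map_le _ _).trans (ih _ (by omega))))
    · rw [dif_neg hk, dif_neg hk, sup_bot_eq]
      exact h k

theorem finrank_singleSpan_le {d : ℕ} (hd : 0 < d) {y : E} (hy : y ∈ G.part d) (n : ℕ) :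
    Module.finrank ℂ (G.singleSpan d y n) ≤ singleCount d n := by
  by_cases h1 : n = d
  · subst h1
    have : G.singleSpan n y n ≤ Submodule.span ℂ {y} :=
      G.singleSpan_le (fun _ => Submodule.mem_span_singleton_self y) fun h => by omega
    refine (Submodule.finrank_mono this).trans ((finrank_span_le_card _).trans ?_)
    simp [singleCount]
  · by_cases h2 : n = d + d ∧ Odd d
    · have : G.singleSpan d y n ≤ Submodule.span ℂ {G.br d d y y} :=
        G.singleSpan_le (fun h => absurd h h1) fun _ => Submodule.mem_span_singleton_self _
      refine (Submodule.finrank_mono this).trans ((finrank_span_le_card _).trans ?_)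
      simp [singleCount, h2]
    · have : G.singleSpan d y n ≤ ⊥ :=
        G.singleSpan_le (fun h => absurd h h1) fun h => by
          rw [Submodule.mem_bot]
          exact G.br_self_eq_zero hy (Nat.not_odd_iff_even.1 fun ho => h2 ⟨h, ho⟩)
      rw [le_bot_iff] at this
      rw [this, finrank_bot]
      exact Nat.zero_le _

/-- An upper bound for the dimensions of the components of a graded Lie algebra in terms of the
number of its generators. -/
theorem finrank_lieSpan_le (hfin : ∀ n, FiniteDimensional ℂ (G.part n)) (N : ℕ) {r d : ℕ}
    (hd : 0 < d) (hr : N + 1 ≤ d + r) {c : ℕ → ℕ} (hc : ∀ k < d, c k = 0)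
    {V : ℕ → Submodule ℂ E} (hV : V ≤ G.part) (hVc : ∀ k, Module.finrank ℂ (V k) ≤ c k) {n : ℕ}
    (hn : n ≠ 0) (hnN : n ≤ N) : (Module.finrank ℂ (G.lieSpan V n) : ℚ) ≤ lieCount c n := by
  have hfinV : ∀ {V : ℕ → Submodule ℂ E}, V ≤ G.part → ∀ k, FiniteDimensional ℂ (V k) :=
    fun hV k => by
      have := hfin k
      exact Submodule.finiteDimensional_of_le (hV k)
  -- Double induction: `r` bounds the number of degrees from `d` to `N` that remain, and `m = c d`
  -- the number of generators of lowest degree `d`. Elimination of one of these lowers `m` and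
  -- creates new generators only in degrees above `d`.
  induction r generalizing d c V with
  -- Now `d > N`, so there are no generators in degrees up to `N` and both sides vanish.
  | zero =>
    have hbot : ∀ k ≤ N, V k = ⊥ := fun k hk => by
      have := hfinV hV k
      exact Submodule.finrank_eq_zero.1 (Nat.le_zero.1 ((hVc k).trans (hc k (by omega)).le))
    rw [G.lieSpan_eq_bot hbot hnN, finrank_bot,
      lieCount_eq_zero (N := N) (fun k hk => hc k (by omega)) hn hnN, Nat.cast_zero]
  | succ r ihr =>
    obtain ⟨m, hm⟩ : ∃ m, c d = m := ⟨_, rfl⟩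
    induction m generalizing c V with
    | zero =>
      refine ihr (d := d + 1) (by omega) (by omega) (fun k hk => ?_) hV hVc
      rcases Nat.lt_succ_iff_lt_or_eq.1 hk with h | rfl
      · exact hc k h
      · exact hm
    | succ m ihm =>
      have := hfinV hV d
      obtain ⟨y, hy, M, hM, hyM, hMm⟩ := exists_span_sup (V d) ((hVc d).trans hm.le)
      have hyP := hV d hy
      set W := Function.update V d M with hWdef
      have hWV : W ≤ V := by
        intro k
        rcases eq_or_ne k d with rfl | hk
        · simpa [hWdef] using hM
        · simp [hWdef, hk]
      have hWP := hWV.trans hV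
      have hV' : G.adSpan d y W ≤ G.part := G.adSpan_le hWP hd fun k x hx => G.br_mem hyP hx
      have hVW : ∀ n, V n ≤ (if n = d then Submodule.span ℂ {y} else ⊥) ⊔ W n := by
        intro n
        rcases eq_or_ne n d with rfl | hk
        · simpa [hWdef] using hyM
        · simp [hWdef, hk]
      have hWc : ∀ k, Module.finrank ℂ (W k) ≤ if k = d then c k - 1 else c k := by
        intro k
        rcases eq_or_ne k d with rfl | hk
        · rw [if_pos rfl, hWdef, Function.update_self, hm]
          exact hMm
        · rw [if_neg hk, hWdef, Function.update_of_ne hk]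
          exact hVc k
      have h1 := ihm (c := elimCount d c) (V := G.adSpan d y W)
        (fun k hk => by rw [elimCount_of_lt hk, hc k hk]) hV'
        (G.finrank_adSpan_le (hfinV hWP) hWc) (by rw [elimCount_self hd (hc 0 hd), hm]; rfl)
      rw [lieCount_elimCount hd (hc 0 hd) (by omega) hn]
      have h2 := G.lieSpan_le_sup hd hyP hWP hVW n
      have h3 := hfinV (G.lieSpan_le_part hV') n
      have h4 : FiniteDimensional ℂ (G.singleSpan d y n) := by
        have hs : G.singleSpan d y n ≤ Submodule.span ℂ {y, G.br d d y y} :=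
          G.singleSpan_le (fun _ => Submodule.subset_span (by simp))
            fun _ => Submodule.subset_span (by simp)
        have : FiniteDimensional ℂ (Submodule.span ℂ {y, G.br d d y y}) :=
          FiniteDimensional.span_of_finite ℂ (Set.toFinite _)
        exact Submodule.finiteDimensional_of_le hs
      have h5 := (Submodule.finrank_mono h2).trans
        (Submodule.finrank_add_le_finrank_add_finrank _ _)
      have h6 := G.finrank_singleSpan_le hd hyP n
      have h7 : (Module.finrank ℂ (G.lieSpan V n) : ℚ) ≤
          singleCount d n + Module.finrank ℂ (G.lieSpan (G.adSpan d y W) n) := by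
        exact_mod_cast h5.trans (by omega)
      linarith

end GradedBracket

end

noncomputable section

/-! ### Words in graded subspaces of an associative algebra -/

/-- The number of words of degree `n` in letters of which `c k` have degree `k`, for `k ≥ 1`. -/
def wordCount (c : ℕ → ℕ) : ℕ → ℕ
  | 0 => 1
  | n + 1 => ∑ k : Fin (n + 1), c (k + 1) * wordCount c (n - k)

/-- Splitting off the first letter of a word gives the recursion of `1 / (1 - ∑ c_k t^k)`. -/
theorem genSeries_mul_mk_wordCount (c : ℕ → ℕ) :
    genSeries (1 : ℚ) c * PowerSeries.mk (fun n => (wordCount c n : ℚ)) = 1 := by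
  ext n
  rw [PowerSeries.coeff_mul]
  rcases n with _ | n
  · simp [genSeries, wordCount]
  · rw [Finset.Nat.sum_antidiagonal_succ, Finset.Nat.sum_antidiagonal_eq_sum_range_succ
      (fun i j => PowerSeries.coeff (i + 1) (genSeries (1 : ℚ) c) *
        PowerSeries.coeff j (PowerSeries.mk (fun n => (wordCount c n : ℚ)))), Finset.sum_range]
    simp [genSeries, wordCount, PowerSeries.coeff_one]

/-- This is the numerical form of a decomposition `A = A' ⊕ yA` of the free algebra, where `A'` is
generated by the elements `(ad y)^j w`. It follows from the factorization of the generating series.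
-/
theorem wordCount_eq_elimCount_add {d : ℕ} {c : ℕ → ℕ} (hd : 0 < d) (h0 : c 0 = 0) (hc : 1 ≤ c d)
    (n : ℕ) : wordCount c n =
      wordCount (elimCount d c) n + if d ≤ n then wordCount c (n - d) else 0 := by
  have h1 := genSeries_mul_mk_wordCount c
  have h2 := genSeries_mul_mk_wordCount (elimCount d c)
  rw [genSeries_elimCount _ hd h0 hc, one_pow, map_one, one_mul] at h1
  have h3 : PowerSeries.mk (fun n => (wordCount c n : ℚ)) * (1 - PowerSeries.X ^ d) =
      PowerSeries.mk (fun n => (wordCount (elimCount d c) n : ℚ)) := by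
    linear_combination PowerSeries.mk (fun n => (wordCount (elimCount d c) n : ℚ)) * h1 -
      (PowerSeries.mk (fun n => (wordCount c n : ℚ)) * (1 - PowerSeries.X ^ d)) * h2
  have h4 := congrArg (PowerSeries.coeff n) h3
  rw [mul_sub, mul_one, map_sub, PowerSeries.coeff_mul_X_pow', PowerSeries.coeff_mk,
    PowerSeries.coeff_mk, PowerSeries.coeff_mk] at h4
  have h5 : (wordCount c n : ℚ) =
      wordCount (elimCount d c) n + if d ≤ n then (wordCount c (n - d) : ℚ) else 0 := by
    linarith
  exact_mod_cast h5

section assocSpan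

variable {E : Type} [Ring E] [Algebra ℂ E] {V : ℕ → Submodule ℂ E}

/-- The components of the graded subalgebra generated by a graded family of subspaces in positive
degrees. -/
def assocSpan (V : ℕ → Submodule ℂ E) : ℕ → Submodule ℂ E
  | 0 => 1
  | n + 1 => ⨆ k : Fin (n + 1), V (k + 1) * assocSpan V (n - k)

theorem assocSpan_zero : assocSpan V 0 = 1 := by rw [assocSpan]

theorem mul_assocSpan_le {k : ℕ} (hk : k ≠ 0) (n : ℕ) :
    V k * assocSpan V n ≤ assocSpan V (k + n) := by
  obtain ⟨k, rfl⟩ := Nat.exists_eq_succ_of_ne_zero hk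
  rw [show k.succ + n = k + n + 1 by omega, assocSpan]
  refine le_trans ?_ (le_iSup _ (⟨k, by omega⟩ : Fin (k + n + 1)))
  simp

theorem assocSpan_le {n : ℕ} {M : Submodule ℂ E} (h0 : n = 0 → 1 ≤ M)
    (h : ∀ k m, k ≠ 0 → k + m = n → V k * assocSpan V m ≤ M) : assocSpan V n ≤ M := by
  rcases n with _ | n
  · rw [assocSpan_zero]
    exact h0 rfl
  · rw [assocSpan]
    exact iSup_le fun k => h _ _ (by omega) (by omega)

theorem assocSpan_mul_le (m n : ℕ) : assocSpan V m * assocSpan V n ≤ assocSpan V (m + n) := by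
  induction m using Nat.strong_induction_on with
  | _ m ih =>
    rcases m with _ | m
    · rw [assocSpan_zero, one_mul, zero_add]
    · rw [assocSpan, Submodule.iSup_mul]
      refine iSup_le fun k => ?_
      rw [mul_assoc]
      refine (mul_le_mul' le_rfl (ih (m - k) (by omega))).trans ?_
      refine (mul_assocSpan_le (by omega) _).trans_eq ?_
      congr 1
      omega

theorem le_assocSpan {k : ℕ} (hk : k ≠ 0) : V k ≤ assocSpan V k := by
  simpa [assocSpan_zero] using mul_assocSpan_le (V := V) hk 0

theorem mul_mem_assocSpan {m n : ℕ} {x y : E} (hx : x ∈ assocSpan V m) (hy : y ∈ assocSpan V n) :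
    x * y ∈ assocSpan V (m + n) :=
  assocSpan_mul_le m n (Submodule.mul_mem_mul hx hy)

theorem finiteDimensional_mul (M N : Submodule ℂ E) [FiniteDimensional ℂ M]
    [FiniteDimensional ℂ N] : FiniteDimensional ℂ (M * N : Submodule ℂ E) := by
  rw [← Submodule.mulMap_range]
  infer_instance

theorem finrank_mul_le (M N : Submodule ℂ E) [FiniteDimensional ℂ M]
    [FiniteDimensional ℂ N] : Module.finrank ℂ (M * N : Submodule ℂ E) ≤
      Module.finrank ℂ M * Module.finrank ℂ N := by
  rw [← Submodule.mulMap_range, ← Module.finrank_tensorProduct]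
  exact LinearMap.finrank_range_le _

theorem finrank_finset_sup_le {ι : Type} (s : Finset ι) (M : ι → Submodule ℂ E)
    [∀ i, FiniteDimensional ℂ (M i)] :
    Module.finrank ℂ (s.sup M : Submodule ℂ E) ≤ ∑ i ∈ s, Module.finrank ℂ (M i) := by
  classical
  induction s using Finset.induction_on with
  | empty => simp
  | insert i s hi ih =>
    rw [Finset.sup_insert, Finset.sum_insert hi]
    exact (Submodule.finrank_add_le_finrank_add_finrank _ _).trans (by omega)

theorem finiteDimensional_assocSpan (hV : ∀ k, FiniteDimensional ℂ (V k)) (n : ℕ) :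
    FiniteDimensional ℂ (assocSpan V n) := by
  induction n using Nat.strong_induction_on with
  | _ n ih =>
    rcases n with _ | n
    · rw [assocSpan_zero, Submodule.one_eq_span]
      infer_instance
    · rw [assocSpan]
      have : ∀ k : Fin (n + 1), FiniteDimensional ℂ
          (V (k + 1) * assocSpan V (n - k) : Submodule ℂ E) := fun k => by
        have := hV (k + 1)
        have := ih (n - k) (by omega)
        exact finiteDimensional_mul _ _
      infer_instance

theorem finrank_assocSpan_le (hV : ∀ k, FiniteDimensional ℂ (V k)) {c : ℕ → ℕ}
    (hc : ∀ k, Module.finrank ℂ (V k) ≤ c k) (n : ℕ) :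
    Module.finrank ℂ (assocSpan V n) ≤ wordCount c n := by
  induction n using Nat.strong_induction_on with
  | _ n ih =>
    rcases n with _ | n
    · rw [assocSpan_zero, Submodule.one_eq_span, wordCount]
      exact (finrank_span_le_card _).trans (by simp)
    · rw [assocSpan, wordCount, ← Finset.sup_univ_eq_iSup]
      have h1 : ∀ k : Fin (n + 1), FiniteDimensional ℂ (assocSpan V (n - k)) :=
        fun k => finiteDimensional_assocSpan hV _
      have h2 : ∀ k : Fin (n + 1), FiniteDimensional ℂ
          (V (k + 1) * assocSpan V (n - k) : Submodule ℂ E) := fun k => finiteDimensional_mul _ _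
      refine (finrank_finset_sup_le _ _).trans (Finset.sum_le_sum fun k _ => ?_)
      exact (finrank_mul_le _ _).trans (Nat.mul_le_mul (hc _) (ih _ (by omega)))

end assocSpan

/-! ### Signed commutators and elimination in associative algebras -/

/-- The signed commutator on an associative algebra. -/
def assocBracket (E : Type) [Ring E] [Algebra ℂ E] : GradedBracket E where
  part _ := ⊤
  br i j := LinearMap.mul ℂ E - (-1 : ℂ) ^ (i * j) • (LinearMap.mul ℂ E).flip
  br_mem _ _ := trivial
  skew {i j x y} _ _ := by
    have h : (-1 : ℂ) ^ (i * j) * (-1) ^ (i * j) = 1 := by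
      rw [← mul_pow]
      simp
    simp [smul_sub, smul_smul, h, mul_comm j i]
  jacobi {i j k x y z} _ _ _ := by
    have h : (-1 : ℂ) ^ (i * j) * (-1) ^ (i * j) = 1 := by
      rw [← mul_pow]
      simp
    simp only [LinearMap.sub_apply, LinearMap.smul_apply, LinearMap.flip_apply,
      LinearMap.mul_apply', mul_sub, sub_mul, smul_sub, mul_smul_comm, smul_mul_assoc, smul_smul,
      mul_add, add_mul, pow_add, mul_assoc, mul_comm j i]
    linear_combination (norm := module) h • ((-1 : ℂ) ^ (j * k) • (x * (z * y)) -
      ((-1 : ℂ) ^ (i * k) * (-1) ^ (j * k)) • (z * (x * y)))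

namespace GradedBracket

section

variable {E : Type} [Ring E] [Algebra ℂ E]

theorem assocBracket_apply (i j : ℕ) (x y : E) :
    (assocBracket E).br i j x y = x * y - (-1 : ℂ) ^ (i * j) • (y * x) := rfl

theorem assocBracket_closed_assocSpan (V : ℕ → Submodule ℂ E) :
    (assocBracket E).Closed (assocSpan V) := fun i j x hx y hy => by
  rw [assocBracket_apply]
  have := mul_mem_assocSpan hy hx
  rw [add_comm] at this
  exact sub_mem (mul_mem_assocSpan hx hy) (Submodule.smul_mem _ _ this)

theorem le_assocSpan_of_zero {V : ℕ → Submodule ℂ E} (h0 : V 0 = ⊥) : V ≤ assocSpan V := by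
  intro k
  rcases eq_or_ne k 0 with rfl | hk
  · rw [h0]
    exact bot_le
  · exact le_assocSpan hk

theorem lieSpan_le_assocSpan {V : ℕ → Submodule ℂ E} (h0 : V 0 = ⊥) :
    (assocBracket E).lieSpan V ≤ assocSpan V :=
  lieSpan_le _ (le_assocSpan_of_zero h0) (assocBracket_closed_assocSpan V)

/-- Every product can be rewritten with `y` moved to the left by `vy = ±(yv - [y, v])`, where `[y,
v]` is again one of the new generators; this gives `A = A' + yA`. The second clause treats products
that begin with a new generator and is proved in the same induction, since each clause needs the
other. -/
theorem assocSpan_le_sup {d : ℕ} (hd : 0 < d) {y : E} {V W : ℕ → Submodule ℂ E} (hy : y ∈ V d)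
    (hWV : W ≤ V)
    (h0 : V 0 = ⊥) (hV : ∀ n, V n ≤ (if n = d then Submodule.span ℂ {y} else ⊥) ⊔ W n) (n : ℕ) :
    assocSpan V n ≤ assocSpan ((assocBracket E).adSpan d y W) n ⊔
        (if d ≤ n then (assocSpan V (n - d)).map (LinearMap.mulLeft ℂ y) else ⊥) ∧
      ∀ k, k ≠ 0 → (assocBracket E).adSpan d y W k * assocSpan V n ≤
        assocSpan ((assocBracket E).adSpan d y W) (k + n) ⊔
        (if d ≤ k + n then (assocSpan V (k + n - d)).map (LinearMap.mulLeft ℂ y) else ⊥) := by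
  have hV'H : (assocBracket E).adSpan d y W ≤ assocSpan V :=
    adSpan_le _ (hWV.trans (le_assocSpan_of_zero h0)) hd fun k x hx =>
      assocBracket_closed_assocSpan V d k y (le_assocSpan hd.ne' hy) x hx
  induction n using Nat.strong_induction_on with
  | _ n ih =>
    have h1 : assocSpan V n ≤ assocSpan ((assocBracket E).adSpan d y W) n ⊔
        (if d ≤ n then (assocSpan V (n - d)).map (LinearMap.mulLeft ℂ y) else ⊥) := by
      refine assocSpan_le (fun h => ?_) fun k m hk hkm => ?_
      · subst h
        rw [assocSpan_zero]
        exact le_sup_left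
      · refine (mul_le_mul' (hV k) le_rfl).trans ?_
        rw [Submodule.sup_mul]
        refine sup_le ?_ ?_
        · by_cases hkd : k = d
          · subst hkd
            rw [if_pos rfl, if_pos (by omega), show n - k = m by omega]
            refine le_trans (Submodule.mul_le.2 ?_) le_sup_right
            intro x hx z hz
            obtain ⟨a, rfl⟩ := Submodule.mem_span_singleton.1 hx
            exact ⟨a • z, Submodule.smul_mem _ _ hz, by simp⟩
          · rw [if_neg hkd, Submodule.bot_mul]
            exact bot_le
        · have := (ih m (by omega)).2 k hk
          rw [hkm] at this
          exact (mul_le_mul' (le_adSpan _ k) le_rfl).trans this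
    refine ⟨h1, fun k hk => ?_⟩
    refine (mul_le_mul' le_rfl h1).trans ?_
    rw [Submodule.mul_sup]
    refine sup_le ((mul_assocSpan_le hk n).trans le_sup_left) ?_
    split_ifs with hdn hdk hdk
    · refine Submodule.mul_le.2 ?_
      rintro v hv _ ⟨z, hz, rfl⟩
      have e : v * (LinearMap.mulLeft ℂ y) z =
          (-1 : ℂ) ^ (d * k) • (LinearMap.mulLeft ℂ y (v * z)) -
          (-1 : ℂ) ^ (d * k) • ((assocBracket E).br d k y v * z) := by
        have h : (-1 : ℂ) ^ (d * k) * (-1) ^ (d * k) = 1 := by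
          rw [← mul_pow]
          simp
        simp [assocBracket_apply, sub_mul, smul_sub, smul_smul, h, mul_assoc]
      rw [e]
      refine sub_mem (Submodule.smul_mem _ _ ?_) (Submodule.smul_mem _ _ ?_)
      · refine Submodule.mem_sup_right ⟨v * z, ?_, rfl⟩
        have := mul_mem_assocSpan (hV'H k hv) hz
        rwa [← Nat.add_sub_assoc hdn] at this
      -- The correction term `[y, v] z` has a new generator of higher degree in front and a shorter
      -- second factor.
      · have := (ih (n - d) (by omega)).2 (d + k) (by omega)
          (Submodule.mul_mem_mul (br_mem_adSpan _ hd hv) hz)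
        rwa [show d + k + (n - d) = k + n by omega, if_pos hdk] at this
    · omega
    · simp
    · simp

end

end GradedBracket

end

/-! ### Lower bound for the dimensions of a Lie algebra of commutators -/

noncomputable section

namespace GradedBracket

variable {E : Type} [Ring E] [Algebra ℂ E]

/-- If the subalgebra generated by `V` is as large as the counts `c` permit, then so is the one
generated after an elimination, and the sum decomposition is direct. -/
theorem elimination_of_wordCount_le {d : ℕ} (hd : 0 < d) {y : E} {V W : ℕ → Submodule ℂ E}
    {c : ℕ → ℕ} (hy : y ∈ V d) (hWV : W ≤ V) (h0 : V 0 = ⊥)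
    (hV : ∀ n, V n ≤ (if n = d then Submodule.span ℂ {y} else ⊥) ⊔ W n)
    (hfin : ∀ k, FiniteDimensional ℂ (V k)) (hVc : ∀ k, Module.finrank ℂ (V k) ≤ c k)
    (hWc : ∀ k, Module.finrank ℂ (W k) ≤ if k = d then c k - 1 else c k)
    (hc0 : c 0 = 0) (hc : 1 ≤ c d) {n : ℕ}
    (hn : wordCount c n ≤ Module.finrank ℂ (assocSpan V n)) :
    wordCount (elimCount d c) n ≤
        Module.finrank ℂ (assocSpan ((assocBracket E).adSpan d y W) n) ∧
      (d ≤ n → ∀ x ∈ assocSpan V (n - d), (y * x = 0 → x = 0) ∧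
        (y * x ∈ assocSpan ((assocBracket E).adSpan d y W) n → x = 0)) := by
  have hfinW : ∀ k, FiniteDimensional ℂ (W k) := fun k =>
    Submodule.finiteDimensional_of_le (hWV k)
  have hfin' := (assocBracket E).finiteDimensional_adSpan (d := d) (y := y) hfinW
  have hc' := (assocBracket E).finrank_adSpan_le (y := y) hfinW hWc
  have h1 := (assocSpan_le_sup hd hy hWV h0 hV n).1
  have h2 := finrank_assocSpan_le hfin' hc' n
  have h3 := wordCount_eq_elimCount_add hd hc0 hc n
  have := finiteDimensional_assocSpan hfin' n
  by_cases hdn : d ≤ n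
  · rw [if_pos hdn] at h1 h3
    have := finiteDimensional_assocSpan hfin (n - d)
    have h4 := finrank_assocSpan_le hfin hVc (n - d)
    have h5 := Submodule.finrank_mono h1
    have h6 := Submodule.finrank_sup_add_finrank_inf_eq
      (assocSpan ((assocBracket E).adSpan d y W) n)
      ((assocSpan V (n - d)).map (LinearMap.mulLeft ℂ y))
    have h7 := Submodule.finrank_map_le (LinearMap.mulLeft ℂ y) (assocSpan V (n - d))
    -- The bounds for `A'_n` and `A_{n-d}` add up to the lower bound assumed for `A_n`. Hence no
    -- dimension is lost: left multiplication by `y` is injective on `A_{n-d}`, and `A'_n` meets `y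
    -- A_{n-d}` trivially.
    have h8 : Module.finrank ℂ (assocSpan V (n - d)) =
        Module.finrank ℂ ((assocSpan V (n - d)).map (LinearMap.mulLeft ℂ y)) := by omega
    have h9 : assocSpan ((assocBracket E).adSpan d y W) n ⊓
        (assocSpan V (n - d)).map (LinearMap.mulLeft ℂ y) = ⊥ :=
      Submodule.finrank_eq_zero.1 (by omega)
    have h10 : ∀ x ∈ assocSpan V (n - d), y * x = 0 → x = 0 := by
      have e := LinearMap.finrank_range_add_finrank_ker
        ((LinearMap.mulLeft ℂ y).domRestrict (assocSpan V (n - d)))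
      rw [LinearMap.range_domRestrict, ← h8, Nat.add_eq_left, Submodule.finrank_eq_zero] at e
      intro x hx hyx
      have : (⟨x, hx⟩ : assocSpan V (n - d)) ∈
          LinearMap.ker ((LinearMap.mulLeft ℂ y).domRestrict (assocSpan V (n - d))) := hyx
      rw [e, Submodule.mem_bot] at this
      exact congrArg Subtype.val this
    refine ⟨by omega, fun _ x hx => ⟨h10 x hx, fun hyx => h10 x hx ?_⟩⟩
    rw [← Submodule.mem_bot ℂ, ← h9]
    exact ⟨hyx, x, hx, rfl⟩
  · rw [if_neg hdn] at h1 h3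
    rw [sup_bot_eq] at h1
    exact ⟨by have := Submodule.finrank_mono h1; omega, fun h => absurd h hdn⟩

/-- A lower bound for the dimensions of the components of a graded Lie algebra of commutators that
generates a sufficiently large associative algebra. -/
theorem le_finrank_lieSpan [Nontrivial E] (N : ℕ) {r d : ℕ}
    (hd : 0 < d) (hr : N + 1 ≤ d + r) {c : ℕ → ℕ} (hc : ∀ k < d, c k = 0)
    {V : ℕ → Submodule ℂ E} (hfin : ∀ k, FiniteDimensional ℂ (V k))
    (hVc : ∀ k, Module.finrank ℂ (V k) ≤ c k)
    (hN : ∀ n ≤ N, wordCount c n ≤ Module.finrank ℂ (assocSpan V n)) {n : ℕ}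
    (hn : n ≠ 0) (hnN : n ≤ N) :
    lieCount c n ≤ Module.finrank ℂ ((assocBracket E).lieSpan V n) := by
  induction r generalizing d c V with
  | zero =>
    rw [lieCount_eq_zero (N := N) (fun k hk => hc k (by omega)) hn hnN]
    exact Nat.cast_nonneg _
  | succ r ihr =>
    obtain ⟨m, hm⟩ : ∃ m, c d = m := ⟨_, rfl⟩
    -- This is the same double induction as for the upper bound; elimination preserves the
    -- hypothesis on the size of the associative algebra.
    induction m generalizing c V with
    | zero =>
      refine ihr (d := d + 1) (by omega) (by omega) (fun k hk => ?_) hfin hVc hN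
      rcases Nat.lt_succ_iff_lt_or_eq.1 hk with h | rfl
      · exact hc k h
      · exact hm
    | succ m ihm =>
      obtain ⟨y, hy, M, hM, hyM, hMm⟩ := exists_span_sup (V d) ((hVc d).trans hm.le)
      have h0 : V 0 = ⊥ := by
        have := hfin 0
        exact Submodule.finrank_eq_zero.1 (Nat.le_zero.1 ((hVc 0).trans (hc 0 hd).le))
      obtain ⟨W, hW⟩ : ∃ W, W = Function.update V d M := ⟨_, rfl⟩
      have hWd : W d = M := by rw [hW, Function.update_self]
      have hWk : ∀ k, k ≠ d → W k = V k := fun k hk => by rw [hW, Function.update_of_ne hk]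
      have hWV : W ≤ V := by
        intro k
        rcases eq_or_ne k d with rfl | hk
        · rwa [hWd]
        · rw [hWk k hk]
      have hVW : ∀ n, V n ≤ (if n = d then Submodule.span ℂ {y} else ⊥) ⊔ W n := by
        intro n
        rcases eq_or_ne n d with rfl | hk
        · rwa [hWd, if_pos rfl]
        · rw [hWk n hk]
          exact le_sup_right
      have hWc : ∀ k, Module.finrank ℂ (W k) ≤ if k = d then c k - 1 else c k := by
        intro k
        rcases eq_or_ne k d with rfl | hk
        · rw [if_pos rfl, hm, hWd]
          exact hMm
        · rw [if_neg hk, hWk k hk]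
          exact hVc k
      have hfinW : ∀ k, FiniteDimensional ℂ (W k) := fun k =>
        Submodule.finiteDimensional_of_le (hWV k)
      have hel := fun {n} (h : n ≤ N) => elimination_of_wordCount_le hd hy hWV h0 hVW hfin hVc hWc
        (hc 0 hd) (by omega) (hN n h)
      have hfin' := (assocBracket E).finiteDimensional_adSpan (d := d) (y := y) hfinW
      have h1 := ihm (c := elimCount d c) (V := (assocBracket E).adSpan d y W)
        (fun k hk => by rw [elimCount_of_lt hk, hc k hk]) hfin'
        ((assocBracket E).finrank_adSpan_le hfinW hWc) (fun n h => (hel h).1)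
        (by rw [elimCount_self hd (hc 0 hd), hm]; rfl)
      rw [lieCount_elimCount hd (hc 0 hd) (by omega) hn]
      have hV'S : (assocBracket E).adSpan d y W ≤ (assocBracket E).lieSpan V :=
        adSpan_le _ (hWV.trans (le_lieSpan _ V)) hd fun k x hx =>
          lieSpan_closed _ V d k y (le_lieSpan _ V d hy) x hx
      have hS := lieSpan_le _ hV'S (lieSpan_closed _ V) n
      have hS'H := lieSpan_le_assocSpan (V := (assocBracket E).adSpan d y W)
        (le_bot_iff.1 (by
          have h2 := (assocBracket E).finrank_adSpan_le (y := y) hfinW hWc 0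
          rw [elimCount_of_lt hd, hc 0 hd, Nat.le_zero] at h2
          exact (Submodule.finrank_eq_zero.1 h2).le)) n
      have := finiteDimensional_assocSpan hfin n
      have : FiniteDimensional ℂ ((assocBracket E).lieSpan V n) :=
        Submodule.finiteDimensional_of_le (lieSpan_le_assocSpan h0 n)
      -- The Lie algebra of the new generators lies in `A'`, so an element of the old Lie algebra
      -- outside `A'` adds a dimension. This is used for `y = y · 1` and, for odd `d`, for `[y, y] =
      -- 2 y · y`.
      have hlt : ∀ z ∈ (assocBracket E).lieSpan V n,
          z ∉ assocSpan ((assocBracket E).adSpan d y W) n →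
          Module.finrank ℂ ((assocBracket E).lieSpan ((assocBracket E).adSpan d y W) n) + 1 ≤
            Module.finrank ℂ ((assocBracket E).lieSpan V n) := fun z hz hz' =>
        Submodule.finrank_lt_finrank_of_lt (lt_of_le_of_ne hS fun h => hz' (hS'H (h ▸ hz)))
      have hy0 : d ≤ N → y ≠ 0 := by
        rintro hdN rfl
        refine one_ne_zero (((hel hdN).2 le_rfl (1 : E) ?_).1 (zero_mul _))
        rw [Nat.sub_self, assocSpan_zero]
        exact Submodule.one_le.1 le_rfl
      have hcount : Module.finrank ℂ ((assocBracket E).lieSpan ((assocBracket E).adSpan d y W) n) +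
          singleCount d n ≤ Module.finrank ℂ ((assocBracket E).lieSpan V n) := by
        by_cases hnd : n = d
        · subst hnd
          rw [singleCount, if_pos rfl, if_neg (by omega), add_zero]
          refine hlt y (le_lieSpan _ V n hy) fun h => ?_
          have h2 := ((hel hnN).2 le_rfl (1 : E) (by
            rw [Nat.sub_self, assocSpan_zero]
            exact Submodule.one_le.1 le_rfl)).2 (by rwa [mul_one])
          exact one_ne_zero h2
        · by_cases hnd2 : n = d + d ∧ Odd d
          · obtain ⟨rfl, ho⟩ := hnd2
            rw [singleCount, if_neg (by omega), if_pos ⟨rfl, ho⟩, zero_add]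
            have e : (assocBracket E).br d d y y = (2 : ℂ) • (y * y) := by
              rw [assocBracket_apply, (ho.mul ho).neg_one_pow]
              module
            refine hlt _ (lieSpan_closed _ V d d y (le_lieSpan _ V d hy) y (le_lieSpan _ V d hy))
              fun h => hy0 (by omega) ?_
            rw [e, Submodule.smul_mem_iff _ two_ne_zero] at h
            refine ((hel hnN).2 (by omega) y ?_).2 h
            rw [Nat.add_sub_cancel]
            exact le_assocSpan hd.ne' hy
          · rw [singleCount, if_neg hnd, if_neg hnd2, add_zero, add_zero]
            exact Submodule.finrank_mono hS
      have h3 : (Module.finrank ℂ ((assocBracket E).lieSpan ((assocBracket E).adSpan d y W) n) +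
          singleCount d n : ℚ) ≤ Module.finrank ℂ ((assocBracket E).lieSpan V n) := by
        exact_mod_cast hcount
      linarith

end GradedBracket

end

noncomputable section

/-! ### A representation of the Koszul dual Lie algebra of the Veronese ring -/

/-- The operator that moves the functions on words to the words with first letter `i`. -/
def prependOp (i : ℕ) : Module.End ℂ (List ℕ → ℂ) where
  toFun f w := if w.head? = some i then f w.tail else 0
  map_add' f g := by
    funext w
    simp only [Pi.add_apply]
    split_ifs <;> simp
  map_smul' c f := by
    funext w
    simp

/-- The restriction of the functions on words to the words with first letter `i`. -/
def tailOp (i : ℕ) : Module.End ℂ (List ℕ → ℂ) where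
  toFun f w := f (i :: w)
  map_add' _ _ := rfl
  map_smul' _ _ := rfl

theorem tailOp_mul_prependOp (i j : ℕ) : tailOp i * prependOp j = if i = j then 1 else 0 := by
  refine LinearMap.ext fun f => funext fun w => ?_
  by_cases h : i = j <;> simp [tailOp, prependOp, h]

/-- The operators `prependOp k` for `2 ≤ k ≤ b + 1`, extended by zero. -/
def cutOp (b k : ℕ) : Module.End ℂ (List ℕ → ℂ) :=
  if 2 ≤ k ∧ k ≤ b + 1 then prependOp k else 0

theorem cutOp_eq_zero {b k : ℕ} (h : ¬(2 ≤ k ∧ k ≤ b + 1)) : cutOp b k = 0 := if_neg h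

/-- The algebra in which the representation takes values. -/
abbrev RepAlg : Type := Matrix (Fin 2) (Fin 2) (Module.End ℂ (List ℕ → ℂ))

section nilpotent

variable {T : Type} [Ring T] {u : ℕ → T}

/-- The coefficients of `u(z) N(z)`, where `u(z) = ∑ u_k z^k` and `N(z)` is nilpotent of square
zero. -/
def nilGen (u : ℕ → T) (i : ℕ) : Matrix (Fin 2) (Fin 2) T :=
  !![u (i + 1), u i; -u (i + 2), -u (i + 1)]

/-- The coefficients of the square of `∑ u_k z^k`. -/
def coeffSq (u : ℕ → T) (k : ℕ) : T :=
  ∑ p ∈ Finset.HasAntidiagonal.antidiagonal k, u p.1 * u p.2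

/-- Shifting an index by `s` divides `u(z)` by `z^s`. As `u_0` and, for shifts by two, also `u_1`
vanish, no boundary terms are lost. This and the following lemmas treat the shifts that occur in the
square of `nilGen`. -/
theorem sum_mul_one_zero (h0 : u 0 = 0) (k : ℕ) :
    ∑ p ∈ Finset.HasAntidiagonal.antidiagonal k, u (p.1 + 1) * u p.2 =
      coeffSq u (k + 1) := by
  rw [coeffSq, Finset.Nat.sum_antidiagonal_succ, h0, zero_mul, zero_add]

theorem sum_mul_zero_one (h0 : u 0 = 0) (k : ℕ) :
    ∑ p ∈ Finset.HasAntidiagonal.antidiagonal k, u p.1 * u (p.2 + 1) =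
      coeffSq u (k + 1) := by
  rw [coeffSq, Finset.Nat.sum_antidiagonal_succ', h0, mul_zero, zero_add]

theorem sum_mul_one_one (h0 : u 0 = 0) (k : ℕ) :
    ∑ p ∈ Finset.HasAntidiagonal.antidiagonal k, u (p.1 + 1) * u (p.2 + 1) =
      coeffSq u (k + 2) := by
  rw [← sum_mul_one_zero h0, Finset.Nat.sum_antidiagonal_succ', h0, mul_zero, zero_add]

theorem sum_mul_two_zero (h0 : u 0 = 0) (h1 : u 1 = 0) (k : ℕ) :
    ∑ p ∈ Finset.HasAntidiagonal.antidiagonal k, u (p.1 + 2) * u p.2 =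
      coeffSq u (k + 2) := by
  rw [← sum_mul_one_zero h0, Finset.Nat.sum_antidiagonal_succ, zero_add, h1, zero_mul,
    zero_add]

theorem sum_mul_zero_two (h0 : u 0 = 0) (h1 : u 1 = 0) (k : ℕ) :
    ∑ p ∈ Finset.HasAntidiagonal.antidiagonal k, u p.1 * u (p.2 + 2) =
      coeffSq u (k + 2) := by
  rw [← sum_mul_zero_one h0, Finset.Nat.sum_antidiagonal_succ', zero_add, h1, mul_zero,
    zero_add]

theorem sum_mul_two_one (h0 : u 0 = 0) (h1 : u 1 = 0) (k : ℕ) :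
    ∑ p ∈ Finset.HasAntidiagonal.antidiagonal k, u (p.1 + 2) * u (p.2 + 1) =
      coeffSq u (k + 3) := by
  rw [← sum_mul_two_zero h0 h1, Finset.Nat.sum_antidiagonal_succ', h0, mul_zero, zero_add]

theorem sum_mul_one_two (h0 : u 0 = 0) (h1 : u 1 = 0) (k : ℕ) :
    ∑ p ∈ Finset.HasAntidiagonal.antidiagonal k, u (p.1 + 1) * u (p.2 + 2) =
      coeffSq u (k + 3) := by
  rw [← sum_mul_zero_two h0 h1, Finset.Nat.sum_antidiagonal_succ, h0, zero_mul, zero_add]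

/-- The generating series is `u(z) N(z)`, where `N(z)` has rows `(z⁻¹, 1)` and `(-z⁻², -z⁻¹)`. Its
entries are central, so the square is `u(z)^2 N(z)^2 = 0`. -/
theorem sum_nilGen_mul (h0 : u 0 = 0) (h1 : u 1 = 0) (k : ℕ) :
    ∑ p ∈ Finset.HasAntidiagonal.antidiagonal k, nilGen u p.1 * nilGen u p.2 = 0 := by
  refine Matrix.ext fun i j => ?_
  rw [Matrix.sum_apply]
  fin_cases i <;> fin_cases j <;>
    simp [nilGen, Finset.sum_add_distrib, Finset.sum_neg_distrib, sum_mul_one_zero h0,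
      sum_mul_zero_one h0, sum_mul_one_one h0, sum_mul_two_zero h0 h1, sum_mul_zero_two h0 h1,
      sum_mul_two_one h0 h1, sum_mul_one_two h0 h1]

end nilpotent

/-- The images of the generators in the representation. -/
def repGen (b i : ℕ) : RepAlg := nilGen (cutOp b) i

theorem sum_repGen_mul_antidiagonal (b k : ℕ) :
    ∑ p ∈ Finset.HasAntidiagonal.antidiagonal k, repGen b p.1 * repGen b p.2 = 0 :=
  sum_nilGen_mul (cutOp_eq_zero (by omega)) (cutOp_eq_zero (by omega)) k

theorem repGen_eq_zero {b i : ℕ} (h : b + 1 < i) : repGen b i = 0 := by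
  rw [repGen, nilGen, cutOp_eq_zero (k := i + 1) (by omega), cutOp_eq_zero (k := i) (by omega),
    cutOp_eq_zero (k := i + 2) (by omega)]
  refine Matrix.ext fun i j => ?_
  fin_cases i <;> fin_cases j <;> simp

/-- The convolution over all natural indices may be cut off at `b + 1`, because `repGen` vanishes
beyond. -/
theorem sum_repGen_mul (b k : ℕ) :
    ∑ i : Fin (b + 2), ∑ j : Fin (b + 2),
      (if (i : ℕ) + j = k then (1 : ℂ) else 0) • (repGen b i * repGen b j) = 0 := by
  have h : ∀ i : ℕ, ∑ j : Fin (b + 2),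
      (if (i : ℕ) + j = k then (1 : ℂ) else 0) • (repGen b i * repGen b j) =
      ∑ j ∈ Finset.range (b + 2), if i + j = k then repGen b i * repGen b j else 0 := fun i => by
    rw [← Fin.sum_univ_eq_sum_range fun j => if i + j = k then repGen b i * repGen b j else 0]
    exact Finset.sum_congr rfl fun j _ => by rw [ite_smul, one_smul, zero_smul]
  rw [Finset.sum_congr rfl fun (i : Fin (b + 2)) _ => h i, Fin.sum_univ_eq_sum_range fun i =>
    ∑ j ∈ Finset.range (b + 2), if i + j = k then repGen b i * repGen b j else 0,
    ← Finset.sum_product', ← Finset.sum_filter, ← sum_repGen_mul_antidiagonal b k]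
  refine Finset.sum_subset (fun p hp => ?_) fun p hp hp' => ?_
  · simpa using (Finset.mem_filter.1 hp).2
  · rw [Finset.HasAntidiagonal.mem_antidiagonal] at hp
    rw [Finset.mem_filter, Finset.mem_product, Finset.mem_range, Finset.mem_range] at hp'
    rcases lt_or_ge (b + 1) p.1 with h1 | h1
    · rw [repGen_eq_zero h1, zero_mul]
    · rw [repGen_eq_zero (i := p.2) (by omega), mul_zero]

/-! ### Algebras generated in degree one -/

/-- The span of a family of elements, placed in degree one. -/
def degOne {ι E : Type} [AddCommGroup E] [Module ℂ E] (Y : ι → E) (k : ℕ) : Submodule ℂ E :=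
  if k = 1 then Submodule.span ℂ (Set.range Y) else ⊥

theorem degOne_one {ι E : Type} [AddCommGroup E] [Module ℂ E] (Y : ι → E) :
    degOne Y 1 = Submodule.span ℂ (Set.range Y) := if_pos rfl

theorem degOne_of_ne {ι E : Type} [AddCommGroup E] [Module ℂ E] (Y : ι → E) {k : ℕ} (hk : k ≠ 1) :
    degOne Y k = ⊥ := if_neg hk

theorem finiteDimensional_degOne {ι E : Type} [Finite ι] [AddCommGroup E] [Module ℂ E] (Y : ι → E)
    (k : ℕ) : FiniteDimensional ℂ (degOne Y k) := by
  rcases eq_or_ne k 1 with rfl | hk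
  · rw [degOne_one]
    exact FiniteDimensional.span_of_finite ℂ (Set.finite_range Y)
  · rw [degOne_of_ne Y hk]
    infer_instance

theorem finrank_degOne_le {ι E : Type} [Fintype ι] [AddCommGroup E] [Module ℂ E] (Y : ι → E)
    (k : ℕ) : Module.finrank ℂ (degOne Y k) ≤ if k = 1 then Fintype.card ι else 0 := by
  rcases eq_or_ne k 1 with rfl | hk
  · rw [degOne_one, if_pos rfl]
    exact finrank_range_le_card Y
  · rw [degOne_of_ne Y hk, finrank_bot]
    exact Nat.zero_le _

theorem mem_assocSpan_degOne_succ {ι E : Type} [Fintype ι] [Ring E] [Algebra ℂ E] (Y : ι → E)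
    {n : ℕ} {x : E} : x ∈ assocSpan (degOne Y) (n + 1) ↔
      ∃ z : ι → E, (∀ i, z i ∈ assocSpan (degOne Y) n) ∧ x = ∑ i, Y i * z i := by
  constructor
  · intro hx
    have h : assocSpan (degOne Y) (n + 1) ≤ LinearMap.range
        (∑ i, LinearMap.mulLeft ℂ (Y i) ∘ₗ (assocSpan (degOne Y) n).subtype ∘ₗ LinearMap.proj i :
          (ι → assocSpan (degOne Y) n) →ₗ[ℂ] E) := by
      refine assocSpan_le (by omega) fun k m hk hkm => ?_
      rcases eq_or_ne k 1 with rfl | hk1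
      · obtain rfl : m = n := by omega
        rw [degOne_one, Submodule.mul_le]
        intro a ha c hc
        induction ha using Submodule.span_induction with
        | mem a ha =>
          classical
          obtain ⟨i, rfl⟩ := ha
          refine ⟨Pi.single i ⟨c, hc⟩, ?_⟩
          rw [LinearMap.sum_apply, Finset.sum_eq_single i]
          · simp
          · intro j _ hj
            simp [hj]
          · simp
        | zero => rw [zero_mul]; exact Submodule.zero_mem _
        | add a a' _ _ h h' => rw [add_mul]; exact Submodule.add_mem _ h h'
        | smul r a _ h => rw [smul_mul_assoc]; exact Submodule.smul_mem _ _ h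
      · rw [degOne_of_ne Y hk1, Submodule.bot_mul]
        exact bot_le
    obtain ⟨z, rfl⟩ := h hx
    exact ⟨fun i => z i, fun i => (z i).2, by simp [LinearMap.sum_apply]⟩
  · rintro ⟨z, hz, rfl⟩
    refine Submodule.sum_mem _ fun i _ => ?_
    rw [add_comm n 1]
    refine mul_assocSpan_le one_ne_zero n (Submodule.mul_mem_mul ?_ (hz i))
    rw [degOne_one]
    exact Submodule.subset_span ⟨i, rfl⟩

/-- If the left multiples of the generators are independent, then `(z_i) ↦ ∑ Y_i z_i` is injective,
and the dimension grows by the factor `card ι` in each step, as in a free algebra. -/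
theorem card_mul_finrank_assocSpan_le {ι E : Type} [Fintype ι] [Ring E] [Algebra ℂ E] (Y : ι → E)
    {n : ℕ} (h : ∀ z : ι → E, (∀ i, z i ∈ assocSpan (degOne Y) n) → ∑ i, Y i * z i = 0 → z = 0) :
    Fintype.card ι * Module.finrank ℂ (assocSpan (degOne Y) n) ≤
      Module.finrank ℂ (assocSpan (degOne Y) (n + 1)) := by
  have hfin := finiteDimensional_assocSpan (finiteDimensional_degOne Y)
  have := hfin n
  have := hfin (n + 1)
  let F : (ι → assocSpan (degOne Y) n) →ₗ[ℂ] assocSpan (degOne Y) (n + 1) :=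
    LinearMap.codRestrict _ (∑ i, LinearMap.mulLeft ℂ (Y i) ∘ₗ
      (assocSpan (degOne Y) n).subtype ∘ₗ LinearMap.proj i) fun z =>
      (mem_assocSpan_degOne_succ _).2 ⟨fun i => z i, fun i => (z i).2, by
        simp [LinearMap.sum_apply]⟩
  have hF : Function.Injective F := by
    refine (injective_iff_map_eq_zero F).2 fun z hz => ?_
    have h1 : ∑ i, Y i * (z i : E) = 0 := by
      have := congrArg Subtype.val hz
      simpa [F, LinearMap.sum_apply] using this
    exact funext fun i => Subtype.ext (congrFun (h (fun i => (z i : E)) (fun i => (z i).2) h1) i)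
  have h3 := LinearMap.finrank_le_finrank_of_injective hF
  rwa [Module.finrank_pi_fintype, Finset.sum_const, Finset.card_univ, smul_eq_mul] at h3

/-! ### Freeness of the algebra generated by the images of the inner generators -/

/-- The images of `y_1, …, y_b` under the representation. -/
def repInner (b : ℕ) (i : Fin b) : RepAlg := repGen b (i + 1)

theorem tailOp_mul_cutOp (b j k : ℕ) (hj : 2 ≤ j ∧ j ≤ b + 1) :
    tailOp j * cutOp b k = if j = k then 1 else 0 := by
  by_cases h : j = k
  · subst h
    rw [cutOp, if_pos hj, tailOp_mul_prependOp]
  · rw [cutOp]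
    split_ifs
    · rw [tailOp_mul_prependOp, if_neg h]
    · rw [mul_zero]

/-- The rows of `∑ y_i z_i` are obtained from the rows of the `z_i`. -/
theorem tailOp_mul_sum_repInner (b : ℕ) (z : Fin b → RepAlg) (i : Fin b) (m : Fin 2) :
    tailOp (i + 2) * (∑ j, repInner b j * z j) 0 m =
      z i 0 m + if h : (i : ℕ) + 1 < b then z ⟨i + 1, h⟩ 1 m else 0 := by
  rw [Matrix.sum_apply, Finset.mul_sum]
  have h : ∀ j : Fin b, tailOp (i + 2) * (repInner b j * z j) 0 m =
      (if j = i then z j 0 m else 0) + if (j : ℕ) = i + 1 then z j 1 m else 0 := by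
    intro j
    rw [Matrix.mul_apply, Fin.sum_univ_two, mul_add, ← mul_assoc, ← mul_assoc]
    change tailOp (i + 2) * cutOp b (j + 1 + 1) * _ + tailOp (i + 2) * cutOp b (j + 1) * _ = _
    rw [tailOp_mul_cutOp b _ _ (by omega), tailOp_mul_cutOp b _ _ (by omega)]
    congr 1
    · simp [Fin.ext_iff, eq_comm]
    · simp [eq_comm]
  rw [Finset.sum_congr rfl fun j _ => h j, Finset.sum_add_distrib, Finset.sum_ite_eq' _ i,
    if_pos (Finset.mem_univ i)]
  congr 1
  split_ifs with hi
  · rw [Finset.sum_eq_single ⟨i + 1, hi⟩]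
    · simp
    · intro j _ hj
      rw [if_neg fun h => hj (Fin.ext h)]
    · simp
  · refine Finset.sum_eq_zero fun j _ => if_neg ?_
    omega

/-- Applying `tailOp (i + 2)` to the first row of the sum gives the first row of `z_i` plus the
second row of `z_{i+1}`. The last `z_i` has no successor, so its first row vanishes and hence so
does `z_i`; descending induction on `i` yields the others. -/
theorem eq_zero_of_sum_repInner {b : ℕ} {M : Submodule ℂ RepAlg}
    (hM : ∀ x ∈ M, (∀ m, x 0 m = 0) → x = 0) {z : Fin b → RepAlg} (hz : ∀ i, z i ∈ M)
    (h : ∀ m, (∑ i, repInner b i * z i) 0 m = 0) : z = 0 := by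
  have key : ∀ r : ℕ, ∀ i : Fin b, b ≤ i + 1 + r → z i = 0 := by
    intro r
    induction r with
    | zero =>
      intro i hi
      refine hM _ (hz i) fun m => ?_
      have := tailOp_mul_sum_repInner b z i m
      rwa [h m, mul_zero, dif_neg (by omega), add_zero, eq_comm] at this
    | succ r ih =>
      intro i hi
      refine hM _ (hz i) fun m => ?_
      have := tailOp_mul_sum_repInner b z i m
      rw [h m, mul_zero] at this
      by_cases hib : (i : ℕ) + 1 < b
      · rw [dif_pos hib, ih ⟨i + 1, hib⟩ (by simp only []; omega), Matrix.zero_apply,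
          add_zero] at this
        exact this.symm
      · rw [dif_neg hib, add_zero] at this
        exact this.symm
  exact funext fun i => key b i (by omega)

/-- In degree zero there are only scalar matrices, which are determined by their first row. An
element of degree `n + 1` is a sum `∑ y_i z_i`, and the preceding lemma uses the assertion in degree
`n` to make all `z_i` vanish. -/
theorem eq_zero_of_mem_assocSpan_repInner {b n : ℕ} {x : RepAlg}
    (hx : x ∈ assocSpan (degOne (repInner b)) n) (h : ∀ m, x 0 m = 0) : x = 0 := by
  induction n generalizing x with
  | zero =>
    rw [assocSpan_zero, Submodule.mem_one] at hx
    obtain ⟨a, rfl⟩ := hx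
    have h0 := h 0
    rw [Matrix.algebraMap_matrix_apply, if_pos rfl] at h0
    rw [(algebraMap ℂ (Module.End ℂ (List ℕ → ℂ))).injective (h0.trans (map_zero _).symm), map_zero]
  | succ n ih =>
    obtain ⟨z, hz, rfl⟩ := (mem_assocSpan_degOne_succ _).1 hx
    rw [eq_zero_of_sum_repInner (fun x hx hx0 => ih hx hx0) hz h]
    simp

theorem pow_le_finrank_assocSpan_repInner (b n : ℕ) :
    b ^ n ≤ Module.finrank ℂ (assocSpan (degOne (repInner b)) n) := by
  induction n with
  | zero =>
    rw [assocSpan_zero, Submodule.one_eq_span, finrank_span_singleton one_ne_zero, pow_zero]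
  | succ n ih =>
    have h := card_mul_finrank_assocSpan_le (repInner b) (n := n) fun z hz h =>
      eq_zero_of_sum_repInner (fun x hx hx0 => eq_zero_of_mem_assocSpan_repInner hx hx0) hz
        (fun m => by rw [h, Matrix.zero_apply])
    rw [Fintype.card_fin] at h
    rw [pow_succ']
    exact (Nat.mul_le_mul_left b ih).trans h

theorem wordCount_single (b n : ℕ) : wordCount (fun k => if k = 1 then b else 0) n = b ^ n := by
  induction n with
  | zero => rw [wordCount, pow_zero]
  | succ n ih =>
    rw [wordCount, Fin.sum_univ_succ, Finset.sum_eq_zero fun i _ => by simp]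
    simp [ih, pow_succ']

/-- The series of `b` generators of degree one with `ε = -1` is `1 + bt`. -/
theorem lieCount_single (b : ℕ) {n : ℕ} (hn : n ≠ 0) :
    lieCount (fun k => if k = 1 then b else 0) n = (-1) ^ n * necklace n (-b) := by
  rw [lieCount, ← prodExponent_one_add_mul_X _ _ hn]
  congr 2
  ext k
  rw [genSeries, PowerSeries.coeff_mk, map_add, PowerSeries.coeff_C_mul, PowerSeries.coeff_X,
    PowerSeries.coeff_one]
  rcases eq_or_ne k 0 with rfl | hk
  · simp
  · rcases eq_or_ne k 1 with rfl | hk1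
    · simp
    · simp [hk, hk1]

theorem le_finrank_lieSpan_repInner (b : ℕ) {n : ℕ} (hn : n ≠ 0) :
    (-1) ^ n * necklace n (-b) ≤
      Module.finrank ℂ ((assocBracket RepAlg).lieSpan (degOne (repInner b)) n) := by
  rw [← lieCount_single b hn]
  refine GradedBracket.le_finrank_lieSpan n (d := 1) (r := n) one_pos (by omega)
    (fun k hk => if_neg (by omega)) (finiteDimensional_degOne _) (fun k => ?_) (fun m _ => ?_) hn
    le_rfl
  · simpa using finrank_degOne_le (repInner b) k
  · rw [wordCount_single]
    exact pow_le_finrank_assocSpan_repInner b m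

end

noncomputable section

/-! ### Graded Lie algebras with generators of degree one and quadratic relations -/

namespace PosGradedLie

theorem word_induction {ι : Type} {P : FreeNonUnitalNonAssocAlgebra ℂ ι → Prop}
    (word : ∀ w, P (word w)) (zero : P 0) (add : ∀ x y, P x → P y → P (x + y))
    (smul : ∀ (c : ℂ) x, P x → P (c • x)) (x : FreeNonUnitalNonAssocAlgebra ℂ ι) : P x := by
  have hx : x ∈ Submodule.span ℂ (Set.range (MonoidAlgebra.basis (FreeMagma ι) ℂ)) := by
    rw [Module.Basis.span_eq]
    trivial
  induction hx using Submodule.span_induction with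
  | mem x hx =>
    obtain ⟨w, rfl⟩ := hx
    exact word w
  | zero => exact zero
  | add x y _ _ hx hy => exact add x y hx hy
  | smul c x _ hx => exact smul c x hx

section eval

variable {ι E : Type} [AddCommGroup E] [Module ℂ E] (G : GradedBracket E) (Y : ι → E)

/-- The value of a nonassociative word in elements of degree one. -/
def wordValue : FreeMagma ι → E
  | .of i => Y i
  | .mul u v => G.br u.length v.length (wordValue u) (wordValue v)

theorem wordValue_mul (u v : FreeMagma ι) : wordValue G Y (u * v) =
    G.br u.length v.length (wordValue G Y u) (wordValue G Y v) := rfl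

variable {Y} in
theorem wordValue_mem_part (hY : ∀ i, Y i ∈ G.part 1) (w : FreeMagma ι) :
    wordValue G Y w ∈ G.part w.length := by
  induction w with
  | ih1 i => exact hY i
  | ih2 u v hu hv => exact G.br_mem hu hv

/-- The linear extension of the evaluation of words; the values of the words of length `n` are put
into the component of index `n`. -/
def gradedEval : FreeNonUnitalNonAssocAlgebra ℂ ι →ₗ[ℂ] (ℕ → E) :=
  (MonoidAlgebra.basis (FreeMagma ι) ℂ).constr ℂ fun w => Pi.single w.length (wordValue G Y w)

theorem gradedEval_word (w : FreeMagma ι) :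
    gradedEval G Y (word w) = Pi.single w.length (wordValue G Y w) :=
  Module.Basis.constr_basis _ _ _ _

/-- The bracket of `G` depends on the degree labels, and its components need not be independent in
`E`. Values in `ℕ → E` keep the lengths of words apart, and evaluation then becomes multiplicative
for the convolution of brackets. -/
theorem gradedEval_mul (x y : FreeNonUnitalNonAssocAlgebra ℂ ι) (n : ℕ) :
    gradedEval G Y (x * y) n = ∑ p ∈ Finset.HasAntidiagonal.antidiagonal n,
      G.br p.1 p.2 (gradedEval G Y x p.1) (gradedEval G Y y p.2) := by
  induction x using word_induction with
  | word u =>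
    induction y using word_induction with
    | word v =>
      rw [← word_mul, gradedEval_word, gradedEval_word, gradedEval_word, wordValue_mul]
      have h0 : ∀ p : ℕ × ℕ, p ≠ (u.length, v.length) → G.br p.1 p.2
          ((Pi.single u.length (wordValue G Y u) : ℕ → E) p.1)
          ((Pi.single v.length (wordValue G Y v) : ℕ → E) p.2) = 0 := by
        intro p hp
        by_cases h1 : p.1 = u.length
        · rw [Pi.single_eq_of_ne (i := v.length) (i' := p.2)
            (fun h2 => hp (Prod.ext h1 h2)), map_zero]
        · rw [Pi.single_eq_of_ne (i := u.length) (i' := p.1) h1, map_zero,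
            LinearMap.zero_apply]
      by_cases hn : n = u.length + v.length
      · subst hn
        rw [Finset.sum_eq_single (u.length, v.length) (fun p _ hp => h0 p hp)
          (fun h => absurd (Finset.HasAntidiagonal.mem_antidiagonal.2 rfl) h), Pi.single_eq_same,
          Pi.single_eq_same]
        exact Pi.single_eq_same _ _
      · rw [Finset.sum_eq_zero fun p hp => h0 p ?_]
        · exact Pi.single_eq_of_ne hn _
        · rintro rfl
          exact hn (Finset.HasAntidiagonal.mem_antidiagonal.1 hp).symm
    | zero => simp
    | add x y hx hy => simp [mul_add, hx, hy, Finset.sum_add_distrib]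
    | smul c x hx => rw [mul_smul_comm]; simp [hx, Finset.smul_sum]
  | zero => simp
  | add x y hx hy => simp [add_mul, hx, hy, Finset.sum_add_distrib]
  | smul c x hx => rw [smul_mul_assoc]; simp [hx, Finset.smul_sum]

variable {Y}

theorem lieSpan_degOne_le_span_wordValue (n : ℕ) : G.lieSpan (degOne Y) n ≤
    Submodule.span ℂ {x | ∃ w : FreeMagma ι, w.length = n ∧ wordValue G Y w = x} := by
  refine G.lieSpan_le (K := fun n =>
    Submodule.span ℂ {x | ∃ w : FreeMagma ι, w.length = n ∧ wordValue G Y w = x}) ?_ ?_ n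
  · intro k
    rcases eq_or_ne k 1 with rfl | hk
    · rw [degOne_one, Submodule.span_le]
      rintro _ ⟨i, rfl⟩
      exact Submodule.subset_span ⟨.of i, rfl, rfl⟩
    · rw [degOne_of_ne Y hk]
      exact bot_le
  · intro i j x hx y hy
    have := Submodule.apply_mem_map₂ (G.br i j) hx hy
    rw [Submodule.map₂_span_span] at this
    refine Submodule.span_mono ?_ this
    rintro _ ⟨_, ⟨u, rfl, rfl⟩, _, ⟨v, rfl, rfl⟩, rfl⟩
    exact ⟨u * v, rfl, rfl⟩

variable [Fintype ι] {Q : Set (ι → ι → ℂ)}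

/-- By multiplicativity the kernel of the evaluation is a two-sided ideal, so only the relators have
to be tested, and these are the identities of `G` and the hypothesis `hQ`. -/
theorem relatorIdeal_le_ker (hY : ∀ i, Y i ∈ G.part 1)
    (hQ : ∀ g ∈ Q, ∑ i, ∑ j, g i j • G.br 1 1 (Y i) (Y j) = 0) :
    relatorIdeal Q ≤ LinearMap.ker (gradedEval G Y) := by
  refine sInf_le ⟨fun x hx => ?_, fun x hx y => ⟨?_, ?_⟩⟩
  · have hval := wordValue_mem_part G hY
    rw [LinearMap.mem_ker]
    cases hx with
    | skew u v =>
      rw [map_add, map_smul, ← word_mul, ← word_mul, gradedEval_word, gradedEval_word]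
      have h1 : (v * u).length = (u * v).length := add_comm _ _
      rw [h1, ← Pi.single_smul, ← Pi.single_add, wordValue_mul, wordValue_mul,
        G.skew (hval u) (hval v), neg_add_cancel, Pi.single_zero]
    | jacobi u v w =>
      rw [map_sub, map_sub, map_smul, ← word_mul, ← word_mul, ← word_mul, ← word_mul, ← word_mul,
        ← word_mul, gradedEval_word, gradedEval_word, gradedEval_word]
      have h1 : (u * v * w).length = (u * (v * w)).length := add_assoc _ _ _
      have h2 : (v * (u * w)).length = (u * (v * w)).length := add_left_comm _ _ _
      rw [h1, h2, ← Pi.single_smul, ← Pi.single_sub, ← Pi.single_sub]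
      simp only [wordValue_mul]
      have h3 := G.jacobi (hval u) (hval v) (hval w)
      have h4 : ∀ a c : FreeMagma ι, (a * c).length = a.length + c.length := fun _ _ => rfl
      rw [h4 v w, h3, h4 u v, h4 u w, add_sub_cancel_left, sub_self, Pi.single_zero]
    | quadratic g hg =>
      rw [map_sum]
      simp only [map_sum, map_smul, ← word_mul, gradedEval_word]
      have h1 := congrArg (fun x => (Pi.single 2 x : ℕ → E)) (hQ g hg)
      rw [Pi.single_zero] at h1
      rw [← h1, ← LinearMap.single_apply ℂ, map_sum]
      refine Finset.sum_congr rfl fun i _ => ?_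
      rw [map_sum]
      refine Finset.sum_congr rfl fun j _ => ?_
      rw [map_smul]
      rfl
  · funext n
    rw [gradedEval_mul, LinearMap.mem_ker.1 hx]
    simp
  · funext n
    rw [gradedEval_mul, LinearMap.mem_ker.1 hx]
    simp

/-- A graded Lie algebra with elements of degree one that satisfy the quadratic relations bounds
the dimensions of the components of the universal one from below. -/
theorem finrank_lieSpan_le_finrank_presentedPart (hY : ∀ i, Y i ∈ G.part 1)
    (hQ : ∀ g ∈ Q, ∑ i, ∑ j, g i j • G.br 1 1 (Y i) (Y j) = 0) {V : ℕ → Submodule ℂ E}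
    (hV : V ≤ degOne Y) (n : ℕ) :
    Module.finrank ℂ (G.lieSpan V n) ≤ Module.finrank ℂ (presentedPart Q n) := by
  let F : PresentedCarrier Q →ₗ[ℂ] E := LinearMap.proj n ∘ₗ
    (relatorIdeal Q).liftQ (gradedEval G Y) (relatorIdeal_le_ker G hY hQ)
  have h1 : G.lieSpan V n ≤ (presentedPart Q n).map F := by
    refine (G.lieSpan_le (hV.trans (G.le_lieSpan _)) (G.lieSpan_closed _) n).trans
      ((lieSpan_degOne_le_span_wordValue G n).trans ?_)
    rw [Submodule.span_le]
    rintro _ ⟨w, rfl, rfl⟩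
    refine ⟨_, Submodule.subset_span ⟨w, rfl, rfl⟩, ?_⟩
    change gradedEval G Y (word w) w.length = _
    rw [gradedEval_word, Pi.single_eq_same]
  exact (Submodule.finrank_mono h1).trans (Submodule.finrank_map_le _ _)

end eval

section presented

variable {ι : Type} [Fintype ι] (Q : Set (ι → ι → ℂ))

/-- The bracket of the graded Lie algebra with given quadratic relations. -/
def presentedBracket : GradedBracket (PresentedCarrier Q) where
  part := presentedPart Q
  br _ _ := presentedMul Q
  br_mem hx hy := presentedMul_mem Q rfl hx hy
  skew hx hy := presentedMul_skew Q hx hy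
  jacobi hx hy hz := presentedMul_jacobi Q hx hy hz

/-- The generators of the graded Lie algebra with given quadratic relations. -/
def presentedGen (i : ι) : PresentedCarrier Q := (relatorIdeal Q).mkQ (word (.of i))

theorem presentedPart_one : presentedPart Q 1 = Submodule.span ℂ (Set.range (presentedGen Q)) := by
  rw [presentedPart]
  congr 1
  ext x
  constructor
  · rintro ⟨w | ⟨u, v⟩, hw, rfl⟩
    · exact ⟨_, rfl⟩
    · have hw' : u.length + v.length = 1 := hw
      have := u.length_pos
      have := v.length_pos
      omega
  · rintro ⟨i, rfl⟩
    exact ⟨.of i, rfl, rfl⟩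

theorem presentedGen_mem (i : ι) : presentedGen Q i ∈ presentedPart Q 1 := by
  rw [presentedPart_one]
  exact Submodule.subset_span ⟨i, rfl⟩

theorem finrank_presentedPart_one : Module.finrank ℂ (presentedPart Q 1) = Fintype.card ι := by
  classical
  refine le_antisymm ?_ ?_
  · rw [presentedPart_one]
    exact finrank_range_le_card _
  -- The abelian Lie algebra `ℂ^ι` satisfies every quadratic relation, so the generators remain
  -- independent in the quotient.
  · let G : GradedBracket (ι → ℂ) :=
      { part := fun _ => ⊤
        br := fun _ _ => 0
        br_mem := fun _ _ => trivial
        skew := fun _ _ => by simp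
        jacobi := fun _ _ _ => by simp }
    have h1 := finrank_lieSpan_le_finrank_presentedPart (Q := Q) G
      (Y := fun i => (Pi.single i 1 : ι → ℂ)) (fun _ => trivial) (fun g _ => by simp [G])
      (V := degOne _) le_rfl 1
    have h2 := Submodule.finrank_mono (G.le_lieSpan (degOne fun i => (Pi.single i 1 : ι → ℂ)) 1)
    have h3 : degOne (fun i => (Pi.single i 1 : ι → ℂ)) 1 = ⊤ := by
      rw [degOne_one, ← (Pi.basisFun ℂ ι).span_eq]
      congr 2
    rw [h3, finrank_top, Module.finrank_fintype_fun_eq_card] at h2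
    exact h2.trans h1

theorem presentedPart_le {K : ℕ → Submodule ℂ (PresentedCarrier Q)}
    (h : ∀ i, presentedGen Q i ∈ K 1) (hK : (presentedBracket Q).Closed K) :
    presentedPart Q ≤ K := by
  intro n
  rw [presentedPart, Submodule.span_le]
  rintro _ ⟨w, rfl, rfl⟩
  induction w with
  | ih1 i => exact h i
  | ih2 u v hu hv =>
    rw [word_mul]
    exact hK _ _ _ hu _ hv

/-- If the brackets of generators are in the Lie subalgebra generated by a set of elements of degree
one, then so are all elements of degree at least two. -/
theorem presentedPart_le_lieSpan {V : ℕ → Submodule ℂ (PresentedCarrier Q)}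
    (hV : V ≤ presentedPart Q) (hV1 : ∀ k, k ≠ 1 → V k = ⊥)
    (h : ∀ i j, presentedMul Q (presentedGen Q i) (presentedGen Q j) ∈
      (presentedBracket Q).lieSpan V 2) {n : ℕ} (hn : 2 ≤ n) :
    presentedPart Q n ≤ (presentedBracket Q).lieSpan V n := by
  have hS0 : (presentedBracket Q).lieSpan V 0 = ⊥ :=
    (presentedBracket Q).lieSpan_eq_bot (N := 0) (fun k hk => hV1 k (by omega)) le_rfl
  have hSP := (presentedBracket Q).lieSpan_le_part hV
  have h11 : ∀ x ∈ presentedPart Q 1, ∀ y ∈ presentedPart Q 1,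
      presentedMul Q x y ∈ (presentedBracket Q).lieSpan V 2 := by
    intro x hx y hy
    rw [presentedPart_one] at hx hy
    have := Submodule.apply_mem_map₂ (presentedMul Q) hx hy
    rw [Submodule.map₂_span_span] at this
    refine (Submodule.span_le.2 ?_) this
    rintro _ ⟨_, ⟨i, rfl⟩, _, ⟨j, rfl⟩, rfl⟩
    exact h i j
  -- Every `ad x` with `x` of degree one maps `V` into the subalgebra generated by `V`, and
  -- therefore preserves this subalgebra.
  have h1 : ∀ x ∈ presentedPart Q 1, ∀ {j}, ∀ y ∈ (presentedBracket Q).lieSpan V j,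
      presentedMul Q x y ∈ (presentedBracket Q).lieSpan V (1 + j) := by
    intro x hx j y hy
    refine (presentedBracket Q).br_mem_lieSpan hx hV (fun k y hy => ?_) hy
    rcases eq_or_ne k 1 with rfl | hk
    · exact h11 x hx y (hV 1 hy)
    · rw [hV1 k hk, Submodule.mem_bot] at hy
      rw [hy, map_zero]
      exact Submodule.zero_mem _
  -- The subalgebra, with its component of degree one enlarged to all of `L_1`, is closed under the
  -- bracket and contains all generators, so it is everything. The case distinctions that follow
  -- exclude sums equal to one, where a factor would have degree zero.
  have h2 := presentedPart_le Q
    (K := fun k => if k = 1 then presentedPart Q 1 else (presentedBracket Q).lieSpan V k)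
    (fun i => by rw [if_pos rfl]; exact presentedGen_mem Q i) (by
      intro i j x hx y hy
      change presentedMul Q x y ∈ _
      dsimp only at hx hy ⊢
      by_cases hi : i = 1 <;> by_cases hj : j = 1
      · subst hi hj
        exact h11 x hx y hy
      · subst hi
        rw [if_pos rfl] at hx
        rw [if_neg hj] at hy
        split_ifs with h
        · obtain rfl : j = 0 := by omega
          rw [hS0, Submodule.mem_bot] at hy
          rw [hy, map_zero]
          exact Submodule.zero_mem _
        · exact h1 x hx y hy
      · subst hj
        rw [if_neg hi] at hx
        rw [if_pos rfl] at hy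
        rw [presentedMul_skew Q (hSP _ hx) hy]
        split_ifs with h
        · obtain rfl : i = 0 := by omega
          rw [hS0, Submodule.mem_bot] at hx
          rw [hx, map_zero, smul_zero, neg_zero]
          exact Submodule.zero_mem _
        · rw [add_comm]
          exact Submodule.neg_mem _ (Submodule.smul_mem _ _ (h1 y hy x hx))
      · rw [if_neg hi] at hx
        rw [if_neg hj] at hy
        split_ifs with h
        · rcases Nat.eq_zero_or_pos i with rfl | hi'
          · rw [hS0, Submodule.mem_bot] at hx
            rw [hx, map_zero, LinearMap.zero_apply]
            exact Submodule.zero_mem _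
          · omega
        · exact (presentedBracket Q).lieSpan_closed V i j x hx y hy) n
  dsimp only at h2
  rwa [if_neg (by omega)] at h2

end presented

end PosGradedLie

end

noncomputable section

/-! ### The dimensions of the components of the Koszul dual Lie algebra of the Veronese ring -/

section veronese

open PosGradedLie

/-- The quadratic relations of the Koszul dual Lie algebra of the Veronese ring. -/
abbrev veroneseRelations (b : ℕ) : Set (Fin (b + 2) → Fin (b + 2) → ℂ) :=
  quadraticAnnihilator (veroneseIdeal b)

variable {b : ℕ}

theorem sum_smul_eq_zero_of_mem_quadraticAnnihilator {E : Type} [AddCommGroup E] [Module ℂ E]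
    {B : Fin (b + 2) → Fin (b + 2) → E}
    (hB : ∀ k : ℕ, ∑ i : Fin (b + 2), ∑ j : Fin (b + 2),
      (if (i : ℕ) + j = k then (1 : ℂ) else 0) • B i j = 0)
    {g : Fin (b + 2) → Fin (b + 2) → ℂ} (hg : g ∈ quadraticAnnihilator (veroneseIdeal b)) :
    ∑ i, ∑ j, g i j • B i j = 0 := by
  rw [quadraticAnnihilator_veroneseIdeal] at hg
  induction hg using Submodule.span_induction with
  | mem g hg =>
    obtain ⟨k, rfl⟩ := hg
    exact hB k
  | zero => simp
  | add g h _ _ hg hh => simp [add_smul, Finset.sum_add_distrib, hg, hh]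
  | smul c g _ hg => simp [mul_smul, ← Finset.smul_sum, hg]

theorem le_finrank_veroneseLie {n : ℕ} (hn : n ≠ 0) :
    (-1) ^ n * necklace n (-b) ≤ Module.finrank ℂ
      (presentedPart (veroneseRelations b) n) := by
  refine (le_finrank_lieSpan_repInner b hn).trans (Nat.cast_le.2 ?_)
  refine finrank_lieSpan_le_finrank_presentedPart (assocBracket RepAlg)
    (Y := fun i : Fin (b + 2) => repGen b i) (fun _ => trivial) (fun g hg => ?_) (fun k => ?_) n
  · refine sum_smul_eq_zero_of_mem_quadraticAnnihilator (fun k => ?_) hg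
    -- In degree one the signed commutator is `xy + yx`, so the relation is the sum of the one for
    -- products and its transpose.
    have h1 := sum_repGen_mul b k
    have h2 := sum_repGen_mul b k
    rw [Finset.sum_comm] at h2
    have h3 := congrArg₂ (· + ·) h1 h2
    simp only [← Finset.sum_add_distrib, add_zero] at h3
    rw [← h3]
    refine Finset.sum_congr rfl fun i _ => Finset.sum_congr rfl fun j _ => ?_
    rw [GradedBracket.assocBracket_apply, add_comm (j : ℕ)]
    module
  · rcases eq_or_ne k 1 with rfl | hk
    · rw [degOne_one, degOne_one]
      refine Submodule.span_mono ?_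
      rintro _ ⟨i, rfl⟩
      exact ⟨⟨i + 1, by omega⟩, rfl⟩
    · rw [degOne_of_ne _ hk]
      exact bot_le

/-- If `p` or `q` is `0` or `b + 1`, then every other unordered pair with the same sum consists of
inner indices, so the relation of index `p + q` expresses `[y_p, y_q]` through brackets of inner
generators. -/
theorem presentedMul_presentedGen_mem (p q : Fin (b + 2)) :
    presentedMul (veroneseRelations b)
        (presentedGen _ p) (presentedGen _ q) ∈
      (presentedBracket _).lieSpan
        (degOne fun i : Fin b => presentedGen _ ⟨i + 1, by omega⟩) 2 := by
  set Q := veroneseRelations b with hQ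
  set S := (presentedBracket Q).lieSpan
    (degOne fun i : Fin b => presentedGen Q ⟨i + 1, by omega⟩) with hS
  have hgen : ∀ i : Fin (b + 2), (i : ℕ) ≠ 0 → (i : ℕ) ≠ b + 1 → presentedGen Q i ∈ S 1 := by
    intro i h0 h1
    refine GradedBracket.le_lieSpan _ _ 1 ?_
    rw [degOne_one]
    have hi : (⟨(i : ℕ) - 1 + 1, by omega⟩ : Fin (b + 2)) = i :=
      Fin.ext (Nat.sub_add_cancel (Nat.pos_of_ne_zero h0))
    exact Submodule.subset_span ⟨⟨i - 1, by omega⟩, congrArg (presentedGen Q) hi⟩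
  have hinner : ∀ i j : Fin (b + 2), (i : ℕ) ≠ 0 → (i : ℕ) ≠ b + 1 → (j : ℕ) ≠ 0 →
      (j : ℕ) ≠ b + 1 → presentedMul Q (presentedGen Q i) (presentedGen Q j) ∈ S 2 :=
    fun i j hi hi' hj hj' =>
      GradedBracket.lieSpan_closed _ _ 1 1 _ (hgen i hi hi') _ (hgen j hj hj')
  by_cases hpq : (p : ℕ) ≠ 0 ∧ (p : ℕ) ≠ b + 1 ∧ (q : ℕ) ≠ 0 ∧ (q : ℕ) ≠ b + 1
  · exact hinner p q hpq.1 hpq.2.1 hpq.2.2.1 hpq.2.2.2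
  · have hskew : presentedMul Q (presentedGen Q q) (presentedGen Q p) =
        presentedMul Q (presentedGen Q p) (presentedGen Q q) := by
      rw [presentedMul_skew Q (presentedGen_mem Q q) (presentedGen_mem Q p)]
      simp
    -- Modulo the subalgebra only the terms `(p, q)` and `(q, p)` survive, and they are equal
    -- because the bracket is symmetric in degree one. Their number is kept as a natural number,
    -- which is nonzero since `(p, q)` itself is counted; no distinction between `p = q` and `p ≠ q`
    -- is needed.
    have hterm : ∀ i j : Fin (b + 2), (if (i : ℕ) + j = p + q then (1 : ℂ) else 0) •
        (S 2).mkQ (presentedMul Q (presentedGen Q i) (presentedGen Q j)) =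
        ((if (i = p ∧ j = q) ∨ (i = q ∧ j = p) then 1 else 0 : ℕ) : ℂ) •
        (S 2).mkQ (presentedMul Q (presentedGen Q p) (presentedGen Q q)) := by
      intro i j
      by_cases h1 : (i = p ∧ j = q) ∨ (i = q ∧ j = p)
      · rw [if_pos h1]
        rcases h1 with ⟨rfl, rfl⟩ | ⟨rfl, rfl⟩
        · simp
        · rw [if_pos (add_comm _ _), hskew, Nat.cast_one]
      · rw [if_neg h1, Nat.cast_zero, zero_smul]
        split_ifs with h2
        · have h3 : ¬(((i : ℕ) = p ∧ (j : ℕ) = q) ∨ ((i : ℕ) = q ∧ (j : ℕ) = p)) := by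
            simpa only [Fin.ext_iff] using h1
          rw [one_smul, Submodule.mkQ_apply, Submodule.Quotient.mk_eq_zero]
          exact hinner i j (by omega) (by omega) (by omega) (by omega)
        · rw [zero_smul]
    have hrel : ∑ i : Fin (b + 2), ∑ j : Fin (b + 2), (if (i : ℕ) + j = p + q then (1 : ℂ) else 0) •
        presentedMul Q (presentedGen Q i) (presentedGen Q j) = 0 := by
      have hg : (fun i j : Fin (b + 2) => if (i : ℕ) + j = p + q then (1 : ℂ) else 0) ∈ Q :=
        fun r hr => sum_antidiagonal_eq_zero_of_mem hr _
      have h1 := relatorIdeal_of Q (IsRelator.quadratic _ hg)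
      rw [← Submodule.Quotient.mk_eq_zero, ← Submodule.mkQ_apply] at h1
      simp only [map_sum, map_smul] at h1
      exact h1
    have h2 := congrArg (S 2).mkQ hrel
    simp only [map_sum, map_smul, map_zero] at h2
    rw [Finset.sum_congr rfl fun i _ => Finset.sum_congr rfl fun j _ => hterm i j] at h2
    simp only [← Finset.sum_smul, ← Nat.cast_sum] at h2
    rw [← Submodule.Quotient.mk_eq_zero, ← Submodule.mkQ_apply]
    refine (smul_eq_zero.1 h2).resolve_left (Nat.cast_ne_zero.2 fun h => ?_)
    have h3 := Finset.sum_eq_zero_iff.1 (Finset.sum_eq_zero_iff.1 h p (Finset.mem_univ p)) q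
      (Finset.mem_univ q)
    simp at h3

/-- From degree two on, the whole component lies in the subalgebra generated by the `b` inner
generators, to which the bound by elimination applies. -/
theorem finrank_veroneseLie_le {n : ℕ} (hn : 2 ≤ n) :
    (Module.finrank ℂ (presentedPart (veroneseRelations b) n) : ℚ) ≤ (-1) ^ n * necklace n (-b) := by
  set Q := veroneseRelations b with hQ
  have hV : degOne (fun i : Fin b => presentedGen Q ⟨i + 1, by omega⟩) ≤ presentedPart Q := by
    intro k
    rcases eq_or_ne k 1 with rfl | hk
    · rw [degOne_one, Submodule.span_le]
      rintro _ ⟨i, rfl⟩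
      exact presentedGen_mem Q _
    · rw [degOne_of_ne _ hk]
      exact bot_le
  rw [← lieCount_single b (by omega)]
  have h1 := presentedPart_le_lieSpan Q hV (fun k hk => degOne_of_ne _ hk)
    presentedMul_presentedGen_mem hn
  have hfin : ∀ k, FiniteDimensional ℂ ((presentedBracket Q).part k) := presentedPart_finite Q
  have h2 : FiniteDimensional ℂ ((presentedBracket Q).lieSpan
      (degOne fun i : Fin b => presentedGen Q ⟨i + 1, by omega⟩) n) :=
    Submodule.finiteDimensional_of_le ((presentedBracket Q).lieSpan_le_part hV n)
  refine (Nat.cast_le.2 (Submodule.finrank_mono h1)).trans ?_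
  refine (presentedBracket Q).finrank_lieSpan_le hfin n (d := 1)
    (r := n) one_pos (by omega) (fun k hk => if_neg (by omega)) hV (fun k => ?_) (by omega) le_rfl
  simpa using finrank_degOne_le (fun i : Fin b => presentedGen Q ⟨i + 1, by omega⟩) k

variable (b)

theorem necklace_one (x : ℚ) : necklace 1 x = x := by simp [necklace]

/-- The dimensions of the components of the Koszul dual Lie algebra of the Veronese ring. -/
theorem neg_one_pow_mul_finrank_veroneseLie {n : ℕ} (hn : n ≠ 0) :
    (((-1) ^ n * (Module.finrank ℂ ((veroneseLie b).part n) : ℤ) : ℤ) : ℚ) =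
      necklace n (-b) - if n = 1 then 2 else 0 := by
  have h : Module.finrank ℂ ((veroneseLie b).part n) = Module.finrank ℂ
      (presentedPart (veroneseRelations b) n) := rfl
  push_cast
  rcases eq_or_ne n 1 with rfl | h1
  -- The two outer generators matter only in degree one, where `-(b + 2) = M_1(-b) - 2`; this is the
  -- source of the factor `(1 - t)⁻²`.
  · rw [h, finrank_presentedPart_one, necklace_one, if_pos rfl, Fintype.card_fin]
    push_cast
    ring
  · rw [if_neg h1, sub_zero, h, le_antisymm (finrank_veroneseLie_le (by omega))
      (le_finrank_veroneseLie hn), ← mul_assoc, ← mul_pow]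
    simp

theorem prodExponent_one_add_natCast_mul_X {n : ℕ} (hn : n ≠ 0) :
    prodExponent (PowerSeries.map (Int.castRingHom ℚ) (1 + (b : PowerSeries ℤ) * PowerSeries.X)) n =
      necklace n (-b) := by
  rw [← prodExponent_one_add_mul_X _ _ hn]
  simp

theorem prodExponent_mul_oneSubPow {n : ℕ} (hn : n ≠ 0) :
    prodExponent (PowerSeries.map (Int.castRingHom ℚ)
      ((1 + (b : PowerSeries ℤ) * PowerSeries.X) * oneSubPow 1 (-2))) n =
      necklace n (-b) - if n = 1 then 2 else 0 := by
  have h := unitExponent_oneSubUnit_zpow 1 (-2) hn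
  rw [unitExponent_apply] at h
  rw [oneSubPow, map_mul, prodExponent_mul (by simp) (constantCoeff_unit_ne_zero _),
    prodExponent_one_add_natCast_mul_X b hn, h, sub_eq_add_neg]
  congr 1
  split_ifs <;> simp_all

theorem constantCoeff_oneSubPow (n : ℕ+) (e : ℤ) :
    PowerSeries.constantCoeff (oneSubPow n e) = 1 := by
  have h : Units.map (PowerSeries.constantCoeff (R := ℤ)).toMonoidHom (oneSubUnit n) = 1 := by
    ext
    simp [oneSubUnit]
  have h2 := congrArg Units.val
    (map_zpow (Units.map (PowerSeries.constantCoeff (R := ℤ)).toMonoidHom) (oneSubUnit n) e)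
  rw [h, one_zpow] at h2
  exact h2

theorem hasProd_eulerHilbertSeries (L : PosGradedLie) :
    HasProd (fun n : ℕ+ => oneSubPow n
      ((-1) ^ (n : ℕ) * (Module.finrank ℂ (L.part n) : ℤ)))
      (eulerHilbertSeries L.chevalleyComplex) :=
  hasProd_oneSubPow L.constantCoeff_eulerHilbertSeries fun n =>
    L.prodExponent_eulerHilbertSeries n.ne_zero

/-- Both series are limits of one and the same infinite product, since their exponents agree. -/
theorem eulerHilbertSeries_veroneseLie : eulerHilbertSeries (veroneseLie b).chevalleyComplex =
    (1 + (b : PowerSeries ℤ) * PowerSeries.X) * oneSubPow 1 (-2) :=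
  (hasProd_eulerHilbertSeries (veroneseLie b)).unique <|
    hasProd_oneSubPow (by simp [constantCoeff_oneSubPow]) fun n => by
      rw [prodExponent_mul_oneSubPow b n.ne_zero,
        neg_one_pow_mul_finrank_veroneseLie b n.ne_zero]

end veronese

end

/-! ### The main theorem -/

theorem mainTheorem10 (b : ℕ) :
    (∀ n a : ℕ, FiniteDimensional ℂ (((veroneseLie b).chevalleyComplex n).X a)) ∧
    (∀ n a : ℕ, n < a → Subsingleton (((veroneseLie b).chevalleyComplex n).X a)) ∧
    HasProd
      (fun n : ℕ+ => oneSubPow n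
        ((-1) ^ (n : ℕ) * (Module.finrank ℂ ((veroneseLie b).part n) : ℤ)))
      (eulerHilbertSeries (veroneseLie b).chevalleyComplex) ∧
    (∃ M : ℕ+ → ℤ, (∀ n : ℕ+, (M n : ℚ) = necklace n (-(b : ℚ))) ∧
      ∃ P : PowerSeries ℤ, HasProd (fun n : ℕ+ => oneSubPow n (M n)) P ∧
        eulerHilbertSeries (veroneseLie b).chevalleyComplex = oneSubPow 1 (-2) * P) ∧
    eulerHilbertSeries (veroneseLie b).chevalleyComplex =
      (1 + (b : PowerSeries ℤ) * PowerSeries.X) * oneSubPow 1 (-2) ∧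
    eulerHilbertSeries (veroneseLie b).chevalleyComplex = veroneseHilbertSeries b := by
  refine ⟨fun n a => (veroneseLie b).finiteDimensional_bipart a n, fun n a h => ?_,
    hasProd_eulerHilbertSeries _, ?_, eulerHilbertSeries_veroneseLie b, ?_⟩
  · have h1 := (veroneseLie b).bipart_eq_bot (Nat.cast_lt.2 h : (n : ℤ) < a)
    exact Submodule.subsingleton_iff_eq_bot.2 h1
  -- Integrality of `M_n(-b)` comes from its meaning as a signed dimension, corrected by `2` for `n
  -- = 1`. The product of the `(1 - t^n)^{M_n(-b)}` is `1 + bt`.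
  · have hM : ∀ n : ℕ+, (((-1) ^ (n : ℕ) * (Module.finrank ℂ ((veroneseLie b).part n) : ℤ) +
        (if (n : ℕ) = 1 then 2 else 0) : ℤ) : ℚ) = necklace n (-(b : ℚ)) := fun n => by
      rw [Int.cast_add, neg_one_pow_mul_finrank_veroneseLie b n.ne_zero]
      split_ifs <;> simp
    refine ⟨_, hM, 1 + (b : PowerSeries ℤ) * PowerSeries.X,
      hasProd_oneSubPow (by simp) fun n => ?_, ?_⟩
    · rw [hM, prodExponent_one_add_natCast_mul_X b n.ne_zero]
    · rw [eulerHilbertSeries_veroneseLie, mul_comm]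
  · rw [eulerHilbertSeries_veroneseLie, veroneseHilbertSeries_eq]
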